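/- Let $\mathbb{C}\{x,y\}$ be the ring of convergent power series at the origin of $\mathbb{C}^2$, with $\nu(H)$ denoting the multiplicity of $H$ at the origin. Let $S:\{f=0\}$ be a singular plane branch, i.e. $f\in\mathbb{C}\{x,y\}$ is irreducible with $\nu:=\nu(f)\ge 2$. The linear coordinates $(x,y)$ are chosen (as is always possible) so that the tangent line of $S$ is not $x=0$; the homogeneous part of degree $\nu$ of $f$ is then $c\,(y+\epsilon x)^{\nu}$ with $c\in\mathbb{C}\setminus\{0\}$, $\epsilon\in\mathbb{C}$. Let $\Omega^1(S)$ be the $\mathbb{C}\{x,y\}$-module of all holomorphic $1$-forms $\omega=A\,dx+B\,dy$ ($A,B\in\mathbb{C}\{x,y\}$) such that $f$ divides $\omega\wedge df$, i.e. $f \mid A\,\partial f/\partial y-B\,\partial f/\partial x$, and put $\nu(\omega)=\min\{\nu(A),\nu(B)\}$. Writing $H^{(d)}$ for the homogeneous part of degree $d$ of $H$, define for $\omega\in\Omega^1(S)\setminus\{0\}$ $$i(\omega)=\text{multiplicity at } y_1=-\epsilon \text{ of } A^{(\nu(\omega))}(1,y_1)+y_1B^{(\nu(\omega))}(1,y_1)\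 \in\ \mathbb{N}\cup\{\infty\}$$ ($\infty$ if this polynomial is zero), and $\mathfrak{i}(S)=\min_{\omega\in\Omega^1(S)\setminus\{0\}} i(\omega)$. Let $\widetilde S$ be the strict transform of $S$ under the blowing-up of the origin, i.e. the germ at the point $(x_1,y_1)=(0,-\epsilon)$ of the curve $\widetilde f=0$, where $f(x_1,x_1y_1)=x_1^{\nu}\,\widetilde f(x_1,y_1)$. For a curve germ $g=0$ let $\mu$ and $\tau$ be the complex dimensions of the quotients of the local ring by $(\partial g/\partial x,\partial g/\partial y)$ and by $(g,\partial g/\partial x,\partial g/\partial y)$, respectively; write $\mu,\tau$ for those of $S$ and $\widetilde\mu,\widetilde\tau$ for those of $\widetilde S$. Suppose that $S$ admits a good Saito basis, i.e. $\Omega^1(S)$ has a basis $\{\omega_1,\omega_2\}$ over $\mathbb{C}\{x,y\}$ with $\nu_1+\nu_2=\nu$, where $\nu_i=\nu(\omega_i)$. Then $\mu$, $\tau$, $\widetilde\mu$, $\widetilde\tau$ and $\mathfrak{i}(S)$ are finite, and for any such basis $$\mu-\tau=(\widetilde\mu-\widetilde\tau)+(\nu_1-1)(\nu_2-1)+\mathfrak{i}(S)-1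 .$$ -/

import Mathlib

noncomputable section

namespace PlaneBranch

open MvPowerSeries

/-- A formal power series in `x = X 0`, `y = X 1` is convergent if its coefficients satisfy a
Cauchy estimate `|a_n| ≤ c K ^ |n|`, i.e. if it converges near the origin. -/
def IsConvergent (f : MvPowerSeries (Fin 2) ℂ) : Prop :=
  ∃ c K : ℝ, 0 < K ∧ ∀ n : Fin 2 →₀ ℕ, ‖coeff n f‖ ≤ c * K ^ n.degree

theorem IsConvergent.add {f g : MvPowerSeries (Fin 2) ℂ} (hf : IsConvergent f)
    (hg : IsConvergent g) : IsConvergent (f + g) := by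
  obtain ⟨c, K, hK, h⟩ := hf
  obtain ⟨c', K', hK', h'⟩ := hg
  have hc : 0 ≤ c := by simpa using (norm_nonneg _).trans (h 0)
  have hc' : 0 ≤ c' := by simpa using (norm_nonneg _).trans (h' 0)
  refine ⟨c + c', max K K', lt_max_of_lt_left hK, fun n => ?_⟩
  have h1 : c * K ^ n.degree ≤ c * max K K' ^ n.degree := by
    gcongr; exact le_max_left _ _
  have h2 : c' * K' ^ n.degree ≤ c' * max K K' ^ n.degree := by
    gcongr; exact le_max_right _ _
  calc ‖coeff n (f + g)‖ ≤ ‖coeff n f‖ + ‖coeff n g‖ := by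
        rw [map_add]; exact norm_add_le _ _
    _ ≤ _ := by linarith [h n, h' n]

theorem card_antidiagonal_le (n : Fin 2 →₀ ℕ) :
    ((Finset.HasAntidiagonal.antidiagonal n).card : ℝ) ≤ 4 ^ n.degree := by
  have h1 : (Finset.HasAntidiagonal.antidiagonal n).card ≤
      (Finset.range (n.degree + 1) ×ˢ Finset.range (n.degree + 1)).card := by
    refine Finset.card_le_card_of_injOn (fun p => (p.1 0, p.1 1)) ?_ ?_
    · intro p hp
      have hp' : p.1 + p.2 = n := by simpa using hp
      have h0 : p.1 0 + p.2 0 = n 0 := by rw [← hp']; rfl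
      have h1 : p.1 1 + p.2 1 = n 1 := by rw [← hp']; rfl
      have hd : n.degree = n 0 + n 1 := by
        simp [Finsupp.degree_eq_sum, Fin.sum_univ_two]
      simp only [Finset.coe_product, Finset.coe_range, Set.mem_prod, Set.mem_Iio]
      omega
    · intro p hp q hq hpq
      have hp' : p.1 + p.2 = n := by simpa using hp
      have hq' : q.1 + q.2 = n := by simpa using hq
      simp only [Prod.mk.injEq] at hpq
      have h1 : p.1 = q.1 := by
        ext i; fin_cases i
        · exact hpq.1
        · exact hpq.2
      have h2 : p.2 = q.2 := by
        rw [← hq', h1] at hp'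
        exact add_left_cancel hp'
      exact Prod.ext h1 h2
  have h2 : n.degree + 1 ≤ 2 ^ n.degree := Nat.lt_two_pow_self
  have h3 : (Finset.HasAntidiagonal.antidiagonal n).card ≤ 4 ^ n.degree := by
    calc _ ≤ (n.degree + 1) * (n.degree + 1) := by simpa using h1
      _ ≤ 2 ^ n.degree * 2 ^ n.degree := Nat.mul_le_mul h2 h2
      _ = 4 ^ n.degree := by rw [← mul_pow]; norm_num
  exact_mod_cast h3

theorem IsConvergent.mul {f g : MvPowerSeries (Fin 2) ℂ} (hf : IsConvergent f)
    (hg : IsConvergent g) : IsConvergent (f * g) := by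
  obtain ⟨c, K, hK, h⟩ := hf
  obtain ⟨c', K', hK', h'⟩ := hg
  have hc : 0 ≤ c := by simpa using (norm_nonneg _).trans (h 0)
  have hc' : 0 ≤ c' := by simpa using (norm_nonneg _).trans (h' 0)
  have hM : 0 < max K K' := lt_max_of_lt_left hK
  refine ⟨c * c', 4 * max K K', by positivity, fun n => ?_⟩
  rw [coeff_mul]
  have key : ∀ p ∈ Finset.HasAntidiagonal.antidiagonal n,
      ‖coeff p.1 f * coeff p.2 g‖ ≤ c * c' * max K K' ^ n.degree := by
    intro p hp
    have hp' : p.1 + p.2 = n := by simpa using hp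
    have h1 : ‖coeff p.1 f‖ ≤ c * max K K' ^ p.1.degree := (h _).trans (by
      gcongr; exact le_max_left _ _)
    have h2 : ‖coeff p.2 g‖ ≤ c' * max K K' ^ p.2.degree := (h' _).trans (by
      gcongr; exact le_max_right _ _)
    calc ‖coeff p.1 f * coeff p.2 g‖ = ‖coeff p.1 f‖ * ‖coeff p.2 g‖ := norm_mul _ _
      _ ≤ (c * max K K' ^ p.1.degree) * (c' * max K K' ^ p.2.degree) := by gcongr
      _ = c * c' * max K K' ^ n.degree := by rw [← hp', map_add, pow_add]; ring
  calc ‖∑ p ∈ Finset.HasAntidiagonal.antidiagonal n, coeff p.1 f * coeff p.2 g‖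
      ≤ ∑ p ∈ Finset.HasAntidiagonal.antidiagonal n, c * c' * max K K' ^ n.degree := norm_sum_le_of_le _ key
    _ = (Finset.HasAntidiagonal.antidiagonal n).card * (c * c' * max K K' ^ n.degree) := by simp
    _ ≤ 4 ^ n.degree * (c * c' * max K K' ^ n.degree) := by
        gcongr; exact card_antidiagonal_le n
    _ = c * c' * (4 * max K K') ^ n.degree := by rw [mul_pow]; ring

theorem isConvergent_C (a : ℂ) : IsConvergent (C a) := by
  classical
  refine ⟨‖a‖, 1, one_pos, fun n => ?_⟩
  rw [coeff_C]
  split_ifs <;> simp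

theorem IsConvergent.pderiv {f : MvPowerSeries (Fin 2) ℂ} (hf : IsConvergent f) (i : Fin 2) :
    IsConvergent (MvPowerSeries.pderiv ℂ i f) := by
  obtain ⟨c, K, hK, h⟩ := hf
  have hc : 0 ≤ c := by simpa using (norm_nonneg _).trans (h 0)
  refine ⟨c * K, 2 * K, by positivity, fun n => ?_⟩
  rw [coeff_pderiv, norm_mul]
  have h1 : ‖((n i : ℂ) + 1)‖ ≤ 2 ^ n.degree := by
    have e : ((n i : ℂ) + 1) = ((n i + 1 : ℕ) : ℂ) := by push_cast; rfl
    rw [e, Complex.norm_natCast]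
    have : n i + 1 ≤ 2 ^ n.degree :=
      (Nat.succ_le_succ (Finsupp.le_degree i n)).trans Nat.lt_two_pow_self
    exact_mod_cast this
  have h2 := h (n + Finsupp.single i 1)
  rw [map_add, Finsupp.degree_single] at h2
  calc _ ≤ (c * K ^ (n.degree + 1)) * 2 ^ n.degree := by gcongr
    _ = c * K * (2 * K) ^ n.degree := by rw [mul_pow]; ring

/-- The ring `ℂ{x, y}` of convergent power series. -/
def convergentSeries : Subalgebra ℂ (MvPowerSeries (Fin 2) ℂ) where
  carrier := {f | IsConvergent f}
  mul_mem' := IsConvergent.mul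
  add_mem' := IsConvergent.add
  algebraMap_mem' := isConvergent_C

/-- The ring `𝒪 = ℂ{x, y}` of germs of holomorphic functions at the origin of `ℂ²`. -/
abbrev 𝒪 : Type := convergentSeries

/-- The partial derivative of a germ with respect to `x` (`i = 0`) or `y` (`i = 1`). -/
def partialDeriv (i : Fin 2) (f : 𝒪) : 𝒪 :=
  ⟨MvPowerSeries.pderiv ℂ i (f : MvPowerSeries (Fin 2) ℂ), IsConvergent.pderiv f.2 i⟩

/-- The multiplicity `ν(f)` of a germ at the origin (`⊤` for `f = 0`). -/
def mult (f : 𝒪) : ℕ∞ := MvPowerSeries.order (f : MvPowerSeries (Fin 2) ℂ)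

/-- The Jacobian ideal `J(f) = (∂f/∂x, ∂f/∂y)`. -/
def jacobianIdeal (f : 𝒪) : Ideal 𝒪 := Ideal.span {partialDeriv 0 f, partialDeriv 1 f}

/-- The ideal `(f) + J(f)`. -/
def tjurinaIdeal (f : 𝒪) : Ideal 𝒪 := Ideal.span {f} ⊔ jacobianIdeal f

/-- The Milnor number `μ = dim ℂ{x, y} / J(f)` (the usual one when this dimension is finite). -/
def milnorNumber (f : 𝒪) : ℕ := Module.finrank ℂ (𝒪 ⧸ jacobianIdeal f)

/-- The Tjurina number `τ = dim ℂ{x, y} / ((f) + J(f))` (the usual one when this dimension is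
finite). -/
def tjurinaNumber (f : 𝒪) : ℕ := Module.finrank ℂ (𝒪 ⧸ tjurinaIdeal f)

/-- Germs of holomorphic 1-forms at the origin of `ℂ²`: the pair `(A, B)` is `A dx + B dy`. -/
abbrev OneForm : Type := 𝒪 × 𝒪

/-- The multiplicity `ν(A dx + B dy) = min (ν(A), ν(B))`. -/
def formMult (ω : OneForm) : ℕ∞ := min (mult ω.1) (mult ω.2)

/-- For `ω = A dx + B dy`, the coefficient `A f_y - B f_x` of `dx ∧ dy` in `ω ∧ df`; as a linear
map in `ω`. -/
def wedgeDiff (f : 𝒪) : OneForm →ₗ[𝒪] 𝒪 where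
  toFun ω := ω.1 * partialDeriv 1 f - ω.2 * partialDeriv 0 f
  map_add' ω η := by simp only [Prod.fst_add, Prod.snd_add]; ring
  map_smul' a ω := by
    simp only [Prod.smul_fst, Prod.smul_snd, smul_eq_mul, RingHom.id_apply]; ring

/-- The `ℂ{x, y}`-module `Ω¹(S)`, `S : {f = 0}`, of all 1-forms `ω` such that `f` divides
`ω ∧ df`. -/
def saitoModule (f : 𝒪) : Submodule 𝒪 OneForm :=
  Submodule.comap (wedgeDiff f) (Ideal.span {f})

theorem mem_saitoModule (f : 𝒪) (ω : OneForm) :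
    ω ∈ saitoModule f ↔ f ∣ ω.1 * partialDeriv 1 f - ω.2 * partialDeriv 0 f :=
  Ideal.mem_span_singleton

/-- The polynomial `F^(d)(1, y₁)`, where `F^(d)` is the homogeneous part of degree `d` of `F`. -/
def dehomogenizedPart (d : ℕ) (F : 𝒪) : Polynomial ℂ :=
  ∑ p ∈ Finset.HasAntidiagonal.antidiagonal d,
    Polynomial.monomial p.2
      (coeff (Finsupp.single 0 p.1 + Finsupp.single 1 p.2) (F : MvPowerSeries (Fin 2) ℂ))

/-- For `ω = A dx + B dy` with `ν(ω) = d`, the multiplicity of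
`A^(d)(1, y₁) + y₁ B^(d)(1, y₁)` at `y₁ = -ε`; it is `⊤` when this polynomial vanishes
(`ω` dicritical, or `ω = 0`). -/
def index (ε : ℂ) (ω : OneForm) : ℕ∞ :=
  emultiplicity (Polynomial.X + Polynomial.C ε)
    (dehomogenizedPart (formMult ω).toNat ω.1 +
      Polynomial.X * dehomogenizedPart (formMult ω).toNat ω.2)

/-- The minimum of `i(ω)` over all `ω ∈ Ω¹(S)`, where `S : {f = 0}` has the tangent line
`y + ε x = 0`. -/
def minIndex (ε : ℂ) (f : 𝒪) : ℕ∞ := ⨅ ω ∈ saitoModule f, index ε ω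

/-- The tangent cone of `S : {f = 0}`, `ν = ν(S)`, is the line `y + ε x = 0` (with multiplicity
`ν`): the homogeneous part of degree `ν` of `f` is `c (y + ε x) ^ ν` for a nonzero constant
`c`. -/
def HasTangent (ε : ℂ) (f : 𝒪) : Prop :=
  ∃ c : ℂ, c ≠ 0 ∧ homogeneousComponent (mult f).toNat (f : MvPowerSeries (Fin 2) ℂ) =
    C c * (X 1 + C ε * X 0) ^ (mult f).toNat

/-- The pull-back of `f` by the blowing-up `E(x₁, y₁) = (x₁, x₁ y₁)` of the origin, expanded at
the point `(0, -ε)` of the exceptional divisor `x₁ = 0`; i.e. `f(x, x (y - ε))` with the local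
coordinates `x = x₁`, `y = y₁ + ε`. -/
def blowUpPullback (ε : ℂ) (f : 𝒪) : MvPowerSeries (Fin 2) ℂ :=
  MvPowerSeries.subst (![X 0, X 0 * (X 1 - C ε)] : Fin 2 → MvPowerSeries (Fin 2) ℂ)
    (f : MvPowerSeries (Fin 2) ℂ)

/-- `f'` is the local equation at the point `(0, -ε)` of the strict transform of `S : {f = 0}`:
the pull-back of `f` is `x ^ ν(S) f'`. (It is unique, as `x` is not a zero divisor.) -/
def IsStrictTransform (ε : ℂ) (f f' : 𝒪) : Prop :=
  blowUpPullback ε f = X 0 ^ (mult f).toNat * (f' : MvPowerSeries (Fin 2) ℂ)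

end PlaneBranch

end

noncomputable section

namespace PlaneBranch

open MvPowerSeries

/-! Put n_i = ν_i - 1, ω_i = A_i dx + B_i dy, and let h_i be the cofactor in A_i f_y - B_i f_x = h_i
f. By Saito's criterion (`exists_unit_det`) A₁B₂ - A₂B₁ is a unit times f, and Cramer's rule then
shows that h₁, h₂ generate the colon ideal (J(f) : f). Hence μ - τ is the colength of (h₁, h₂)
(`colen_eq_of_basis`). All colengths are computed in the completion ℂ⟦x, y⟧, where
`colen_extend_of_ne_top` says they do not change.

Blowing up turns ω_i into x^ν_i (a_i dx + x b_i dy) and h_i into x^n_i k_i, with a_i f'_y - b_i (x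
f'_x + ν f') = k_i f' (`blowUp_cofactor`). The identity u f_y = B₂h₁ - B₁h₂ forces the tangent cones
of h₁ and h₂ to have no common line besides the tangent of S (`cofactor_tangents`). Noether's
formula (`colen_eq_mul_add_colen_blowUp`) therefore gives colen (h₁, h₂) = n₁n₂ + colen (k₁, k₂).

The colon-ideal argument applies equally to the pair (f'_y, x f'_x + s f'). Teissier's lemma
(`exists_colen_polar_eq`) says that the colength of this pair does not depend on s: along a branch
of the polar curve f'_y = 0, x f'_x is, up to the ramification index, the Euler derivative t d/dt of
f'. Passing from s = ν to s = 0 replaces k_i by l_i = k_i + ν b_i without changing the colength.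

The pulled-back forms a_i dx + x b_i dy are tangent to the exceptional line as well as to the strict
transform. Subtracting from one of them a multiple of the one with the smaller order of a_i(0, y)
makes it divisible by x; dividing by x produces a basis of Ω¹ of the strict transform
(`colen_eq_add_of_order_le`). The colength drops by the order of l_i(0, y), which is one less than
that of a_i(0, y). Finally the minimum of the orders of a₁(0, y), a₂(0, y) is the minimal index,
since ν₁ + ν₂ = ν bounds the orders of the coefficients of any form in the basis from below
(`min_le_order_restr`).

Intersection numbers are evaluated on branches by Newton-Puiseux (`exists_puiseux_splitting`).
Finiteness rests on x^N ∈ (f, f_y), which uses irreducibility of f among convergent series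
(`exists_X_pow_mem`). -/

/-- The ring `ℂ⟦x, y⟧` of formal power series. -/
abbrev 𝓡 : Type := MvPowerSeries (Fin 2) ℂ

/-! ### Coefficient calculus in two variables. -/

/-- The coefficient of `x ^ i y ^ j`. -/
def cf (f : 𝓡) (i j : ℕ) : ℂ := coeff (Finsupp.single 0 i + Finsupp.single 1 j) f

theorem exponent_eq (n : Fin 2 →₀ ℕ) :
    Finsupp.single 0 (n 0) + Finsupp.single 1 (n 1) = n := by
  ext i; fin_cases i <;> simp

theorem coeff_eq_cf (f : 𝓡) (n : Fin 2 →₀ ℕ) : coeff n f = cf f (n 0) (n 1) := by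
  rw [cf, exponent_eq]

theorem cf_ext {f g : 𝓡} (h : ∀ i j, cf f i j = cf g i j) : f = g := by
  ext n; rw [coeff_eq_cf, coeff_eq_cf, h]

/-- The power series with prescribed coefficients. -/
def ofCoeff (a : ℕ → ℕ → ℂ) : 𝓡 := fun n => a (n 0) (n 1)

@[simp] theorem cf_ofCoeff (a : ℕ → ℕ → ℂ) (i j : ℕ) : cf (ofCoeff a) i j = a i j := by
  change a _ _ = _
  simp

@[simp] theorem cf_add (f g : 𝓡) (i j : ℕ) : cf (f + g) i j = cf f i j + cf g i j := by simp [cf]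
@[simp] theorem cf_sub (f g : 𝓡) (i j : ℕ) : cf (f - g) i j = cf f i j - cf g i j := by simp [cf]
@[simp] theorem cf_zero (i j : ℕ) : cf 0 i j = 0 := by simp [cf]
@[simp] theorem cf_C_mul (a : ℂ) (f : 𝓡) (i j : ℕ) : cf (C a * f) i j = a * cf f i j := by simp [cf]
theorem cf_C (a : ℂ) (i j : ℕ) : cf (C a) i j = if i = 0 ∧ j = 0 then a else 0 := by
  classical
  rw [cf, coeff_C]
  congr 1
  simp only [eq_iff_iff]
  constructor
  · intro h
    exact ⟨by simpa using DFunLike.congr_fun h 0, by simpa using DFunLike.congr_fun h 1⟩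
  · rintro ⟨rfl, rfl⟩; simp

theorem cf_mul (f g : 𝓡) (i j : ℕ) :
    cf (f * g) i j = ∑ p ∈ Finset.HasAntidiagonal.antidiagonal i, ∑ q ∈ Finset.HasAntidiagonal.antidiagonal j,
      cf f p.1 q.1 * cf g p.2 q.2 := by
  classical
  rw [cf, coeff_mul, ← Finset.sum_product']
  refine Finset.sum_bij' (fun p _ => ((p.1 0, p.2 0), (p.1 1, p.2 1)))
    (fun r _ => (Finsupp.single 0 r.1.1 + Finsupp.single 1 r.2.1,
      Finsupp.single 0 r.1.2 + Finsupp.single 1 r.2.2)) ?_ ?_ ?_ ?_ ?_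
  · intro p hp
    have hp' := Finset.HasAntidiagonal.mem_antidiagonal.1 hp
    have h0 := DFunLike.congr_fun hp' 0
    have h1 := DFunLike.congr_fun hp' 1
    simp at h0 h1
    simp [h0, h1]
  · rintro ⟨⟨a, b⟩, c, d⟩ h
    simp only [Finset.mem_product, Finset.HasAntidiagonal.mem_antidiagonal] at h ⊢
    rw [← h.1, ← h.2, Finsupp.single_add, Finsupp.single_add]
    abel
  · intro p hp
    simp [exponent_eq]
  · rintro ⟨⟨a, b⟩, c, d⟩ h
    simp
  · intro p hp
    simp [coeff_eq_cf]

theorem X_zero_mul_eq (f : 𝓡) :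
    (X 0 : 𝓡) * f = ofCoeff fun i j => match i with | 0 => 0 | i + 1 => cf f i j := by
  classical
  ext n
  rw [X_def, coeff_monomial_mul]
  simp only [Finsupp.single_le_iff, one_mul, coeff_eq_cf, cf_ofCoeff]
  rcases h : n 0 with _ | i <;> simp [h]

theorem X_one_mul_eq (f : 𝓡) :
    (X 1 : 𝓡) * f = ofCoeff fun i j => match j with | 0 => 0 | j + 1 => cf f i j := by
  classical
  ext n
  rw [X_def, coeff_monomial_mul]
  simp only [Finsupp.single_le_iff, one_mul, coeff_eq_cf, cf_ofCoeff]
  rcases h : n 1 with _ | i <;> simp [h]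

@[simp] theorem cf_X_zero_mul_zero (f : 𝓡) (j : ℕ) : cf (X 0 * f) 0 j = 0 := by
  rw [X_zero_mul_eq]; simp
@[simp] theorem cf_X_zero_mul_succ (f : 𝓡) (i j : ℕ) : cf (X 0 * f) (i + 1) j = cf f i j := by
  rw [X_zero_mul_eq]; simp
@[simp] theorem cf_X_one_mul_zero (f : 𝓡) (i : ℕ) : cf (X 1 * f) i 0 = 0 := by
  rw [X_one_mul_eq]; simp
@[simp] theorem cf_X_one_mul_succ (f : 𝓡) (i j : ℕ) : cf (X 1 * f) i (j + 1) = cf f i j := by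
  rw [X_one_mul_eq]; simp

theorem cf_X_zero_pow_mul (n : ℕ) (f : 𝓡) (i j : ℕ) : cf (X 0 ^ n * f) (i + n) j = cf f i j := by
  induction n with
  | zero => simp
  | succ n ih => rw [pow_succ', mul_assoc, ← add_assoc, cf_X_zero_mul_succ, ih]

theorem cf_X_zero_pow_mul_of_lt {n i : ℕ} (h : i < n) (f : 𝓡) (j : ℕ) :
    cf (X 0 ^ n * f) i j = 0 := by
  induction n generalizing i with
  | zero => omega
  | succ n ih =>
    rw [pow_succ', mul_assoc]
    rcases i with _ | i
    · simp
    · rw [cf_X_zero_mul_succ, ih (by omega)]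

theorem cf_X_one_pow_mul (n : ℕ) (f : 𝓡) (i j : ℕ) : cf (X 1 ^ n * f) i (j + n) = cf f i j := by
  induction n with
  | zero => simp
  | succ n ih => rw [pow_succ', mul_assoc, ← add_assoc, cf_X_one_mul_succ, ih]

theorem cf_X_one_pow_mul_of_lt {n j : ℕ} (h : j < n) (f : 𝓡) (i : ℕ) :
    cf (X 1 ^ n * f) i j = 0 := by
  induction n generalizing j with
  | zero => omega
  | succ n ih =>
    rw [pow_succ', mul_assoc]
    rcases j with _ | j
    · simp
    · rw [cf_X_one_mul_succ, ih (by omega)]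

theorem X_zero_pow_dvd_iff {n : ℕ} {f : 𝓡} : X 0 ^ n ∣ f ↔ ∀ i j, i < n → cf f i j = 0 := by
  constructor
  · rintro ⟨g, rfl⟩ i j h
    exact cf_X_zero_pow_mul_of_lt h _ _
  · intro h
    refine ⟨ofCoeff fun i j => cf f (i + n) j, cf_ext fun i j => ?_⟩
    rcases lt_or_ge i n with hi | hi
    · rw [h i j hi, cf_X_zero_pow_mul_of_lt hi]
    · obtain ⟨k, rfl⟩ := Nat.exists_eq_add_of_le' hi
      rw [cf_X_zero_pow_mul, cf_ofCoeff]

theorem X_zero_dvd_iff {f : 𝓡} : X 0 ∣ f ↔ ∀ j, cf f 0 j = 0 := by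
  rw [← pow_one (X 0), X_zero_pow_dvd_iff]
  exact ⟨fun h j => h 0 j one_pos, fun h i j hi => by rw [Nat.lt_one_iff.1 hi, h]⟩

theorem cf_zero_zero_mul (f g : 𝓡) : cf (f * g) 0 0 = cf f 0 0 * cf g 0 0 := by
  rw [cf_mul]; simp

theorem constantCoeff_eq_cf (f : 𝓡) : constantCoeff f = cf f 0 0 := by
  simp [cf]

theorem cf_pderiv_zero (f : 𝓡) (i j : ℕ) :
    cf (MvPowerSeries.pderiv ℂ 0 f) i j = cf f (i + 1) j * (i + 1) := by
  rw [cf, coeff_pderiv, coeff_eq_cf]; simp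

theorem cf_pderiv_one (f : 𝓡) (i j : ℕ) :
    cf (MvPowerSeries.pderiv ℂ 1 f) i j = cf f i (j + 1) * (j + 1) := by
  rw [cf, coeff_pderiv, coeff_eq_cf]; simp

theorem le_order_iff {f : 𝓡} {n : ℕ} : (n : ℕ∞) ≤ order f ↔ ∀ i j, i + j < n → cf f i j = 0 := by
  constructor
  · intro h i j hij
    refine coeff_of_lt_order (lt_of_lt_of_le ?_ h)
    simpa [Finsupp.degree_eq_sum] using (by exact_mod_cast hij)
  · intro h
    refine nat_le_order fun d hd => ?_
    rw [coeff_eq_cf]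
    apply h
    simpa [Finsupp.degree_eq_sum, Fin.sum_univ_two] using hd

/-- Every power series is `c + x f₁ + y f₂`. -/
theorem exists_decomp (f : 𝓡) : ∃ f₁ f₂ : 𝓡, f = C (cf f 0 0) + X 0 * f₁ + X 1 * f₂ := by
  refine ⟨ofCoeff fun i j => cf f (i + 1) j,
    ofCoeff fun i j => if i = 0 then cf f 0 (j + 1) else 0, cf_ext fun i j => ?_⟩
  rcases i with _ | i <;> rcases j with _ | j <;> simp [cf_C]

theorem exists_decomp_of_le_order {f : 𝓡} {n : ℕ} (h : ((n + 1 : ℕ) : ℕ∞) ≤ order f) :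
    ∃ f₁ f₂ : 𝓡, f = X 0 * f₁ + X 1 * f₂ ∧ (n : ℕ∞) ≤ order f₁ ∧ (n : ℕ∞) ≤ order f₂ := by
  rw [le_order_iff] at h
  refine ⟨ofCoeff fun i j => cf f (i + 1) j,
    ofCoeff fun i j => if i = 0 then cf f 0 (j + 1) else 0, cf_ext fun i j => ?_, ?_, ?_⟩
  · rcases i with _ | i <;> rcases j with _ | j <;> simp [h 0 0]
  · rw [le_order_iff]
    intro i j hij
    simpa using h _ _ (by omega)
  · rw [le_order_iff]
    intro i j hij
    rcases i with _ | i
    · simpa using h _ _ (by omega)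
    · simp

theorem eq_zero_of_le_order {σ : Type*} {f : MvPowerSeries σ ℂ} (h : ∀ n : ℕ, (n : ℕ∞) ≤ order f) :
    f = 0 := by
  rw [← order_eq_top_iff]
  exact ENat.eq_top_iff_forall_ge.2 h

theorem one_le_order_of_constantCoeff {σ : Type*} {f : MvPowerSeries σ ℂ}
    (h : constantCoeff f = 0) : 1 ≤ order f := by
  exact one_le_order_iff_constCoeff_eq_zero.2 h

theorem succ_le_order_mul {σ : Type*} {f g : MvPowerSeries σ ℂ} {n : ℕ}
    (hf : constantCoeff f = 0) (hg : (n : ℕ∞) ≤ order g) : ((n + 1 : ℕ) : ℕ∞) ≤ order (f * g) := by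
  refine le_trans ?_ le_order_mul
  push_cast
  rw [add_comm]
  exact add_le_add (one_le_order_of_constantCoeff hf) hg

theorem le_order_add {σ : Type*} {f g : MvPowerSeries σ ℂ} {n : ℕ∞}
    (hf : n ≤ order f) (hg : n ≤ order g) : n ≤ order (f + g) :=
  (le_min hf hg).trans min_order_le_add

/-! ### Homomorphisms and derivations determined by their values on x and y. -/

theorem algHom_C {σ : Type*} (φ : 𝓡 →ₐ[ℂ] MvPowerSeries σ ℂ) (a : ℂ) : φ (C a) = C a := by
  exact φ.commutes a

/-- Two local algebra homomorphisms out of `ℂ⟦x, y⟧` which agree on `x`, `y` are equal. -/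
theorem algHom_ext {σ : Type*} {φ ψ : 𝓡 →ₐ[ℂ] MvPowerSeries σ ℂ} (h : ∀ i, φ (X i) = ψ (X i))
    (h0 : ∀ i, constantCoeff (φ (X i)) = 0) : φ = ψ := by
  -- No continuity is assumed: the splitting f = c + x f₁ + y f₂ gains one order at each step, so
  -- the difference has infinite order.
  have key : ∀ n : ℕ, ∀ f : 𝓡, (n : ℕ∞) ≤ order (φ f - ψ f) := by
    intro n
    induction n with
    | zero => simp
    | succ n ih =>
      intro f
      obtain ⟨f₁, f₂, hf⟩ := exists_decomp f
      have : φ f - ψ f = φ (X 0) * (φ f₁ - ψ f₁) + φ (X 1) * (φ f₂ - ψ f₂) := by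
        rw [hf]
        simp only [map_add, map_mul, algHom_C, ← h]
        ring
      rw [this]
      exact le_order_add (succ_le_order_mul (h0 0) (ih _)) (succ_le_order_mul (h0 1) (ih _))
  ext1 f
  exact sub_eq_zero.1 (eq_zero_of_le_order fun n => key n f)

/-- A derivation along a local homomorphism out of `ℂ⟦x, y⟧` vanishes if it kills `x` and `y`. -/
theorem derivation_eq_zero {σ : Type*} (φ : 𝓡 →ₐ[ℂ] MvPowerSeries σ ℂ)
    (h0 : ∀ i, constantCoeff (φ (X i)) = 0) (D : 𝓡 → MvPowerSeries σ ℂ)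
    (hadd : ∀ f g, D (f + g) = D f + D g) (hC : ∀ a, D (C a) = 0)
    (hmul : ∀ i g, D (X i * g) = φ (X i) * D g) (f : 𝓡) : D f = 0 := by
  refine eq_zero_of_le_order fun n => ?_
  induction n generalizing f with
  | zero => simp
  | succ n ih =>
    obtain ⟨f₁, f₂, hf⟩ := exists_decomp f
    rw [hf, hadd, hadd, hC, hmul, hmul, zero_add]
    exact le_order_add (succ_le_order_mul (h0 0) (ih _)) (succ_le_order_mul (h0 1) (ih _))

/-! ### Expansion in powers of x and restriction to the line x = 0. -/

/-- `ℂ⟦x, y⟧ = ℂ⟦y⟧⟦x⟧`. -/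
def iterEquiv : 𝓡 ≃ₐ[ℂ] PowerSeries (PowerSeries ℂ) where
  toFun f := PowerSeries.mk fun i => PowerSeries.mk fun j => cf f i j
  invFun g := ofCoeff fun i j => PowerSeries.coeff j (PowerSeries.coeff i g)
  left_inv f := cf_ext fun i j => by simp
  right_inv g := by ext i j; simp
  map_mul' f g := by
    ext i j
    rw [PowerSeries.coeff_mul, map_sum]
    simp [cf_mul, PowerSeries.coeff_mul]
  map_add' f g := by ext i j; simp
  commutes' a := by
    ext i j
    have h : algebraMap ℂ 𝓡 a = C a := rfl
    rw [PowerSeries.algebraMap_apply, PowerSeries.algebraMap_apply, h]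
    simp only [PowerSeries.coeff_mk, cf_C, PowerSeries.coeff_C]
    rcases i with _ | i <;> rcases j with _ | j <;> simp [PowerSeries.coeff_C]

@[simp] theorem coeff_iterEquiv (f : 𝓡) (i j : ℕ) :
    PowerSeries.coeff j (PowerSeries.coeff i (iterEquiv f)) = cf f i j := by
  simp [iterEquiv]

@[simp] theorem cf_iterEquiv_symm (g : PowerSeries (PowerSeries ℂ)) (i j : ℕ) :
    cf (iterEquiv.symm g) i j = PowerSeries.coeff j (PowerSeries.coeff i g) := by
  simp [iterEquiv]

/-- The restriction `f(0, y)` of a power series to the line `x = 0`. -/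
def restr : 𝓡 →ₐ[ℂ] PowerSeries ℂ where
  toFun f := PowerSeries.constantCoeff (iterEquiv f)
  map_one' := by simp
  map_mul' f g := by simp
  map_zero' := by simp
  map_add' f g := by simp
  commutes' a := by rw [AlgEquiv.commutes]; rfl

@[simp] theorem coeff_restr (f : 𝓡) (j : ℕ) : PowerSeries.coeff j (restr f) = cf f 0 j := by
  rw [← coeff_iterEquiv, PowerSeries.coeff_zero_eq_constantCoeff_apply]; rfl

theorem restr_eq_zero_iff {f : 𝓡} : restr f = 0 ↔ X 0 ∣ f := by
  rw [X_zero_dvd_iff, PowerSeries.ext_iff]; simp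

@[simp] theorem restr_X_zero : restr (X 0) = 0 := restr_eq_zero_iff.2 dvd_rfl

theorem restr_surjective : Function.Surjective restr := by
  intro g
  refine ⟨ofCoeff fun i j => if i = 0 then PowerSeries.coeff j g else 0, ?_⟩
  ext j; simp

@[simp] theorem restr_X_one : restr (X 1) = PowerSeries.X := by
  ext j
  rw [coeff_restr, ← mul_one (X 1), PowerSeries.coeff_X]
  rcases j with _ | j
  · rw [cf_X_one_mul_zero]; simp
  · rw [cf_X_one_mul_succ, ← map_one C, cf_C]; simp

@[simp] theorem restr_C (a : ℂ) : restr (C a) = PowerSeries.C a := restr.commutes a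

/-- The kernel of `restr` is (x) and its target is a domain. -/
theorem prime_X_zero : Prime (X 0 : 𝓡) := by
  refine ⟨fun h => ?_, fun h => ?_, fun a b h => ?_⟩
  · have := congrArg (fun f => cf f 1 0) h
    rw [← mul_one (X 0), cf_X_zero_mul_succ, ← map_one C, cf_C] at this
    simp at this
  · have := h.map restr
    simp at this
  · simpa [← restr_eq_zero_iff] using h

theorem mem_span_pair' {A : Type*} [CommRing A] {a b x : A} : x ∈ Ideal.span {a, b} ↔ ∃ r s, x = a * r + b * s := by
  rw [Ideal.mem_span_pair]
  constructor
  · rintro ⟨r, s, h⟩; exact ⟨r, s, by rw [← h]; ring⟩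
  · rintro ⟨r, s, h⟩; exact ⟨r, s, by rw [h]; ring⟩

theorem mem_span_triple' {A : Type*} [CommRing A] {a b c x : A} :
    x ∈ Ideal.span {a, b, c} ↔ ∃ r s t, x = a * r + b * s + c * t := by
  rw [Ideal.mem_span_insert]
  simp only [mem_span_pair']
  constructor
  · rintro ⟨r, _, ⟨s, t, rfl⟩, h⟩; exact ⟨r, s, t, by rw [h]; ring⟩
  · rintro ⟨r, s, t, h⟩; exact ⟨r, _, ⟨s, t, rfl⟩, by rw [h]; ring⟩

/-! ### Colengths of ideals in ℂ-algebras. -/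

section Colength

variable {A B : Type*} [CommRing A] [Algebra ℂ A] [CommRing B] [Algebra ℂ B]

/-- The colength `dim A / I` of an ideal of a `ℂ`-algebra. -/
def colen (I : Ideal A) : ℕ∞ := Module.length ℂ (A ⧸ I)

theorem colen_ne_top_iff {I : Ideal A} : colen I ≠ ⊤ ↔ Module.Finite ℂ (A ⧸ I) := by
  rw [colen, Module.length_ne_top_iff, isFiniteLength_iff_isNoetherian_isArtinian]
  exact ⟨fun h => have := h.1; inferInstance, fun h => ⟨inferInstance, inferInstance⟩⟩

theorem colen_eq_finrank {I : Ideal A} (h : colen I ≠ ⊤) :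
    colen I = Module.finrank ℂ (A ⧸ I) := by
  have := colen_ne_top_iff.1 h
  exact Module.length_eq_finrank _ _

theorem colen_mono {I J : Ideal A} (h : I ≤ J) : colen J ≤ colen I := by
  refine Module.length_le_of_surjective (g := (Ideal.Quotient.factorₐ ℂ h).toLinearMap) ?_
  exact Ideal.Quotient.factor_surjective h

/-- Exactness of `0 → A / (I : a) → A / I → A / (I + (a)) → 0`. -/
theorem colen_eq_add {I K L : Ideal A} (a : A) (hK : ∀ b, b ∈ K ↔ a * b ∈ I)
    (hL : L = I ⊔ Ideal.span {a}) : colen I = colen K + colen L := by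
  subst hL
  have hle : I ≤ I ⊔ Ideal.span {a} := le_sup_left
  let f : (A ⧸ K) →ₗ[ℂ] (A ⧸ I) :=
    (Submodule.mapQ K I (LinearMap.mulLeft A a) (fun b hb => (hK b).1 hb)).restrictScalars ℂ
  refine Module.length_eq_add_of_exact f (Ideal.Quotient.factorₐ ℂ hle).toLinearMap ?_
    (Ideal.Quotient.factor_surjective hle) ?_
  · rw [injective_iff_map_eq_zero]
    intro x hx
    obtain ⟨b, rfl⟩ := Ideal.Quotient.mk_surjective x
    exact Ideal.Quotient.eq_zero_iff_mem.2 ((hK b).2 (Ideal.Quotient.eq_zero_iff_mem.1 hx))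
  · intro x
    obtain ⟨b, rfl⟩ := Ideal.Quotient.mk_surjective x
    constructor
    · intro h
      have h' : b ∈ I ⊔ Ideal.span {a} := Ideal.Quotient.eq_zero_iff_mem.1 h
      obtain ⟨i, hi, s, hs, hb⟩ := Submodule.mem_sup.1 h'
      obtain ⟨c, rfl⟩ := Ideal.mem_span_singleton.1 hs
      refine ⟨Ideal.Quotient.mk K c, ?_⟩
      change Ideal.Quotient.mk I (a * c) = _
      rw [Ideal.Quotient.eq, ← hb]
      simpa using hi
    · rintro ⟨y, hy⟩
      obtain ⟨c, rfl⟩ := Ideal.Quotient.mk_surjective y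
      have hy' : Ideal.Quotient.mk I (a * c) = Ideal.Quotient.mk I b := hy
      rw [Ideal.Quotient.eq] at hy'
      change Ideal.Quotient.mk _ b = 0
      rw [Ideal.Quotient.eq_zero_iff_mem, show b = -(a * c - b) + a * c by ring]
      exact Ideal.add_mem _ (neg_mem (hle hy'))
        (Ideal.mul_mem_right _ _ (Ideal.mem_sup_right (Ideal.mem_span_singleton_self a)))

/-- Surjectivity is asked only modulo J, so that this also covers the inclusion of 𝒪 into its
completion. -/
theorem colen_eq_of_algHom (φ : A →ₐ[ℂ] B) {I : Ideal A} {J : Ideal B}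
    (hI : ∀ a, a ∈ I ↔ φ a ∈ J) (hs : ∀ b, ∃ a, φ a - b ∈ J) : colen I = colen J := by
  have hI' : ∀ a ∈ I, (Ideal.Quotient.mkₐ ℂ J).comp φ a = 0 := fun a ha =>
    Ideal.Quotient.eq_zero_iff_mem.2 ((hI a).1 ha)
  let f : (A ⧸ I) →ₐ[ℂ] (B ⧸ J) := Ideal.Quotient.liftₐ I _ hI'
  refine LinearEquiv.length_eq (LinearEquiv.ofBijective f.toLinearMap ⟨?_, ?_⟩)
  · rw [injective_iff_map_eq_zero]
    intro x hx
    obtain ⟨b, rfl⟩ := Ideal.Quotient.mk_surjective x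
    exact Ideal.Quotient.eq_zero_iff_mem.2 ((hI b).2 (Ideal.Quotient.eq_zero_iff_mem.1 hx))
  · intro y
    obtain ⟨b, rfl⟩ := Ideal.Quotient.mk_surjective y
    obtain ⟨a, ha⟩ := hs b
    exact ⟨Ideal.Quotient.mk I a, Ideal.Quotient.eq.2 ha⟩

/-- Additivity of the intersection multiplicity. -/
theorem colen_mul [IsDomain A] {a b p : A} (ha : a ≠ 0) (h : ∀ s, a ∣ p * s → a ∣ s) :
    colen (Ideal.span {a * b, p}) = colen (Ideal.span {b, p}) + colen (Ideal.span {a, p}) := by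
  refine colen_eq_add a (fun z => ?_) ?_
  · rw [mem_span_pair', mem_span_pair']
    constructor
    · rintro ⟨r, s, rfl⟩
      exact ⟨r, a * s, by ring⟩
    · rintro ⟨r, s, hz⟩
      obtain ⟨t, rfl⟩ := h s ⟨z - b * r, by linear_combination -hz⟩
      exact ⟨r, t, mul_left_cancel₀ ha (by linear_combination hz)⟩
  · rw [← Ideal.span_union]
    apply le_antisymm <;> rw [Ideal.span_le] <;> intro x hx
    · rcases hx with rfl | rfl <;> exact Ideal.subset_span (by simp)
    · rcases hx with (rfl | rfl) | rfl
      · exact Ideal.mul_mem_right _ _ (Ideal.subset_span (by simp))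
      · exact Ideal.subset_span (by simp)
      · exact Ideal.subset_span (by simp)

/-- The cofactors of a basis `(aᵢ, bᵢ)` of the module of all `(a, b)` with `f ∣ a p - b q`
generate `((p, q) : f)`. -/
theorem colen_eq_of_basis [IsDomain A] {p q f a₁ b₁ a₂ b₂ c₁ c₂ u : A} (hf : f ≠ 0) (hu : IsUnit u)
    (h₁ : a₁ * p - b₁ * q = c₁ * f) (h₂ : a₂ * p - b₂ * q = c₂ * f)
    (hdet : a₁ * b₂ - a₂ * b₁ = u * f) (hreg : ∀ g, f ∣ g * p → f ∣ g * q → f ∣ g) :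
    colen (Ideal.span {p, q}) = colen (Ideal.span {c₁, c₂}) + colen (Ideal.span {f, p, q}) := by
  obtain ⟨v, hv⟩ := hu.exists_right_inv
  refine colen_eq_add f (fun z => ?_) ?_
  · rw [mem_span_pair', mem_span_pair']
    constructor
    · rintro ⟨r, s, rfl⟩
      exact ⟨r * a₁ + s * a₂, -(r * b₁ + s * b₂), by linear_combination -r * h₁ - s * h₂⟩
    · rintro ⟨a, b, h⟩
      -- Cramer's rule: f divides the minor of (a, -b) with each basis element, because by `hreg` it
      -- suffices that f divides the minor times p and times q. The quotients of the two minors by f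
      -- are, up to v and a sign, the coordinates of (a, -b) in the basis.
      have hd : ∀ a' b' c' : A, a' * p - b' * q = c' * f → f ∣ a * b' + a' * b := by
        intro a' b' c' h'
        refine hreg _ ⟨b' * z + c' * b, ?_⟩ ⟨a' * z - c' * a, ?_⟩
        · linear_combination -b' * h + b * h'
        · linear_combination -a' * h - a * h'
      obtain ⟨s, hs⟩ := hd a₁ b₁ c₁ h₁
      obtain ⟨r, hr⟩ := hd a₂ b₂ c₂ h₂
      refine ⟨v * r, -v * s, ?_⟩
      have e1 : a * (u * f) = f * (r * a₁ - s * a₂) := by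
        linear_combination -a * hdet + a₁ * hr - a₂ * hs
      have e2 : b * (u * f) = f * (s * b₂ - r * b₁) := by
        linear_combination -b * hdet + b₂ * hs - b₁ * hr
      have e1' : a = v * (r * a₁ - s * a₂) := by
        apply mul_left_cancel₀ hf
        linear_combination v * e1 - a * f * hv
      have e2' : b = v * (s * b₂ - r * b₁) := by
        apply mul_left_cancel₀ hf
        linear_combination v * e2 - b * f * hv
      apply mul_left_cancel₀ hf
      rw [h, e1', e2']
      linear_combination v * r * h₁ - v * s * h₂
  · rw [← Ideal.span_union]
    congr 1
    ext x; simp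

theorem colen_span_mul [IsDomain A] {a b : A} (ha : a ≠ 0) :
    colen (Ideal.span {a * b}) = colen (Ideal.span {b}) + colen (Ideal.span {a}) := by
  refine colen_eq_add a (fun z => ?_) ?_
  · rw [Ideal.mem_span_singleton, Ideal.mem_span_singleton, mul_dvd_mul_iff_left ha]
  · symm
    rw [sup_eq_right, Ideal.span_singleton_le_span_singleton]
    exact dvd_mul_right _ _

theorem colen_bot_complex : colen (⊥ : Ideal ℂ) = 1 := by
  rw [colen, (Submodule.quotEquivOfEqBot (⊥ : Submodule ℂ ℂ) rfl).length_eq]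
  exact Module.length_eq_one ℂ ℂ

theorem colen_span_X : colen (Ideal.span {(PowerSeries.X : PowerSeries ℂ)}) = 1 := by
  rw [← colen_bot_complex]
  let φ : PowerSeries ℂ →ₐ[ℂ] ℂ :=
    { (PowerSeries.constantCoeff : PowerSeries ℂ →+* ℂ) with
      commutes' := fun a => by simp }
  refine colen_eq_of_algHom φ (fun a => ?_) (fun b => ⟨PowerSeries.C b, ?_⟩)
  swap
  · exact (Submodule.mem_bot ℂ).2 (sub_eq_zero.2 (PowerSeries.constantCoeff_C b))
  rw [Ideal.mem_span_singleton, PowerSeries.X_dvd_iff]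
  rfl

theorem colen_span_X_pow (n : ℕ) :
    colen (Ideal.span {(PowerSeries.X : PowerSeries ℂ) ^ n}) = n := by
  induction n with
  | zero =>
    rw [pow_zero, Ideal.span_singleton_one, colen]
    exact Module.length_eq_zero
  | succ n ih =>
    rw [pow_succ', colen_span_mul PowerSeries.X_ne_zero, ih, colen_span_X]
    norm_cast

/-- A nonzero series is a unit times a power of X; for g = 0 the quotients by X^n give arbitrarily
large lower bounds. -/
theorem colen_span_powerSeries (g : PowerSeries ℂ) : colen (Ideal.span {g}) = g.order := by
  by_cases hg : g = 0
  · subst hg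
    rw [PowerSeries.order_zero, ENat.eq_top_iff_forall_ge]
    intro n
    rw [← colen_span_X_pow n]
    exact colen_mono (by simp)
  · obtain ⟨n, hn⟩ := ENat.ne_top_iff_exists.1 (mt PowerSeries.order_eq_top.1 hg)
    obtain ⟨h, rfl⟩ := PowerSeries.X_pow_dvd_iff.2 fun m hm =>
      PowerSeries.coeff_of_lt_order m (show (m : ℕ∞) < g.order by rw [← hn]; exact_mod_cast hm)
    rw [PowerSeries.order_mul, PowerSeries.order_X_pow] at hn
    have h0 : h.order = 0 := by
      have hh : h.order ≠ ⊤ := fun e => by simp [e] at hn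
      obtain ⟨k, hk⟩ := ENat.ne_top_iff_exists.1 hh
      rw [← hk] at hn ⊢
      norm_cast at hn ⊢
      omega
    have hu : IsUnit h := by
      rw [PowerSeries.isUnit_iff_constantCoeff, isUnit_iff_ne_zero]
      intro e
      rw [← PowerSeries.coeff_zero_eq_constantCoeff_apply] at e
      have : h ≠ 0 := by rintro rfl; simp at h0
      have := (PowerSeries.order_eq_nat (φ := h) (n := 0)).1 (by simpa using h0)
      exact this.1 e
    rw [Ideal.span_singleton_mul_right_unit hu, colen_span_X_pow, PowerSeries.order_mul, h0,
      PowerSeries.order_X_pow, add_zero]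

end Colength

/-! ### Ideals of finite colength in ℂ⟦x, y⟧. -/

section FormalColength

theorem isUnit_iff_cf {f : 𝓡} : IsUnit f ↔ cf f 0 0 ≠ 0 := by
  rw [MvPowerSeries.isUnit_iff_constantCoeff, isUnit_iff_ne_zero, constantCoeff_eq_cf]

/-- The quotient is Artinian, so its Jacobson radical is nilpotent, and the class of x lies in that
radical because 1 + xy is a unit for every y. -/
theorem exists_pow_mem_of_colen_ne_top {I : Ideal 𝓡} (h : colen I ≠ ⊤) {x : 𝓡}
    (hx : cf x 0 0 = 0) : ∃ n, x ^ n ∈ I := by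
  have := colen_ne_top_iff.1 h
  have : IsArtinianRing (𝓡 ⧸ I) := IsArtinianRing.of_finite ℂ _
  obtain ⟨n, hn⟩ := IsArtinianRing.isNilpotent_jacobson_bot (R := 𝓡 ⧸ I)
  refine ⟨n, ?_⟩
  have hm : Ideal.Quotient.mk I x ∈ Ideal.jacobson (⊥ : Ideal (𝓡 ⧸ I)) := by
    rw [Ideal.mem_jacobson_bot]
    intro y
    obtain ⟨y, rfl⟩ := Ideal.Quotient.mk_surjective y
    rw [← map_mul, ← map_one (Ideal.Quotient.mk I), ← map_add]
    refine IsUnit.map _ (isUnit_iff_cf.2 ?_)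
    rw [cf_add, cf_zero_zero_mul, hx, ← map_one C, cf_C]
    simp
  have := Ideal.pow_mem_pow hm n
  rw [hn, ← map_pow] at this
  exact Ideal.Quotient.eq_zero_iff_mem.1 this

/-- `dim ℂ⟦x, y⟧ / (x, g) = ord g(0, y)`. -/
theorem colen_X_zero (g : 𝓡) : colen (Ideal.span {X 0, g}) = (restr g).order := by
  rw [← colen_span_powerSeries]
  refine colen_eq_of_algHom restr (fun a => ?_)
    (fun b => (restr_surjective b).imp fun a ha => by simp [ha])
  rw [mem_span_pair', Ideal.mem_span_singleton]
  constructor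
  · rintro ⟨r, s, rfl⟩
    simp
  · rintro ⟨t, ht⟩
    obtain ⟨s, rfl⟩ := restr_surjective t
    have : restr (a - g * s) = 0 := by rw [map_sub, ht, map_mul, sub_self]
    obtain ⟨r, hr⟩ := restr_eq_zero_iff.1 this
    exact ⟨r, s, by linear_combination hr⟩

end FormalColength

end PlaneBranch

namespace PlaneBranch

/-! ### The Newton-Puiseux theorem. -/

section Puiseux

open Polynomial

/-- A polynomial over `ℂ⟦x⟧` has a Puiseux root: a root in `ℂ⟦x ^ (1 / q)⟧` for some `q`. -/
def HasPuiseuxRoot (P : Polynomial (PowerSeries ℂ)) : Prop :=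
  ∃ (q : ℕ) (hq : q ≠ 0) (s : PowerSeries ℂ),
    P.eval₂ (PowerSeries.expand q hq : PowerSeries ℂ →ₐ[ℂ] PowerSeries ℂ).toRingHom s = 0

variable {P Q : Polynomial (PowerSeries ℂ)}

theorem HasPuiseuxRoot.of_dvd (h : HasPuiseuxRoot P) (hd : P ∣ Q) : HasPuiseuxRoot Q := by
  obtain ⟨q, hq, s, hs⟩ := h
  obtain ⟨R, rfl⟩ := hd
  exact ⟨q, hq, s, by rw [eval₂_mul, hs, zero_mul]⟩

theorem HasPuiseuxRoot.of_taylor {c : PowerSeries ℂ} (h : HasPuiseuxRoot (taylor c P)) :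
    HasPuiseuxRoot P := by
  obtain ⟨q, hq, s, hs⟩ := h
  rw [taylor_apply, eval₂_comp] at hs
  exact ⟨q, hq, _, hs⟩

theorem expand_comp_expand {p q : ℕ} (hp : p ≠ 0) (hq : q ≠ 0) :
    (PowerSeries.expand p hp : PowerSeries ℂ →ₐ[ℂ] PowerSeries ℂ).toRingHom.comp
      (PowerSeries.expand q hq : PowerSeries ℂ →ₐ[ℂ] PowerSeries ℂ).toRingHom =
    (PowerSeries.expand (p * q) (p.mul_ne_zero hp hq) :
      PowerSeries ℂ →ₐ[ℂ] PowerSeries ℂ).toRingHom := by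
  ext1 x
  exact (PowerSeries.expand_mul p hp q hq x).symm

theorem HasPuiseuxRoot.of_expand {q : ℕ} (hq : q ≠ 0)
    (h : HasPuiseuxRoot (P.map (PowerSeries.expand q hq :
      PowerSeries ℂ →ₐ[ℂ] PowerSeries ℂ).toRingHom)) : HasPuiseuxRoot P := by
  obtain ⟨p, hp, s, hs⟩ := h
  rw [eval₂_map, expand_comp_expand] at hs
  exact ⟨_, _, s, hs⟩

theorem HasPuiseuxRoot.scaleRoots (r : PowerSeries ℂ) (h : HasPuiseuxRoot P) :
    HasPuiseuxRoot (P.scaleRoots r) := by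
  obtain ⟨q, hq, s, hs⟩ := h
  exact ⟨q, hq, _, scaleRoots_eval₂_eq_zero _ hs⟩

instance : IsAdicComplete (IsLocalRing.maximalIdeal (PowerSeries ℂ)) (PowerSeries ℂ) := by
  rw [PowerSeries.maximalIdeal_eq_span_X]
  infer_instance

theorem mem_maximalIdeal_iff {a : PowerSeries ℂ} :
    a ∈ IsLocalRing.maximalIdeal (PowerSeries ℂ) ↔ PowerSeries.constantCoeff a = 0 := by
  rw [PowerSeries.maximalIdeal_eq_span_X, Ideal.mem_span_singleton, PowerSeries.X_dvd_iff]

/-- A monic polynomial over `ℂ⟦x⟧` whose reduction has `0` as a root, but is not a power of the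
variable, is divisible by a monic polynomial of smaller degree. -/
theorem exists_monic_dvd
    (h0 : PowerSeries.constantCoeff (P.coeff 0) = 0) {i : ℕ} (hi : i < P.natDegree)
    (hPi : PowerSeries.constantCoeff (P.coeff i) ≠ 0) :
    ∃ W : Polynomial (PowerSeries ℂ), W.Monic ∧ 0 < W.natDegree ∧ W.natDegree < P.natDegree ∧
      W ∣ P := by
  have hg : (P : PowerSeries (PowerSeries ℂ)).map
      (IsLocalRing.residue (PowerSeries ℂ)) ≠ 0 := by
    intro h
    have := congrArg (PowerSeries.coeff i) h
    rw [PowerSeries.coeff_map, coeff_coe, map_zero, IsLocalRing.residue_eq_zero_iff,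
      mem_maximalIdeal_iff] at this
    exact hPi this
  obtain ⟨W, h, hW⟩ := PowerSeries.exists_isWeierstrassFactorization hg
  have hmonic := hW.isDistinguishedAt.monic
  refine ⟨W, hmonic, ?_, ?_, ?_⟩
  · rw [Nat.pos_iff_ne_zero]
    intro hd
    have h1 : W = 1 := hmonic.natDegree_eq_zero.1 hd
    have h2 := hW.eq_mul
    rw [h1, coe_one, one_mul] at h2
    have h3 := hW.isUnit
    rw [← h2, PowerSeries.isUnit_iff_constantCoeff,
      ← PowerSeries.coeff_zero_eq_constantCoeff_apply, coeff_coe,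
      PowerSeries.isUnit_iff_constantCoeff, h0] at h3
    simp at h3
  · by_contra hlt
    push Not at hlt
    apply hPi
    rw [← mem_maximalIdeal_iff, ← coeff_coe, hW.eq_mul, PowerSeries.coeff_mul]
    refine Ideal.sum_mem _ fun p hp => Ideal.mul_mem_right _ _ ?_
    have hp' := Finset.HasAntidiagonal.mem_antidiagonal.1 hp
    rw [coeff_coe]
    exact hW.isDistinguishedAt.mem (by omega)
  -- Divisibility is so far known only among power series. Uniqueness of Weierstrass division by W
  -- identifies the polynomial division of P with P = W h + 0, so the polynomial remainder vanishes.
  · rw [← modByMonic_eq_zero_iff_dvd hmonic]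
    have hdiv := hW.isDistinguishedAt.isWeierstrassDivisorAt'
    have hdeg : (W : PowerSeries (PowerSeries ℂ)).map (Ideal.Quotient.mk
        (IsLocalRing.maximalIdeal (PowerSeries ℂ))) ≠ 0 ∧ (W.natDegree : ℕ∞) =
        ((W : PowerSeries (PowerSeries ℂ)).map (Ideal.Quotient.mk
        (IsLocalRing.maximalIdeal (PowerSeries ℂ)))).order := by
      have e := hW.isDistinguishedAt.coe_natDegree_eq_order_map W 1
        (by rw [PowerSeries.constantCoeff_one]
            exact (Ideal.ne_top_iff_one _).1 (IsLocalRing.maximalIdeal.isMaximal _).ne_top)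
        (by simp)
      refine ⟨fun h => ?_, e⟩
      rw [h, PowerSeries.order_zero] at e
      exact ENat.natCast_ne_top _ e
    refine (hdiv.eq_of_mul_add_eq_mul_add (q := ((P /ₘ W : Polynomial _) : PowerSeries _)) (q' := h)
      (r' := 0) ?_ ?_ ?_).2
    · rw [← hdeg.2, ENat.toNat_natCast, ← degree_eq_natDegree hmonic.ne_zero]
      exact degree_modByMonic_lt _ hmonic
    · rw [← hdeg.2, ENat.toNat_natCast, degree_zero]
      exact WithBot.bot_lt_coe _
    · rw [← hW.eq_mul.trans (by simp : _ = (W : PowerSeries (PowerSeries ℂ)) * h +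
        ((0 : Polynomial (PowerSeries ℂ)) : PowerSeries (PowerSeries ℂ)))]
      conv_rhs => rw [← modByMonic_add_div P W]
      push_cast
      ring

/-- A depressed monic polynomial over `ℂ⟦x⟧` which does not reduce to a power of the variable
has a proper monic divisor after a translation. -/
theorem exists_taylor_dvd (hP : P.Monic) (h1 : P.coeff (P.natDegree - 1) = 0) {i : ℕ}
    (hi : i < P.natDegree) (hPi : PowerSeries.constantCoeff (P.coeff i) ≠ 0) :
    ∃ c W, W.Monic ∧ 0 < W.natDegree ∧ W.natDegree < P.natDegree ∧ W ∣ taylor c P := by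
  set P₀ : Polynomial ℂ := P.map PowerSeries.constantCoeff with hP₀
  have hmon : P₀.Monic := hP.map _
  have hdeg : P₀.natDegree = P.natDegree := hP.natDegree_map _
  have hdeg' : P₀.degree ≠ 0 := by
    rw [degree_eq_natDegree hmon.ne_zero, hdeg]
    exact_mod_cast (by omega : P.natDegree ≠ 0)
  obtain ⟨c, hc⟩ := IsAlgClosed.exists_root P₀ hdeg'
  have hT : ∀ k, PowerSeries.constantCoeff ((taylor (PowerSeries.C c) P).coeff k) =
      (taylor c P₀).coeff k := by
    intro k
    rw [← coeff_map, map_taylor, PowerSeries.constantCoeff_C]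
  have hTdeg : (taylor (PowerSeries.C c) P).natDegree = P.natDegree := natDegree_taylor _ _
  have hTmon : (taylor (PowerSeries.C c) P).Monic := by
    rw [Monic, leadingCoeff_taylor]; exact hP
  -- Here depressedness enters: otherwise P₀ = (X - c)^n, the vanishing of the coefficient of
  -- X^(n-1) forces c = 0, and P₀ = X^n contradicts `hPi`.
  have hex : ∃ k < P.natDegree, (taylor c P₀).coeff k ≠ 0 := by
    by_contra hcon
    push Not at hcon
    have hX : taylor c P₀ = X ^ P.natDegree := by
      ext k
      rw [coeff_X_pow]
      rcases lt_trichotomy k P.natDegree with hk | hk | hk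
      · rw [hcon k hk, if_neg hk.ne]
      · rw [if_pos hk, hk, ← hdeg]
        rw [coeff_taylor_natDegree]; exact hmon
      · rw [if_neg hk.ne', coeff_eq_zero_of_natDegree_lt]
        rwa [natDegree_taylor, hdeg]
    have hP0 : P₀ = (X - C c) ^ P.natDegree := by
      have := congrArg (taylor (-c)) hX
      rw [taylor_taylor, neg_add_cancel, taylor_zero] at this
      rw [this]
      simp [taylor_apply, sub_eq_add_neg]
    have hc0 : c = 0 := by
      have e : P₀.nextCoeff = 0 := by
        rw [nextCoeff_of_natDegree_pos (by omega), hdeg, hP₀, coeff_map, h1, map_zero]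
      rw [hP0, (monic_X_sub_C c).nextCoeff_pow, nextCoeff_X_sub_C, nsmul_eq_mul, mul_eq_zero,
        neg_eq_zero, Nat.cast_eq_zero] at e
      exact e.resolve_left (by omega)
    apply hPi
    rw [← coeff_map, ← hP₀, hP0, hc0, map_zero, sub_zero, coeff_X_pow, if_neg hi.ne]
  obtain ⟨k, hk, hk0⟩ := hex
  obtain ⟨W, h⟩ := exists_monic_dvd (P := taylor (PowerSeries.C c) P) (i := k)
    (by rw [hT, taylor_coeff_zero]; exact hc) (by rw [hTdeg]; exact hk) (by rwa [hT])
  rw [hTdeg] at h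
  exact ⟨_, W, h⟩

/-- Removing the common slope of the Newton polygon of a depressed polynomial. -/
theorem exists_scaleRoots (hP : P.Monic) {i : ℕ} (hi : i < P.natDegree) (hPi : P.coeff i ≠ 0) :
    ∃ (q : ℕ) (hq : q ≠ 0) (p : ℕ) (Q : Polynomial (PowerSeries ℂ)), Q.Monic ∧
      Q.natDegree = P.natDegree ∧
      P.map (PowerSeries.expand q hq : PowerSeries ℂ →ₐ[ℂ] PowerSeries ℂ).toRingHom =
        Q.scaleRoots (PowerSeries.X ^ p) ∧
      ∃ k < P.natDegree, PowerSeries.constantCoeff (Q.coeff k) ≠ 0 := by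
  classical
  set n := P.natDegree with hn
  -- The slopes ord(P_i) / (n - i) have denominators dividing n!, so after x ↦ x^(n!) they become
  -- the integers `w i`. The minimum p is the common slope to remove; where it is attained, the new
  -- coefficient has nonzero constant term.
  set q := n.factorial with hqdef
  have hq : q ≠ 0 := n.factorial_ne_zero
  set I : Finset ℕ := (Finset.range n).filter fun i => P.coeff i ≠ 0 with hI
  have hIne : I.Nonempty := ⟨i, by simp [hI, hi, hPi]⟩
  let w : ℕ → ℕ := fun i => (P.coeff i).order.toNat * (q / (n - i))
  have hw : ∀ i ∈ I, q * (P.coeff i).order.toNat = w i * (n - i) := by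
    intro i hi
    have hi' : i < n := by simp [hI] at hi; exact hi.1
    have : q / (n - i) * (n - i) = q :=
      Nat.div_mul_cancel (Nat.dvd_factorial (by omega) (by omega))
    simp only [w]
    rw [mul_assoc, this, mul_comm]
  obtain ⟨k, hk, hmin⟩ := Finset.exists_min_image I w hIne
  set p := w k
  set φ := (PowerSeries.expand q hq : PowerSeries ℂ →ₐ[ℂ] PowerSeries ℂ).toRingHom with hφ
  have hord : ∀ i, P.coeff i ≠ 0 →
      (φ (P.coeff i)).order = ((q * (P.coeff i).order.toNat : ℕ) : ℕ∞) := by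
    intro i hi
    have : (φ (P.coeff i)).order = _ := PowerSeries.order_expand q hq _
    rw [this]
    have h2 : (P.coeff i).order ≠ ⊤ := mt PowerSeries.order_eq_top.1 hi
    obtain ⟨m, hm⟩ := ENat.ne_top_iff_exists.1 h2
    rw [← hm]
    simp
  have hdvd : ∀ i, ∃ b, (i < n → φ (P.coeff i) = b * (PowerSeries.X ^ p) ^ (n - i)) := by
    intro i
    by_cases hi : i < n
    · by_cases h0 : P.coeff i = 0
      · exact ⟨0, fun _ => by rw [h0, map_zero, zero_mul]⟩
      · have hiI : i ∈ I := by simp [hI, hi, h0]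
        have : PowerSeries.X ^ (p * (n - i)) ∣ φ (P.coeff i) := by
          refine PowerSeries.X_pow_dvd_iff.2 fun m hm => PowerSeries.coeff_of_lt_order m ?_
          rw [hord i h0, hw i hiI]
          exact_mod_cast hm.trans_le (Nat.mul_le_mul_right _ (hmin i hiI))
        obtain ⟨b, hb⟩ := this
        exact ⟨b, fun _ => by rw [hb, pow_mul, mul_comm]⟩
    · exact ⟨0, fun h => absurd h hi⟩
  choose b hb using hdvd
  have hsum : (∑ i : Fin n, C (b i) * X ^ (i : ℕ) : Polynomial (PowerSeries ℂ)).degree < n := by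
    exact degree_sum_fin_lt _
  set Q : Polynomial (PowerSeries ℂ) := X ^ n + ∑ i : Fin n, C (b i) * X ^ (i : ℕ) with hQ
  have hQmon : Q.Monic := monic_X_pow_add hsum
  have hQdeg : Q.natDegree = n := natDegree_eq_of_degree_eq_some (by
    rw [hQ, degree_add_eq_left_of_degree_lt (by rwa [degree_X_pow]), degree_X_pow])
  have hQc : ∀ i < n, Q.coeff i = b i := by
    intro i hi
    rw [hQ, coeff_add, coeff_X_pow, if_neg hi.ne, zero_add, finsetSum_coeff,
      Finset.sum_eq_single (⟨i, hi⟩ : Fin n)]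
    · simp
    · intro j _ hj
      rw [coeff_C_mul, coeff_X_pow, if_neg, mul_zero]
      rintro rfl
      exact hj rfl
    · simp
  refine ⟨q, hq, p, Q, hQmon, hQdeg, ?_, k, ?_, ?_⟩
  · ext1 i
    rw [coeff_map, coeff_scaleRoots, hQdeg]
    rcases lt_trichotomy i n with hi | rfl | hi
    · rw [hQc i hi, hb i hi]
    · rw [hn, hP.coeff_natDegree, ← hn, ← hQdeg, hQmon.coeff_natDegree]
      simp
    · rw [coeff_eq_zero_of_natDegree_lt hi, coeff_eq_zero_of_natDegree_lt (hQdeg.symm ▸ hi)]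
      simp
  · simp [hI] at hk; exact hk.1
  · have hk' : k < n ∧ P.coeff k ≠ 0 := by simpa [hI] using hk
    rw [hQc k hk'.1]
    intro h0
    have h1 := hb k hk'.1
    have h2 := hord k hk'.2
    rw [h1, hw k hk, ← pow_mul, PowerSeries.order_mul, PowerSeries.order_X_pow] at h2
    rw [← PowerSeries.X_dvd_iff] at h0
    obtain ⟨b', hb'⟩ := h0
    rw [hb', PowerSeries.order_mul, PowerSeries.order_X] at h2
    have h3 : b'.order ≠ ⊤ := by
      intro e
      rw [e, add_top, top_add] at h2
      exact ENat.natCast_ne_top _ h2.symm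
    obtain ⟨m, hm⟩ := ENat.ne_top_iff_exists.1 h3
    rw [← hm] at h2
    norm_cast at h2
    simp only [p] at h2
    omega

/-- **Newton-Puiseux**: every nonconstant monic polynomial over `ℂ⟦x⟧` has a Puiseux root. -/
theorem hasPuiseuxRoot (hP : P.Monic) (hd : 0 < P.natDegree) : HasPuiseuxRoot P := by
  induction hn : P.natDegree using Nat.strong_induction_on generalizing P with
  | _ n ih =>
  -- Tschirnhaus translation, killing the coefficient of degree n - 1.
  set c : PowerSeries ℂ := PowerSeries.C (-(1 / n : ℂ)) * P.coeff (n - 1) with hc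
  refine HasPuiseuxRoot.of_taylor (c := c) ?_
  set T := taylor c P with hT
  have hTdeg : T.natDegree = n := by rw [hT, natDegree_taylor, hn]
  have hTmon : T.Monic := by rw [Monic, hT, leadingCoeff_taylor]; exact hP
  have hn0 : (n : ℂ) ≠ 0 := by exact_mod_cast (by omega : n ≠ 0)
  have hT1 : T.coeff (n - 1) = 0 := by
    have : T.coeff (n - 1) = n * c + P.coeff (n - 1) := by
      have hle : (hasseDeriv (n - 1) P).natDegree < 2 := by
        have := natDegree_hasseDeriv_le P (n - 1)
        omega
      rw [hT, taylor_coeff, eval_eq_sum_range' hle, Finset.sum_range_succ, Finset.sum_range_one,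
        hasseDeriv_coeff, hasseDeriv_coeff]
      have e : 1 + (n - 1) = n := by omega
      have e' : n.choose (n - 1) = n := by
        rw [← Nat.choose_symm_of_eq_add (show n = 1 + (n - 1) by omega), Nat.choose_one_right]
      rw [e, e', zero_add, Nat.choose_self, ← hn, hP.coeff_natDegree]
      push_cast
      ring
    rw [this, hc]
    have e : (n : PowerSeries ℂ) = PowerSeries.C (n : ℂ) := by simp
    rw [e, ← mul_assoc, ← map_mul, mul_neg, mul_one_div_cancel hn0]
    simp
  by_cases hall : ∀ i < n, T.coeff i = 0
  · refine ⟨1, one_ne_zero, 0, ?_⟩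
    rw [eval₂_at_zero, hall 0 (by omega), map_zero]
  push Not at hall
  obtain ⟨i, hi, hTi⟩ := hall
  obtain ⟨q, hq, p, Q, hQ, hQd, hTQ, k, hk, hQk⟩ := exists_scaleRoots hTmon (hTdeg.symm ▸ hi) hTi
  refine HasPuiseuxRoot.of_expand hq ?_
  rw [hTQ]
  refine HasPuiseuxRoot.scaleRoots _ ?_
  have hQ1 : Q.coeff (Q.natDegree - 1) = 0 := by
    have := congrArg (fun R => coeff R (n - 1)) hTQ
    simp only [coeff_map, hT1, map_zero, coeff_scaleRoots] at this
    rw [hQd, hTdeg]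
    rcases mul_eq_zero.1 this.symm with h | h
    · exact h
    · exact absurd h (pow_ne_zero _ (pow_ne_zero _ PowerSeries.X_ne_zero))
  -- Q is still depressed but its reduction is no longer X^n, so after a translation a monic factor
  -- of smaller positive degree splits off, to which induction applies.
  obtain ⟨d, W, hW, hW0, hWd, hWQ⟩ := exists_taylor_dvd hQ hQ1 (hQd.symm ▸ hk) hQk
  refine HasPuiseuxRoot.of_taylor (c := d) (HasPuiseuxRoot.of_dvd ?_ hWQ)
  exact ih _ (by omega) hW hW0 rfl

/-- Every monic polynomial over `ℂ⟦x⟧` splits over some `ℂ⟦x ^ (1 / q)⟧`. -/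
theorem exists_puiseux_splitting (hP : P.Monic) :
    ∃ (q : ℕ) (hq : q ≠ 0) (s : Multiset (PowerSeries ℂ)),
      P.map (PowerSeries.expand q hq : PowerSeries ℂ →ₐ[ℂ] PowerSeries ℂ).toRingHom =
        (s.map fun a => X - C a).prod := by
  induction hn : P.natDegree generalizing P with
  | zero =>
    refine ⟨1, one_ne_zero, 0, ?_⟩
    rw [hP.natDegree_eq_zero.1 hn]
    simp
  | succ n ih =>
    obtain ⟨q, hq, a, ha⟩ := hasPuiseuxRoot hP (by omega)
    set φ := (PowerSeries.expand q hq : PowerSeries ℂ →ₐ[ℂ] PowerSeries ℂ).toRingHom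
    have hroot : (P.map φ).IsRoot a := by rwa [IsRoot.def, eval_map]
    obtain ⟨R, hR⟩ := dvd_iff_isRoot.2 hroot
    have hRmon : R.Monic := (monic_X_sub_C a).of_mul_monic_left (hR ▸ hP.map φ)
    have hRdeg : R.natDegree = n := by
      have := congrArg natDegree hR
      rw [hP.natDegree_map, (monic_X_sub_C a).natDegree_mul hRmon, natDegree_X_sub_C, hn] at this
      omega
    obtain ⟨p, hp, s, hs⟩ := ih hRmon hRdeg
    set ψ := (PowerSeries.expand p hp : PowerSeries ℂ →ₐ[ℂ] PowerSeries ℂ).toRingHom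
    refine ⟨_, p.mul_ne_zero hp hq, ψ a ::ₘ s, ?_⟩
    rw [← expand_comp_expand hp hq, ← Polynomial.map_map, hR, Polynomial.map_mul, hs]
    simp [ψ]

end Puiseux

end PlaneBranch

namespace PlaneBranch

open MvPowerSeries

/-! ### Weierstrass preparation with convergence. -/

section Weierstrass

/-- The coefficients of the multiplier in the Weierstrass preparation theorem. -/
def weierstrassCoeff (g : 𝓡) (n : ℕ) : ℕ → ℕ → ℂ
  | i, j => (if i = 0 ∧ j = 0 then 1 else 0) -
      ∑ a : Fin (i + 1), ∑ b : Fin (j + n + 1),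
        if _ : 0 < (a : ℕ) ∨ n < (b : ℕ) then
          cf g a b * weierstrassCoeff g n (i - a) (j + n - b) else 0
-- Terms with a > 0 may call a larger second index, but then the first one drops; terms with a = 0
-- have b > n and lower the second. Hence the lexicographic order.
termination_by i j => (i, j)
decreasing_by
  have := a.2
  have := b.2
  rw [Prod.lex_def]
  simp only
  omega

theorem weierstrassCoeff_eq (g : 𝓡) (n i j : ℕ) :
    weierstrassCoeff g n i j = (if i = 0 ∧ j = 0 then 1 else 0) -
      ∑ a ∈ Finset.range (i + 1), ∑ b ∈ Finset.range (j + n + 1),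
        if 0 < a ∨ n < b then cf g a b * weierstrassCoeff g n (i - a) (j + n - b) else 0 := by
  rw [weierstrassCoeff, Finset.sum_range]
  simp only [Finset.sum_range, dite_eq_ite]

theorem cf_mul' (f g : 𝓡) (i j : ℕ) :
    cf (f * g) i j = ∑ a ∈ Finset.range (i + 1), ∑ b ∈ Finset.range (j + 1),
      cf g a b * cf f (i - a) (j - b) := by
  rw [mul_comm, cf_mul, Finset.Nat.sum_antidiagonal_eq_sum_range_succ_mk]
  refine Finset.sum_congr rfl fun a _ => ?_
  rw [Finset.Nat.sum_antidiagonal_eq_sum_range_succ_mk]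

theorem isConvergent_iff {f : 𝓡} :
    IsConvergent f ↔ ∃ c K : ℝ, 0 < K ∧ ∀ i j, ‖cf f i j‖ ≤ c * K ^ (i + j) := by
  constructor
  · rintro ⟨c, K, hK, h⟩
    refine ⟨c, K, hK, fun i j => ?_⟩
    have := h (Finsupp.single 0 i + Finsupp.single 1 j)
    rwa [map_add, Finsupp.degree_single, Finsupp.degree_single] at this
  · rintro ⟨c, K, hK, h⟩
    refine ⟨c, K, hK, fun n => ?_⟩
    rw [coeff_eq_cf, Finsupp.degree_eq_sum, Fin.sum_univ_two]
    exact h _ _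

theorem sum_geom_le {r : ℝ} (h0 : 0 ≤ r) (h1 : r ≤ 1 / 2) (n : ℕ) :
    ∑ b ∈ Finset.range n, r ^ b ≤ 2 := by
  calc ∑ b ∈ Finset.range n, r ^ b ≤ ∑ b ∈ Finset.range n, (1 / 2 : ℝ) ^ b := by gcongr
    _ ≤ 2 := by simpa using sum_geometric_two_le n

/-- The terms with a > 0 gain a factor r, and those with a = 0 start at b = n + 1; each remaining
geometric sum is at most 2. -/
theorem sum_sum_geom_le {r s : ℝ} (hr : 0 ≤ r) (hr' : r ≤ 1 / 2) (hs : 0 ≤ s) (hs' : s ≤ 1 / 2)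
    (n i j : ℕ) :
    ∑ a ∈ Finset.range (i + 1), ∑ b ∈ Finset.range (j + n + 1),
      (if 0 < a ∨ n < b then r ^ a * s ^ b else 0) ≤ r * 4 + s ^ (n + 1) * 2 := by
  rw [Finset.sum_range_succ']
  refine add_le_add ?_ ?_
  · simp only [Nat.zero_lt_succ, true_or, if_true]
    calc _ = (∑ a ∈ Finset.range i, r ^ (a + 1)) * ∑ b ∈ Finset.range (j + n + 1), s ^ b := by
          rw [Finset.sum_mul_sum]
      _ = r * ((∑ a ∈ Finset.range i, r ^ a) * ∑ b ∈ Finset.range (j + n + 1), s ^ b) := by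
          simp_rw [pow_succ', ← Finset.mul_sum]
          ring
      _ ≤ r * (2 * 2) := by
          gcongr
          · exact sum_geom_le hr hr' _
          · exact sum_geom_le hs hs' _
      _ = r * 4 := by ring
  · rw [show j + n + 1 = n + 1 + j by ring, Finset.sum_range_add, Finset.sum_eq_zero, zero_add]
    · calc _ = s ^ (n + 1) * ∑ b ∈ Finset.range j, s ^ b := by
            rw [Finset.mul_sum]
            refine Finset.sum_congr rfl fun b _ => ?_
            rw [if_pos (Or.inr (by omega)), pow_zero, one_mul, pow_add]
        _ ≤ _ := by gcongr; exact sum_geom_le hs hs' _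
    · intro b hb
      rw [if_neg]
      simp at hb
      omega

theorem norm_weierstrassCoeff_le {g : 𝓡} {n : ℕ} (hg : IsConvergent g) :
    ∃ L M : ℝ, 0 < L ∧ 0 < M ∧ ∀ i j, ‖weierstrassCoeff g n i j‖ ≤ L ^ i * M ^ j := by
  obtain ⟨c, K, hK, h⟩ := isConvergent_iff.1 hg
  have hc : 0 ≤ c := by simpa using (norm_nonneg _).trans (h 0 0)
  -- The induction closes if c M^n (4/l + 2 m^(-n-1)) ≤ 1. Since M = K m, the second part is
  -- 2cK^n/m, at most 1/2 for this m. With M then fixed, l ≥ 8cM^n makes the first part at most 1/2.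
  -- The 2's keep both ratios below 1/2.
  set m : ℝ := 2 + 4 * c * K ^ n with hm
  have hm2 : 2 ≤ m := by rw [hm]; nlinarith [mul_nonneg hc (pow_nonneg hK.le n)]
  set M := K * m with hM
  have hMpos : 0 < M := by positivity
  set l : ℝ := 2 + 8 * c * M ^ n with hl
  have hl2 : 2 ≤ l := by rw [hl]; nlinarith [mul_nonneg hc (pow_nonneg hMpos.le n)]
  set L := K * l with hL
  have hLpos : 0 < L := by positivity
  -- the term `(a, b)` of the recursion
  have hterm' : ∀ a b i j, a ≤ i → b ≤ j + n →
      c * K ^ (a + b) * (L ^ (i - a) * M ^ (j + n - b)) =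
        L ^ i * M ^ j * (c * M ^ n * ((1 / l) ^ a * (1 / m) ^ b)) := by
    intro a b i j ha hb
    have e1 : L ^ i = L ^ (i - a) * (K ^ a * l ^ a) := by
      rw [← mul_pow, ← hL, ← pow_add, Nat.sub_add_cancel ha]
    have e2 : M ^ j * M ^ n = M ^ (j + n - b) * (K ^ b * m ^ b) := by
      rw [← mul_pow, ← hM, ← pow_add, ← pow_add, Nat.sub_add_cancel hb]
    have e3 : L ^ i * M ^ j * (c * M ^ n * ((1 / l) ^ a * (1 / m) ^ b)) =
        c * (L ^ i) * (M ^ j * M ^ n) * ((1 / l) ^ a * (1 / m) ^ b) := by ring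
    rw [e3, e1, e2]
    have hl0 : l ≠ 0 := by positivity
    have hm0 : m ≠ 0 := by positivity
    rw [one_div, one_div, inv_pow, inv_pow]
    field_simp
    ring
  have hl1 : 1 / l ≤ 1 / 2 := by gcongr
  have hm1 : 1 / m ≤ 1 / 2 := by gcongr
  have hl0 : 0 ≤ 1 / l := by positivity
  have hm0 : 0 ≤ 1 / m := by positivity
  have hbnd : c * M ^ n * (1 / l * 4) ≤ 1 / 2 := by
    rw [one_div, ← div_eq_inv_mul, ← mul_div_assoc, div_le_iff₀ (by positivity), hl]
    linarith
  have hbnd' : c * M ^ n * ((1 / m) ^ (n + 1) * 2) ≤ 1 / 2 := by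
    have : M ^ n * (1 / m) ^ (n + 1) = K ^ n * (1 / m) := by
      rw [hM, mul_pow, pow_succ]
      have hm0 : m ≠ 0 := by positivity
      rw [one_div, inv_pow]
      field_simp
    calc c * M ^ n * ((1 / m) ^ (n + 1) * 2) = 2 * c * (M ^ n * (1 / m) ^ (n + 1)) := by ring
      _ = (2 * c * K ^ n) / m := by rw [this]; ring
      _ ≤ 1 / 2 := by
        rw [div_le_iff₀ (by positivity), hm]
        linarith
  clear_value l m
  refine ⟨L, M, hLpos, hMpos, fun i j => ?_⟩
  induction i using Nat.strong_induction_on generalizing j with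
  | _ i ihi =>
  induction j using Nat.strong_induction_on with
  | _ j ihj =>
  rw [weierstrassCoeff_eq]
  by_cases h0 : i = 0 ∧ j = 0
  · obtain ⟨rfl, rfl⟩ := h0
    rw [Finset.sum_eq_zero]
    · simp
    · intro a ha
      refine Finset.sum_eq_zero fun b hb => ?_
      rw [if_neg]
      simp at ha hb
      omega
  rw [if_neg h0, zero_sub, norm_neg]
  have hkey : ∀ a ∈ Finset.range (i + 1), ∀ b ∈ Finset.range (j + n + 1),
      ‖if 0 < a ∨ n < b then cf g a b * weierstrassCoeff g n (i - a) (j + n - b) else 0‖ ≤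
        L ^ i * M ^ j * (c * M ^ n) *
          (if 0 < a ∨ n < b then (1 / l) ^ a * (1 / m) ^ b else 0) := by
    intro a ha b hb
    simp only [Finset.mem_range] at ha hb
    split_ifs with hab
    · have hq : ‖weierstrassCoeff g n (i - a) (j + n - b)‖ ≤ L ^ (i - a) * M ^ (j + n - b) := by
        rcases Nat.eq_zero_or_pos a with rfl | ha'
        · exact ihj _ (by omega)
        · exact ihi _ (by omega) _
      rw [norm_mul]
      calc _ ≤ c * K ^ (a + b) * (L ^ (i - a) * M ^ (j + n - b)) := by gcongr; exact h _ _
        _ = _ := by rw [hterm' a b i j (by omega) (by omega)]; ring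
    · simp
  refine (norm_sum_le_of_le _ fun a ha => norm_sum_le_of_le _ fun b hb => hkey a ha b hb).trans ?_
  simp_rw [← Finset.mul_sum]
  calc _ ≤ L ^ i * M ^ j * (c * M ^ n) * (1 / l * 4 + (1 / m) ^ (n + 1) * 2) := by
        gcongr
        exact sum_sum_geom_le hl0 hl1 hm0 hm1 n i j
    _ ≤ L ^ i * M ^ j * 1 := by
        rw [mul_assoc]
        gcongr
        linarith
    _ = _ := mul_one _

/-- **Weierstrass preparation** for `ℂ⟦x, y⟧` and for `ℂ{x, y}`. -/
theorem exists_weierstrass {g : 𝓡} {n : ℕ} (h0 : ∀ j < n, cf g 0 j = 0) (hn : cf g 0 n ≠ 0) :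
    ∃ q : 𝓡, cf q 0 0 ≠ 0 ∧ (IsConvergent g → IsConvergent q) ∧
      ∀ i j, cf (q * g) i (j + n) = if i = 0 ∧ j = 0 then 1 else 0 := by
  -- After this scaling g'(0, y) begins with y^n, so the term a = 0, b = n of the convolution is
  -- exactly the coefficient that the recursion solves for.
  set e : ℂ := (cf g 0 n)⁻¹ with he
  have he0 : e ≠ 0 := inv_ne_zero hn
  set g' : 𝓡 := C e * g with hg'
  set q : 𝓡 := ofCoeff (weierstrassCoeff g' n) with hq
  have hg0 : ∀ j < n, cf g' 0 j = 0 := fun j hj => by rw [hg', cf_C_mul, h0 j hj, mul_zero]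
  have hgn : cf g' 0 n = 1 := by rw [hg', cf_C_mul, he, inv_mul_cancel₀ hn]
  have hqg : ∀ i j, cf (q * g') i (j + n) = if i = 0 ∧ j = 0 then 1 else 0 := by
    intro i j
    rw [cf_mul', sub_eq_iff_eq_add.1 (weierstrassCoeff_eq g' n i j).symm]
    have hsplit : ∀ a ∈ Finset.range (i + 1), ∀ b ∈ Finset.range (j + n + 1),
        cf g' a b * cf q (i - a) (j + n - b) =
          (if 0 < a ∨ n < b then cf g' a b * weierstrassCoeff g' n (i - a) (j + n - b) else 0) +
          if a = 0 then (if b = n then weierstrassCoeff g' n i j else 0) else 0 := by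
      intro a _ b _
      rw [hq, cf_ofCoeff]
      rcases Nat.eq_zero_or_pos a with rfl | ha
      · rcases lt_trichotomy b n with hb | rfl | hb
        · rw [hg0 b hb]; simp [hb.not_gt, hb.ne]
        · simp [hgn]
        · simp [hb, hb.ne']
      · simp [ha, ha.ne']
    rw [Finset.sum_congr rfl fun a ha => Finset.sum_congr rfl (hsplit a ha)]
    simp only [Finset.sum_add_distrib]
    rw [add_comm]
    congr 1
    rw [Finset.sum_eq_single 0 (fun a _ ha => by simp [ha]) (by simp)]
    simp
  refine ⟨q * C e, ?_, fun hg => ?_, fun i j => ?_⟩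
  · rw [mul_comm, cf_C_mul, hq, cf_ofCoeff, weierstrassCoeff_eq, Finset.sum_eq_zero]
    · simpa using he0
    · intro a ha
      refine Finset.sum_eq_zero fun b hb => ?_
      rw [if_neg]
      simp at ha hb
      omega
  · refine IsConvergent.mul ?_ (isConvergent_C _)
    have hg'' : IsConvergent g' := IsConvergent.mul (isConvergent_C _) hg
    obtain ⟨L, M, hL, hM, h⟩ := norm_weierstrassCoeff_le (n := n) hg''
    refine isConvergent_iff.2 ⟨1, max L M, lt_max_of_lt_left hL, fun i j => ?_⟩
    rw [hq, cf_ofCoeff, one_mul, pow_add]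
    refine (h i j).trans ?_
    gcongr
    · exact le_max_left _ _
    · exact le_max_right _ _
  · rw [mul_assoc, ← hg', hqg]

/-- This is Weierstrass preparation in order n = 0. -/
theorem exists_convergent_inverse {g : 𝓡} (hg : IsConvergent g) (h0 : cf g 0 0 ≠ 0) :
    ∃ q : 𝓡, IsConvergent q ∧ q * g = 1 := by
  obtain ⟨q, -, hq, h⟩ := exists_weierstrass (n := 0) (by simp) h0
  refine ⟨q, hq hg, cf_ext fun i j => ?_⟩
  rw [← add_zero j, h, ← map_one C, cf_C, add_zero]

theorem isUnit_germ_iff {g : 𝒪} : IsUnit g ↔ cf g 0 0 ≠ 0 := by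
  constructor
  · intro h
    exact isUnit_iff_cf.1 (h.map convergentSeries.val)
  · intro h
    obtain ⟨q, hq, hqg⟩ := exists_convergent_inverse g.2 h
    exact IsUnit.of_mul_eq_one (⟨q, hq⟩ : 𝒪) (Subtype.ext ((mul_comm _ _).trans hqg))

theorem IsConvergent.of_X_zero_pow_mul {f : 𝓡} {n : ℕ} (h : IsConvergent (X 0 ^ n * f)) :
    IsConvergent f := by
  obtain ⟨c, K, hK, h⟩ := isConvergent_iff.1 h
  refine isConvergent_iff.2 ⟨c * K ^ n, K, hK, fun i j => ?_⟩
  have := h (i + n) j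
  rw [cf_X_zero_pow_mul] at this
  refine this.trans (le_of_eq ?_)
  ring

end Weierstrass

/-! ### Polynomials in y over ℂ⟦x⟧. -/

section PolynomialInY

/-- A power series in `x`, as an element of `ℂ⟦x, y⟧`. -/
def seriesInX : PowerSeries ℂ →+* 𝓡 :=
  iterEquiv.symm.toRingEquiv.toRingHom.comp (PowerSeries.map PowerSeries.C)

theorem cf_seriesInX (a : PowerSeries ℂ) (i j : ℕ) :
    cf (seriesInX a) i j = if j = 0 then PowerSeries.coeff i a else 0 := by
  change cf (iterEquiv.symm _) i j = _
  rw [cf_iterEquiv_symm, PowerSeries.coeff_map, PowerSeries.coeff_C]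

theorem seriesInX_X : seriesInX PowerSeries.X = X 0 := by
  refine cf_ext fun i j => ?_
  rw [cf_seriesInX, PowerSeries.coeff_X, ← mul_one (X 0), ← map_one C]
  rcases i with _ | i
  · rw [cf_X_zero_mul_zero]; simp
  · rw [cf_X_zero_mul_succ, cf_C]
    by_cases hi : i = 0 <;> by_cases hj : j = 0 <;> simp [hi, hj]

/-- A polynomial in `y` with coefficients in `ℂ⟦x⟧`, as an element of `ℂ⟦x, y⟧`. -/
def polyInY : Polynomial (PowerSeries ℂ) →+* 𝓡 := Polynomial.eval₂RingHom seriesInX (X 1)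

theorem cf_polyInY (P : Polynomial (PowerSeries ℂ)) (i j : ℕ) :
    cf (polyInY P) i j = PowerSeries.coeff i (P.coeff j) := by
  induction P using Polynomial.induction_on' with
  | add p q hp hq => rw [map_add, cf_add, hp, hq, Polynomial.coeff_add, map_add]
  | monomial n a =>
    rw [polyInY, Polynomial.coe_eval₂RingHom, Polynomial.eval₂_monomial, mul_comm,
      Polynomial.coeff_monomial]
    rcases lt_or_ge j n with hj | hj
    · rw [cf_X_one_pow_mul_of_lt hj, if_neg hj.ne', map_zero]
    · obtain ⟨k, rfl⟩ := Nat.exists_eq_add_of_le' hj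
      rw [cf_X_one_pow_mul, cf_seriesInX]
      by_cases hk : k = 0 <;> simp [hk]

theorem pderiv_polyInY (P : Polynomial (PowerSeries ℂ)) :
    MvPowerSeries.pderiv ℂ 1 (polyInY P) = polyInY P.derivative := by
  refine cf_ext fun i j => ?_
  rw [cf_pderiv_one, cf_polyInY, cf_polyInY, Polynomial.coeff_derivative,
    show ((j : PowerSeries ℂ) + 1) = PowerSeries.C ((j : ℂ) + 1) by simp, PowerSeries.coeff_mul_C]

/-- A power series whose coefficients are those of a monic polynomial of degree `n` in `y`. -/
theorem exists_polyInY {W : 𝓡} {n : ℕ}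
    (hW : ∀ i j, cf W i (j + n) = if i = 0 ∧ j = 0 then 1 else 0) :
    ∃ P : Polynomial (PowerSeries ℂ), P.Monic ∧ P.natDegree = n ∧ polyInY P = W := by
  have hd : (∑ j : Fin n, Polynomial.C (PowerSeries.mk fun i => cf W i j) *
      Polynomial.X ^ (j : ℕ)).degree < (n : WithBot ℕ) := Polynomial.degree_sum_fin_lt _
  set P := Polynomial.X ^ n + ∑ j : Fin n, Polynomial.C (PowerSeries.mk fun i => cf W i j) *
      Polynomial.X ^ (j : ℕ) with hP
  have hmon : P.Monic := Polynomial.monic_X_pow_add hd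
  have hdeg : P.natDegree = n := Polynomial.natDegree_eq_of_degree_eq_some (by
    rw [hP, Polynomial.degree_add_eq_left_of_degree_lt (by rwa [Polynomial.degree_X_pow]),
      Polynomial.degree_X_pow])
  refine ⟨P, hmon, hdeg, cf_ext fun i j => ?_⟩
  rw [cf_polyInY]
  rcases lt_or_ge j n with hj | hj
  · rw [hP, Polynomial.coeff_add, Polynomial.coeff_X_pow, if_neg hj.ne, zero_add,
      Polynomial.finsetSum_coeff, Finset.sum_eq_single (⟨j, hj⟩ : Fin n)]
    · simp
    · intro k _ hk
      rw [Polynomial.coeff_C_mul, Polynomial.coeff_X_pow, if_neg, mul_zero]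
      rintro rfl
      exact hk rfl
    · simp
  · obtain ⟨k, rfl⟩ := Nat.exists_eq_add_of_le' hj
    rw [hW]
    rcases Nat.eq_zero_or_pos k with rfl | hk
    · rw [zero_add]
      have := hmon.coeff_natDegree
      rw [hdeg] at this
      rw [this, PowerSeries.coeff_one]
      simp
    · rw [Polynomial.coeff_eq_zero_of_natDegree_lt (by omega), map_zero, if_neg (by omega)]

end PolynomialInY

/-! ### An irreducible convergent germ is reduced: powers of x in (f, f_y). -/

section Reduced

/-- The ring `ℂ{x}` of convergent power series in one variable. -/
def convergentSeriesInX : Subring (PowerSeries ℂ) := convergentSeries.toSubring.comap seriesInX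

theorem mem_convergentSeriesInX {a : PowerSeries ℂ} :
    a ∈ convergentSeriesInX ↔ IsConvergent (seriesInX a) := Iff.rfl

theorem exists_inverse_convergentSeriesInX {a : PowerSeries ℂ} (ha : a ∈ convergentSeriesInX)
    (h0 : PowerSeries.constantCoeff a ≠ 0) : ∃ b ∈ convergentSeriesInX, a * b = 1 := by
  have h : cf (seriesInX a) 0 0 ≠ 0 := by simpa [cf_seriesInX] using h0
  obtain ⟨q, hq, hqa⟩ := exists_convergent_inverse ha h
  have hab : a * a⁻¹ = 1 := PowerSeries.mul_inv_cancel a h0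
  refine ⟨a⁻¹, ?_, hab⟩
  have : seriesInX a⁻¹ = q := by
    have h1 : seriesInX a * seriesInX a⁻¹ = 1 := by rw [← map_mul, hab, map_one]
    linear_combination q * h1 - seriesInX a⁻¹ * hqa
  rwa [mem_convergentSeriesInX, this]

theorem exists_eq_X_pow_mul {a : PowerSeries ℂ} (ha : a ∈ convergentSeriesInX) (h : a ≠ 0) :
    ∃ n, ∃ u ∈ convergentSeriesInX, ∃ v ∈ convergentSeriesInX,
      a = PowerSeries.X ^ n * u ∧ u * v = 1 := by
  obtain ⟨n, hn⟩ := ENat.ne_top_iff_exists.1 (mt PowerSeries.order_eq_top.1 h)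
  have hn' : a.order = n := hn.symm
  obtain ⟨u, rfl⟩ := PowerSeries.X_pow_dvd_iff.2 fun m hm =>
    PowerSeries.coeff_of_lt_order m (show (m : ℕ∞) < a.order by rw [hn']; exact_mod_cast hm)
  have hu : u ∈ convergentSeriesInX := by
    rw [mem_convergentSeriesInX, map_mul, map_pow, seriesInX_X] at ha
    exact ha.of_X_zero_pow_mul
  have h0 : PowerSeries.constantCoeff u ≠ 0 := by
    have := ((PowerSeries.order_eq_nat).1 hn').1
    rwa [PowerSeries.coeff_X_pow_mul', if_pos le_rfl, Nat.sub_self,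
      PowerSeries.coeff_zero_eq_constantCoeff_apply] at this
  obtain ⟨v, hv, huv⟩ := exists_inverse_convergentSeriesInX hu h0
  exact ⟨n, u, hu, v, hv, rfl, huv⟩

theorem X_mem_convergentSeriesInX : PowerSeries.X ∈ convergentSeriesInX := by
  rw [mem_convergentSeriesInX, seriesInX_X]
  refine isConvergent_iff.2 ⟨1, 1, one_pos, fun i j => ?_⟩
  rw [← seriesInX_X, cf_seriesInX, PowerSeries.coeff_X]
  split_ifs <;> simp

/-- Every nonzero element is a power of x times a unit. A valuation ring is integrally closed, which
is what Gauss's lemma for monic polynomials over ℂ{x} requires. -/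
instance : ValuationRing convergentSeriesInX where
  cond' a b := by
    by_cases ha : a = 0
    · exact ⟨0, Or.inr (by rw [ha, mul_zero])⟩
    by_cases hb : b = 0
    · exact ⟨0, Or.inl (by rw [hb, mul_zero])⟩
    obtain ⟨n, u, hu, v, hv, h1, huv⟩ := exists_eq_X_pow_mul a.2 (by simpa using ha)
    obtain ⟨m, u', hu', v', hv', h1', huv'⟩ := exists_eq_X_pow_mul b.2 (by simpa using hb)
    have hX := X_mem_convergentSeriesInX
    rcases le_total n m with hnm | hnm
    · refine ⟨⟨PowerSeries.X ^ (m - n) * v * u',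
        mul_mem (mul_mem (pow_mem hX _) hv) hu'⟩, Or.inl (Subtype.ext ?_)⟩
      change (a : PowerSeries ℂ) * _ = b
      rw [h1, h1', ← Nat.sub_add_cancel hnm, Nat.add_sub_cancel, pow_add]
      linear_combination PowerSeries.X ^ n * PowerSeries.X ^ (m - n) * u' * huv
    · refine ⟨⟨PowerSeries.X ^ (n - m) * v' * u,
        mul_mem (mul_mem (pow_mem hX _) hv') hu⟩, Or.inr (Subtype.ext ?_)⟩
      change (b : PowerSeries ℂ) * _ = a
      rw [h1, h1', ← Nat.sub_add_cancel hnm, Nat.add_sub_cancel, pow_add]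
      linear_combination PowerSeries.X ^ m * PowerSeries.X ^ (n - m) * u * huv'

/-- The germ of a polynomial in `y` with coefficients in `ℂ{x}`. -/
def polyGerm : Polynomial convergentSeriesInX →+* 𝒪 :=
  Polynomial.eval₂RingHom
    ((seriesInX.comp convergentSeriesInX.subtype).codRestrict convergentSeries fun a => a.2)
    ⟨X 1, by
      refine isConvergent_iff.2 ⟨1, 1, one_pos, fun i j => ?_⟩
      have : (X 1 : 𝓡) = polyInY Polynomial.X := by simp [polyInY]
      rw [this, cf_polyInY, Polynomial.coeff_X]
      split_ifs
      · rw [PowerSeries.coeff_one]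
        split_ifs <;> simp
      · simp⟩

theorem coe_polyGerm (P : Polynomial convergentSeriesInX) :
    (polyGerm P : 𝓡) = polyInY (P.map convergentSeriesInX.subtype) := by
  rw [polyInY, Polynomial.coe_eval₂RingHom, Polynomial.eval₂_map, polyGerm,
    Polynomial.coe_eval₂RingHom]
  exact Polynomial.hom_eval₂ P _ (convergentSeries.val : 𝒪 →+* 𝓡) _

theorem partialDeriv_polyGerm (P : Polynomial convergentSeriesInX) :
    partialDeriv 1 (polyGerm P) = polyGerm P.derivative := by
  refine Subtype.ext ?_
  rw [coe_polyGerm, ← Polynomial.derivative_map, ← pderiv_polyInY, ← coe_polyGerm]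
  rfl

/-- The germ `x`. -/
def germX : 𝒪 := ⟨X 0, by
  have := X_mem_convergentSeriesInX
  rwa [mem_convergentSeriesInX, seriesInX_X] at this⟩

/-- A monic polynomial in `y` over `ℂ{x}` with irreducible germ, which reduces to a power of
`y`, is irreducible. -/
theorem irreducible_of_polyGerm {P : Polynomial convergentSeriesInX} (hP : P.Monic)
    (hX : (P.map convergentSeriesInX.subtype).map PowerSeries.constantCoeff =
      Polynomial.X ^ P.natDegree)
    (hirr : Irreducible (polyGerm P)) : Irreducible P := by
  -- Modulo x a monic factor F divides a power of y, so if its degree is positive its germ vanishes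
  -- at the origin and cannot be a unit. Thus a polynomial factorization gives a factorization of
  -- the germ into non-units.
  have key : ∀ F G : Polynomial convergentSeriesInX, F.Monic → F * G = P →
      IsUnit (polyGerm F) → F.natDegree = 0 := by
    intro F G hF hFG hu
    set F₀ := (F.map convergentSeriesInX.subtype).map PowerSeries.constantCoeff with hF₀
    have hmon : F₀.Monic := (hF.map _).map _
    have hdeg : F₀.natDegree = F.natDegree := by
      rw [hF₀, (hF.map _).natDegree_map, hF.natDegree_map]
    have hdvd : F₀ ∣ Polynomial.X ^ P.natDegree := by
      rw [← hX, ← hFG, Polynomial.map_mul, Polynomial.map_mul]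
      exact dvd_mul_right _ _
    by_contra hne
    obtain ⟨r, hr⟩ := IsAlgClosed.exists_root F₀ (by
      rw [Polynomial.degree_eq_natDegree hmon.ne_zero, hdeg]
      exact_mod_cast hne)
    have hr0 : r = 0 := by
      have := hr.dvd hdvd
      rw [Polynomial.IsRoot.def, Polynomial.eval_pow, Polynomial.eval_X] at this
      exact eq_zero_of_pow_eq_zero this
    rw [isUnit_germ_iff, coe_polyGerm, cf_polyInY] at hu
    apply hu
    rw [hr0, Polynomial.IsRoot.def, ← Polynomial.coeff_zero_eq_eval_zero, hF₀,
      Polynomial.coeff_map] at hr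
    simpa using hr
  rw [hP.irreducible_iff_natDegree]
  refine ⟨fun h1 => hirr.not_isUnit (by rw [h1, map_one]; exact isUnit_one), ?_⟩
  intro F G hF hG hFG
  rcases hirr.isUnit_or_isUnit (by rw [← hFG, map_mul]) with h | h
  · exact Or.inl (key F G hF hFG h)
  · exact Or.inr (key G F hG (by rw [mul_comm, hFG]) h)

/-- By Gauss's lemma P stays irreducible over the fraction field of ℂ{x}, hence is separable in
characteristic 0. Clearing denominators in a Bézout relation for P and P' leaves a nonzero element
of ℂ{x}, that is, a unit times a power of x. -/
theorem exists_X_pow_mem_of_irreducible {P : Polynomial convergentSeriesInX} (hP : P.Monic)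
    (hirr : Irreducible P) : ∃ (n : ℕ) (a b : 𝒪), germX ^ n =
      a * polyGerm P + b * partialDeriv 1 (polyGerm P) := by
  set K := FractionRing convergentSeriesInX
  have hirrK := (hP.irreducible_iff_irreducible_map_fraction_map (K := K)).1 hirr
  have : CharZero convergentSeriesInX := by
    refine ⟨fun a b h => ?_⟩
    have := congrArg (fun a : convergentSeriesInX => PowerSeries.constantCoeff (a : PowerSeries ℂ)) h
    simpa using this
  have : CharZero K := charZero_of_injective_algebraMap (IsFractionRing.injective convergentSeriesInX K)
  obtain ⟨a, b, hab⟩ := hirrK.separable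
  obtain ⟨c, hc, hca⟩ := IsLocalization.integerNormalization_spec (nonZeroDivisors convergentSeriesInX) a
  obtain ⟨d, hd, hdb⟩ := IsLocalization.integerNormalization_spec (nonZeroDivisors convergentSeriesInX) b
  set a' := IsLocalization.integerNormalization (nonZeroDivisors convergentSeriesInX) a
  set b' := IsLocalization.integerNormalization (nonZeroDivisors convergentSeriesInX) b
  have key : Polynomial.C d * a' * P + Polynomial.C c * b' * P.derivative = Polynomial.C (c * d) := by
    apply Polynomial.map_injective _ (IsFractionRing.injective convergentSeriesInX K)
    rw [Polynomial.map_add, Polynomial.map_mul, Polynomial.map_mul, Polynomial.map_mul,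
      Polynomial.map_mul, hca, hdb, Polynomial.map_C, Polynomial.map_C, Polynomial.map_C,
      ← Polynomial.derivative_map, map_mul, Polynomial.C_mul, Algebra.smul_def, Algebra.smul_def]
    simp only [Polynomial.algebraMap_apply]
    linear_combination Polynomial.C (algebraMap convergentSeriesInX K c) *
      Polynomial.C (algebraMap convergentSeriesInX K d) * hab
  have hcd : c * d ≠ 0 := mul_ne_zero (nonZeroDivisors.ne_zero hc) (nonZeroDivisors.ne_zero hd)
  obtain ⟨n, u, hu, v, hv, h1, huv⟩ := exists_eq_X_pow_mul (c * d).2 (by simpa using hcd)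
  have h2 := congrArg polyGerm key
  rw [map_add, map_mul, map_mul _ _ (Polynomial.derivative P), ← partialDeriv_polyGerm] at h2
  have h3 : polyGerm (Polynomial.C (c * d)) * polyGerm (Polynomial.C ⟨v, hv⟩) = germX ^ n := by
    rw [← map_mul, ← Polynomial.C_mul]
    refine Subtype.ext ?_
    rw [coe_polyGerm, Polynomial.map_C]
    change polyInY (Polynomial.C (((c * d : convergentSeriesInX) : PowerSeries ℂ) * v)) = X 0 ^ n
    rw [h1, mul_assoc, huv, mul_one, ← seriesInX_X, ← map_pow]
    exact Polynomial.eval₂_C _ _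
  refine ⟨n, polyGerm (Polynomial.C d * a') * polyGerm (Polynomial.C ⟨v, hv⟩),
    polyGerm (Polynomial.C c * b') * polyGerm (Polynomial.C ⟨v, hv⟩), ?_⟩
  rw [← h3, ← h2]
  ring

/-- An irreducible germ which is regular in `y` is reduced: `x ^ m ∈ (f, ∂f/∂y)` for some `m`. -/
theorem exists_X_pow_mem {f : 𝒪} (hirr : Irreducible f) {n : ℕ}
    (h0 : ∀ j < n, cf (f : 𝓡) 0 j = 0) (hn : cf (f : 𝓡) 0 n ≠ 0) :
    ∃ (m : ℕ) (a b : 𝒪), germX ^ m = a * f + b * partialDeriv 1 f := by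
  obtain ⟨q, hq0, hq, hW⟩ := exists_weierstrass h0 hn
  obtain ⟨P, hP, hPn, hPW⟩ := exists_polyInY hW
  have hcoef : (↑P.coeffs : Set (PowerSeries ℂ)) ⊆ convergentSeriesInX := by
    have hWc : IsConvergent (q * f) := (hq f.2).mul f.2
    obtain ⟨c, K, hK, h⟩ := isConvergent_iff.1 hWc
    have hc : 0 ≤ c := by simpa using (norm_nonneg _).trans (h 0 0)
    intro a ha
    obtain ⟨j, -, rfl⟩ := Polynomial.mem_coeffs_iff.1 ha
    refine isConvergent_iff.2 ⟨c * K ^ j, K, hK, fun i k => ?_⟩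
    rw [cf_seriesInX]
    split_ifs with hk
    · rw [← cf_polyInY, hPW, hk]
      refine (h i j).trans (le_of_eq ?_)
      ring
    · simp only [norm_zero]
      positivity
  set P' := P.toSubring convergentSeriesInX hcoef with hP'
  have hmap : P'.map convergentSeriesInX.subtype = P := Polynomial.map_toSubring _ _ _
  have hmon : P'.Monic := (Polynomial.monic_toSubring _ _ _).2 hP
  have hdeg : P'.natDegree = n := (Polynomial.natDegree_toSubring _ _ _).trans hPn
  set q' : 𝒪 := ⟨q, hq f.2⟩ with hq'
  have hgerm : polyGerm P' = q' * f := by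
    refine Subtype.ext ?_
    rw [coe_polyGerm, hmap, hPW]
    rfl
  have hunit : IsUnit q' := isUnit_germ_iff.2 hq0
  have hirr' : Irreducible (polyGerm P') := by
    rw [hgerm]
    exact (irreducible_isUnit_mul hunit).2 hirr
  have hX : (P'.map convergentSeriesInX.subtype).map PowerSeries.constantCoeff =
      Polynomial.X ^ P'.natDegree := by
    ext j
    rw [hmap, Polynomial.coeff_map, hdeg, Polynomial.coeff_X_pow,
      ← PowerSeries.coeff_zero_eq_constantCoeff_apply, ← cf_polyInY, hPW]
    rcases lt_or_ge j n with hj | hj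
    · rw [if_neg hj.ne, cf_mul]
      refine Finset.sum_eq_zero fun p hp => Finset.sum_eq_zero fun r hr => ?_
      have h1 := Finset.HasAntidiagonal.mem_antidiagonal.1 hp
      have h2 := Finset.HasAntidiagonal.mem_antidiagonal.1 hr
      rw [show p.2 = 0 by omega, h0 _ (by omega), mul_zero]
    · obtain ⟨k, rfl⟩ := Nat.exists_eq_add_of_le' hj
      rw [hW]
      simp
  obtain ⟨m, a, b, hab⟩ := exists_X_pow_mem_of_irreducible hmon
    (irreducible_of_polyGerm hmon hX hirr')
  -- By Leibniz, the y-derivative of the Weierstrass polynomial q' f lies in (f, f_y), so the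
  -- relation descends to f.
  have hder : partialDeriv 1 (q' * f) = q' * partialDeriv 1 f + f * partialDeriv 1 q' :=
    Subtype.ext (Derivation.leibniz (MvPowerSeries.pderiv ℂ 1) (q' : 𝓡) (f : 𝓡))
  rw [hgerm, hder] at hab
  exact ⟨m, a * q' + b * partialDeriv 1 q', b * q', by rw [hab]; ring⟩

end Reduced

/-! ### Blowing-up and dehomogenised homogeneous parts. -/

section BlowUp

theorem hasSubst_pair {σ : Type*} {a b : MvPowerSeries σ ℂ} (ha : constantCoeff a = 0)
    (hb : constantCoeff b = 0) : HasSubst (![a, b] : Fin 2 → MvPowerSeries σ ℂ) := by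
  refine hasSubst_of_constantCoeff_zero fun i => ?_
  fin_cases i
  · exact ha
  · exact hb

/-- The blowing-up `f ↦ f(x, x (y - ε))`. -/
def blowUp (ε : ℂ) : 𝓡 →ₐ[ℂ] 𝓡 :=
  substAlgHom (R := ℂ) (hasSubst_pair (a := (X 0 : 𝓡)) (b := X 0 * (X 1 - C ε)) (by simp) (by simp))

theorem blowUpPullback_eq (ε : ℂ) (f : 𝒪) : blowUpPullback ε f = blowUp ε (f : 𝓡) := by
  rw [blowUp, substAlgHom_apply, blowUpPullback]

@[simp] theorem blowUp_X_zero (ε : ℂ) : blowUp ε (X 0) = X 0 := by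
  rw [blowUp, substAlgHom_X]; rfl

@[simp] theorem blowUp_X_one (ε : ℂ) : blowUp ε (X 1) = X 0 * (X 1 - C ε) := by
  rw [blowUp, substAlgHom_X]; rfl

@[simp] theorem blowUp_C (ε a : ℂ) : blowUp ε (C a) = C a := algHom_C _ _

theorem X_zero_pow_dvd_blowUp (ε : ℂ) {f : 𝓡} {n : ℕ} (h : (n : ℕ∞) ≤ order f) :
    X 0 ^ n ∣ blowUp ε f := by
  induction n generalizing f with
  | zero => simp
  | succ n ih =>
    obtain ⟨f₁, f₂, rfl, h₁, h₂⟩ := exists_decomp_of_le_order h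
    rw [map_add, map_mul, map_mul, blowUp_X_zero, blowUp_X_one, pow_succ', mul_assoc]
    exact dvd_add (mul_dvd_mul_left _ (ih h₁))
      (mul_dvd_mul_left _ (Dvd.dvd.mul_left (ih h₂) _))

/-- The polynomial `f^(d)(1, y)`. -/
def dehom (d : ℕ) (f : 𝓡) : Polynomial ℂ :=
  ∑ p ∈ Finset.HasAntidiagonal.antidiagonal d, Polynomial.monomial p.2 (cf f p.1 p.2)

theorem coeff_dehom (d : ℕ) (f : 𝓡) (j : ℕ) :
    (dehom d f).coeff j = if j ≤ d then cf f (d - j) j else 0 := by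
  rw [dehom, Polynomial.finsetSum_coeff]
  split_ifs with h
  · rw [Finset.sum_eq_single (d - j, j)]
    · simp
    · rintro ⟨a, b⟩ hp hne
      rw [Polynomial.coeff_monomial, if_neg]
      rintro rfl
      have := Finset.HasAntidiagonal.mem_antidiagonal.1 hp
      exact hne (Prod.ext (by simp at this ⊢; omega) rfl)
    · intro hp
      exact absurd (Finset.HasAntidiagonal.mem_antidiagonal.2 (by simp; omega)) hp
  · refine Finset.sum_eq_zero fun p hp => ?_
    have := Finset.HasAntidiagonal.mem_antidiagonal.1 hp
    rw [Polynomial.coeff_monomial, if_neg (by omega)]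

/-- The substitution `p ↦ p(y - ε)` from polynomials to power series. -/
def shiftCoe (ε : ℂ) : Polynomial ℂ →+* PowerSeries ℂ :=
  Polynomial.coeToPowerSeries.ringHom.comp
    (Polynomial.compRingHom (Polynomial.X - Polynomial.C ε))

theorem shiftCoe_apply (ε : ℂ) (p : Polynomial ℂ) :
    shiftCoe ε p = ((p.comp (Polynomial.X - Polynomial.C ε) : Polynomial ℂ) : PowerSeries ℂ) := rfl

@[simp] theorem shiftCoe_C (ε a : ℂ) : shiftCoe ε (Polynomial.C a) = PowerSeries.C a := by
  simp [shiftCoe_apply]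

@[simp] theorem shiftCoe_X (ε : ℂ) : shiftCoe ε Polynomial.X = PowerSeries.X - PowerSeries.C ε := by
  simp [shiftCoe_apply]

/-- Turns the multiplicity of a polynomial at -ε, as used in `index`, into an order along the
exceptional divisor. -/
theorem X_pow_dvd_shiftCoe_iff (ε : ℂ) (p : Polynomial ℂ) (n : ℕ) :
    PowerSeries.X ^ n ∣ shiftCoe ε p ↔ (Polynomial.X + Polynomial.C ε) ^ n ∣ p := by
  rw [shiftCoe_apply, PowerSeries.X_pow_dvd_iff]
  simp only [Polynomial.coeff_coe]
  rw [← Polynomial.X_pow_dvd_iff]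
  constructor
  · rintro ⟨q, hq⟩
    refine ⟨q.comp (Polynomial.X + Polynomial.C ε), ?_⟩
    have := congrArg (fun r => r.comp (Polynomial.X + Polynomial.C ε)) hq
    simpa [Polynomial.comp_assoc] using this
  · rintro ⟨q, rfl⟩
    exact ⟨q.comp (Polynomial.X - Polynomial.C ε), by simp⟩

theorem shiftCoe_injective (ε : ℂ) : Function.Injective (shiftCoe ε) := by
  rw [injective_iff_map_eq_zero]
  intro p hp
  rw [shiftCoe_apply, Polynomial.coe_eq_zero_iff] at hp
  have := congrArg (fun r => r.comp (Polynomial.X + Polynomial.C ε)) hp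
  simpa [Polynomial.comp_assoc] using this

/-- The coefficient of `x ^ d` of the blowing-up of `f` is `f^(d)(1, y - ε)`. -/
theorem coeff_blowUp (ε : ℂ) (f : 𝓡) (d : ℕ) :
    PowerSeries.coeff d (iterEquiv (blowUp ε f)) = shiftCoe ε (dehom d f) := by
  induction d generalizing f with
  | zero =>
    obtain ⟨f₁, f₂, hf⟩ := exists_decomp f
    have h1 : dehom 0 f = Polynomial.C (cf f 0 0) := by
      ext j
      rw [coeff_dehom, Polynomial.coeff_C]
      rcases j with _ | j <;> simp
    rw [h1, shiftCoe_C, hf]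
    ext j
    rw [coeff_iterEquiv, map_add, map_add, map_mul, map_mul, blowUp_X_zero, blowUp_X_one, blowUp_C,
      mul_assoc, cf_add, cf_add, cf_X_zero_mul_zero, cf_X_zero_mul_zero, cf_C,
      PowerSeries.coeff_C, ← hf]
    simp
  | succ d ih =>
    obtain ⟨f₁, f₂, hf⟩ := exists_decomp f
    have h1 : dehom (d + 1) f = dehom d f₁ + Polynomial.X * dehom d f₂ := by
      ext j
      rw [Polynomial.coeff_add, coeff_dehom, coeff_dehom]
      rcases j with _ | j
      · rw [Polynomial.mul_coeff_zero, Polynomial.coeff_X_zero, zero_mul, hf]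
        simp [cf_C]
      · rw [Polynomial.coeff_X_mul, coeff_dehom]
        by_cases h : j ≤ d
        · rw [if_pos (by omega), if_pos h]
          rcases Nat.lt_or_ge j d with h' | h'
          · rw [if_pos (by omega), hf, show d + 1 - (j + 1) = (d - (j + 1)) + 1 by omega, cf_add,
              cf_add, cf_X_zero_mul_succ, cf_X_one_mul_succ, cf_C]
            simp [show d - (j + 1) + 1 = d - j by omega]
          · rw [if_neg (by omega), hf, show d + 1 - (j + 1) = 0 by omega,
              show d - j = 0 by omega, cf_add,
              cf_add, cf_X_zero_mul_zero, cf_X_one_mul_succ, cf_C]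
            simp
        · simp [show ¬ j + 1 ≤ d by omega, h]
    rw [h1, map_add, map_mul, shiftCoe_X, ← ih, ← ih]
    ext j
    have h2 : PowerSeries.coeff j ((PowerSeries.X - PowerSeries.C ε) *
        PowerSeries.coeff d (iterEquiv (blowUp ε f₂))) = cf ((X 1 - C ε) * blowUp ε f₂) d j := by
      rw [sub_mul, sub_mul, cf_sub, map_sub, PowerSeries.coeff_C_mul, cf_C_mul, coeff_iterEquiv]
      congr 1
      rcases j with _ | j
      · rw [PowerSeries.coeff_zero_X_mul, cf_X_one_mul_zero]
      · rw [PowerSeries.coeff_succ_X_mul, cf_X_one_mul_succ, coeff_iterEquiv]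
    rw [map_add, h2]
    rw [coeff_iterEquiv, coeff_iterEquiv]
    conv_lhs => rw [hf]
    rw [map_add, map_add, map_mul, map_mul, blowUp_X_zero, blowUp_X_one, blowUp_C, mul_assoc,
      cf_add, cf_add, cf_X_zero_mul_succ, cf_X_zero_mul_succ, cf_C]
    simp

theorem natDegree_dehom_le (d : ℕ) (f : 𝓡) : (dehom d f).natDegree ≤ d := by
  rw [Polynomial.natDegree_le_iff_coeff_eq_zero]
  intro j hj
  rw [coeff_dehom, if_neg hj.not_ge]

/-- The link between tangent cones and strict transforms: what remains on the exceptional divisor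
after removing x^n is the part of degree n. -/
theorem restr_of_blowUp_eq {ε : ℂ} {f k : 𝓡} {n : ℕ} (h : blowUp ε f = X 0 ^ n * k) :
    restr k = shiftCoe ε (dehom n f) := by
  rw [← coeff_blowUp, h]
  ext j
  rw [coeff_restr, coeff_iterEquiv, ← cf_X_zero_pow_mul n k 0 j, zero_add]

end BlowUp

/-! ### Smooth branches y = s(x) and intersection with them. -/

section Curves

@[simp] theorem seriesInX_C (a : ℂ) : seriesInX (PowerSeries.C a) = C a := by
  refine cf_ext fun i j => ?_
  rw [cf_seriesInX, cf_C, PowerSeries.coeff_C]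
  rcases i with _ | i <;> rcases j with _ | j <;> simp

theorem constantCoeff_seriesInX (a : PowerSeries ℂ) :
    constantCoeff (seriesInX a) = PowerSeries.constantCoeff a := by
  rw [constantCoeff_eq_cf, cf_seriesInX, if_pos rfl, PowerSeries.coeff_zero_eq_constantCoeff_apply]

/-- `seriesInX` as a homomorphism of algebras. -/
def seriesInXAlgHom : PowerSeries ℂ →ₐ[ℂ] 𝓡 :=
  { seriesInX with commutes' := seriesInX_C }

/-- The restriction `f(t, s(t))` of a power series to the smooth branch `y = s(x)`. -/
def curve (s : PowerSeries ℂ) (hs : PowerSeries.constantCoeff s = 0) : 𝓡 →ₐ[ℂ] PowerSeries ℂ :=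
  substAlgHom (R := ℂ) (hasSubst_pair (a := (PowerSeries.X : PowerSeries ℂ)) (b := s)
    PowerSeries.constantCoeff_X hs)

section CurveLemmas
variable {s : PowerSeries ℂ} (hs : PowerSeries.constantCoeff s = 0)

@[simp] theorem curve_X_zero : curve s hs (X 0) = PowerSeries.X := by
  rw [curve, substAlgHom_X]; rfl

@[simp] theorem curve_X_one : curve s hs (X 1) = s := by
  rw [curve, substAlgHom_X]; rfl

@[simp] theorem curve_C (a : ℂ) : curve s hs (C a) = PowerSeries.C a := algHom_C _ _

theorem coeff_curve_zero (f : 𝓡) (i : ℕ) :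
    PowerSeries.coeff i (curve 0 (map_zero _) f) = cf f i 0 := by
  induction i generalizing f with
  | zero =>
    obtain ⟨f₁, f₂, hf⟩ := exists_decomp f
    conv_lhs => rw [hf]
    simp
  | succ i ih =>
    obtain ⟨f₁, f₂, hf⟩ := exists_decomp f
    conv_lhs => rw [hf]
    conv_rhs => rw [hf]
    have h1 : curve 0 (map_zero _) (C (cf f 0 0) + X 0 * f₁ + X 1 * f₂) =
        PowerSeries.C (cf f 0 0) + PowerSeries.X * curve 0 (map_zero _) f₁ := by
      rw [map_add, map_add, map_mul, map_mul, curve_X_zero, curve_X_one, curve_C, zero_mul,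
        add_zero]
    rw [h1, map_add, PowerSeries.coeff_succ_X_mul, ih, cf_add, cf_add, cf_X_zero_mul_succ,
      cf_X_one_mul_zero, cf_C]
    simp

/-- `algHom_ext` only controls homomorphisms out of ℂ⟦x, y⟧, so ℂ⟦x⟧ is reached through the
retraction given by restriction to y = 0. -/
theorem curve_seriesInX (a : PowerSeries ℂ) : curve s hs (seriesInX a) = a := by
  have h : (curve s hs).comp (seriesInXAlgHom.comp (curve 0 (map_zero _))) =
      curve 0 (map_zero _) := by
    refine algHom_ext (fun i => ?_) fun i => ?_
    · fin_cases i
      · change curve s hs (seriesInX (curve 0 (map_zero _) (X 0))) = curve 0 (map_zero _) (X 0)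
        rw [curve_X_zero, seriesInX_X, curve_X_zero]
      · change curve s hs (seriesInX (curve 0 (map_zero _) (X 1))) = curve 0 (map_zero _) (X 1)
        rw [curve_X_one, map_zero, map_zero]
    · fin_cases i
      · change constantCoeff (curve s hs (seriesInX (curve 0 (map_zero _) (X 0)))) = 0
        rw [curve_X_zero, seriesInX_X, curve_X_zero]
        exact PowerSeries.constantCoeff_X
      · change constantCoeff (curve s hs (seriesInX (curve 0 (map_zero _) (X 1)))) = 0
        rw [curve_X_one, map_zero, map_zero, map_zero]
  have h1 : curve 0 (map_zero _) (ofCoeff fun i j => if j = 0 then PowerSeries.coeff i a else 0) =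
      a := by
    ext i; simp [coeff_curve_zero]
  have h2 := DFunLike.congr_fun h (ofCoeff fun i j => if j = 0 then PowerSeries.coeff i a else 0)
  change curve s hs (seriesInX (curve 0 (map_zero _) _)) = _ at h2
  rwa [h1] at h2

/-- The coordinate change `y ↦ y + s(x)`. -/
def shear (s : PowerSeries ℂ) (hs : PowerSeries.constantCoeff s = 0) : 𝓡 →ₐ[ℂ] 𝓡 :=
  substAlgHom (R := ℂ) (hasSubst_pair (a := (X 0 : 𝓡)) (b := X 1 + seriesInX s) (by simp)
    (by rw [map_add, constantCoeff_seriesInX, hs]; simp))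

@[simp] theorem shear_X_zero : shear s hs (X 0) = X 0 := by
  rw [shear, substAlgHom_X]; rfl

@[simp] theorem shear_X_one : shear s hs (X 1) = X 1 + seriesInX s := by
  rw [shear, substAlgHom_X]; rfl

theorem shear_seriesInX (a : PowerSeries ℂ) : shear s hs (seriesInX a) = seriesInX a := by
  have h : (shear s hs).comp (seriesInXAlgHom.comp (curve 0 (map_zero _))) =
      seriesInXAlgHom.comp (curve 0 (map_zero _)) := by
    refine algHom_ext (fun i => ?_) fun i => ?_
    · fin_cases i
      · change shear s hs (seriesInX (curve 0 (map_zero _) (X 0))) =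
          seriesInX (curve 0 (map_zero _) (X 0))
        rw [curve_X_zero, seriesInX_X, shear_X_zero]
      · change shear s hs (seriesInX (curve 0 (map_zero _) (X 1))) =
          seriesInX (curve 0 (map_zero _) (X 1))
        rw [curve_X_one, map_zero, map_zero]
    · fin_cases i
      · change constantCoeff (shear s hs (seriesInX (curve 0 (map_zero _) (X 0)))) = 0
        rw [curve_X_zero, seriesInX_X, shear_X_zero]
        simp
      · change constantCoeff (shear s hs (seriesInX (curve 0 (map_zero _) (X 1)))) = 0
        rw [curve_X_one, map_zero, map_zero, map_zero]
  have h2 := DFunLike.congr_fun h (seriesInX a)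
  change shear s hs (seriesInX (curve 0 (map_zero _) _)) = seriesInX (curve 0 (map_zero _) _) at h2
  rwa [curve_seriesInX] at h2

theorem X_one_dvd_iff {f : 𝓡} : X 1 ∣ f ↔ ∀ i, cf f i 0 = 0 := by
  constructor
  · rintro ⟨g, rfl⟩ i
    exact cf_X_one_mul_zero _ _
  · intro h
    refine ⟨ofCoeff fun i j => cf f i (j + 1), cf_ext fun i j => ?_⟩
    rcases j with _ | j
    · rw [cf_X_one_mul_zero, h]
    · rw [cf_X_one_mul_succ, cf_ofCoeff]

/-- The automorphism y ↦ y + s(x) carries the branch y = s(x) to the axis y = 0, where the claim can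
be read off the coefficients. -/
theorem curve_eq_zero_iff {f : 𝓡} : curve s hs f = 0 ↔ X 1 - seriesInX s ∣ f := by
  constructor
  · intro h
    have hs' : PowerSeries.constantCoeff (-s) = 0 := by rw [map_neg, hs, neg_zero]
    have e1 : (curve 0 (map_zero _)).comp (shear s hs) = curve s hs := by
      refine algHom_ext (fun i => ?_) fun i => ?_
      · fin_cases i
        · change curve 0 (map_zero _) (shear s hs (X 0)) = curve s hs (X 0)
          simp
        · change curve 0 (map_zero _) (shear s hs (X 1)) = curve s hs (X 1)
          simp [curve_seriesInX]
      · fin_cases i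
        · change constantCoeff (curve 0 (map_zero _) (shear s hs (X 0))) = 0
          rw [shear_X_zero, curve_X_zero]
          exact PowerSeries.constantCoeff_X
        · change constantCoeff (curve 0 (map_zero _) (shear s hs (X 1))) = 0
          rw [shear_X_one, map_add, curve_X_one, curve_seriesInX, zero_add]
          exact hs
    have e2 : (shear (-s) hs').comp (shear s hs) = AlgHom.id ℂ 𝓡 := by
      refine algHom_ext (fun i => ?_) fun i => ?_
      · fin_cases i
        · change shear (-s) hs' (shear s hs (X 0)) = X 0
          simp
        · change shear (-s) hs' (shear s hs (X 1)) = X 1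
          rw [shear_X_one, map_add, shear_X_one, shear_seriesInX, map_neg]; ring
      · fin_cases i
        · change constantCoeff (shear (-s) hs' (shear s hs (X 0))) = 0
          simp
        · change constantCoeff (shear (-s) hs' (shear s hs (X 1))) = 0
          rw [shear_X_one, map_add, shear_X_one, shear_seriesInX, map_neg, neg_add_cancel_right]
          simp
    have h1 : X 1 ∣ shear s hs f := by
      rw [X_one_dvd_iff]
      intro i
      rw [← coeff_curve_zero, show curve 0 (map_zero _) (shear s hs f) = curve s hs f from
        DFunLike.congr_fun e1 f, h, map_zero]
    have h2 := map_dvd (shear (-s) hs') h1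
    rw [show shear (-s) hs' (shear s hs f) = f from DFunLike.congr_fun e2 f, shear_X_one, map_neg,
      ← sub_eq_add_neg] at h2
    exact h2
  · rintro ⟨g, rfl⟩
    rw [map_mul, map_sub, curve_X_one, curve_seriesInX, sub_self, zero_mul]

theorem prime_X_one_sub {s : PowerSeries ℂ} (hs : PowerSeries.constantCoeff s = 0) : Prime (X 1 - seriesInX s) := by
  refine ⟨fun h => ?_, fun h => ?_, fun a b h => ?_⟩
  · have := congrArg (fun f => cf f 0 1) h
    simp only [cf_sub, cf_seriesInX, cf_zero] at this
    rw [← mul_one (X 1), cf_X_one_mul_succ, ← map_one C, cf_C] at this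
    simp at this
  · have := (curve_eq_zero_iff hs).2 (h.dvd (a := 1))
    rw [map_one] at this
    exact one_ne_zero this
  · simp only [← curve_eq_zero_iff hs, map_mul, mul_eq_zero] at h ⊢
    exact h

/-- The intersection multiplicity with a smooth branch. -/
theorem colen_smooth (g : 𝓡) :
    colen (Ideal.span {X 1 - seriesInX s, g}) = (curve s hs g).order := by
  rw [← colen_span_powerSeries]
  refine colen_eq_of_algHom (curve s hs) (fun a => ?_) fun b => ⟨seriesInX b, ?_⟩
  · rw [mem_span_pair', Ideal.mem_span_singleton]
    constructor
    · rintro ⟨r, t, rfl⟩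
      rw [map_add, map_mul, (curve_eq_zero_iff hs).2 dvd_rfl, map_mul, zero_mul, zero_add]
      exact dvd_mul_right _ _
    · rintro ⟨t, ht⟩
      have : curve s hs (a - g * seriesInX t) = 0 := by
        rw [map_sub, map_mul, curve_seriesInX, ht, sub_self]
      obtain ⟨r, hr⟩ := (curve_eq_zero_iff hs).1 this
      exact ⟨r, seriesInX t, by rw [← hr]; ring⟩
  · rw [curve_seriesInX, sub_self]
    exact zero_mem _

end CurveLemmas

theorem colen_multiset_prod {ι : Type*} (s : Multiset ι) (F : ι → 𝓡) (g : 𝓡)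
    (h0 : ∀ a ∈ s, F a ≠ 0) (h : ∀ a ∈ s, ∀ r, F a ∣ g * r → F a ∣ r) :
    colen (Ideal.span {(s.map F).prod, g}) = (s.map fun a => colen (Ideal.span {F a, g})).sum := by
  have : IsDomain 𝓡 := NoZeroDivisors.to_isDomain 𝓡
  induction s using Multiset.induction_on with
  | empty =>
    rw [Multiset.map_zero, Multiset.prod_zero, Multiset.map_zero, Multiset.sum_zero, colen,
      (Ideal.eq_top_iff_one _).2 (Ideal.subset_span (by simp))]
    exact Module.length_eq_zero
  | cons a s ih =>
    rw [Multiset.map_cons, Multiset.prod_cons, Multiset.map_cons, Multiset.sum_cons,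
      colen_mul (h0 a (Multiset.mem_cons_self a s)) (h a (Multiset.mem_cons_self a s)),
      ih (fun b hb => h0 b (Multiset.mem_cons_of_mem hb))
        (fun b hb => h b (Multiset.mem_cons_of_mem hb)), add_comm]

end Curves

/-! ### The base change x ↦ x^q. -/

section Ramification

variable (q : ℕ) (hq : q ≠ 0)

/-- The substitution `x ↦ x ^ q` as a homomorphism of rings. -/
def expandRingHom {R : Type*} [CommRing R] (q : ℕ) (hq : q ≠ 0) : PowerSeries R →+* PowerSeries R :=
  (PowerSeries.expand q hq).toRingHom

theorem coeff_expandRingHom {R : Type*} [CommRing R] (q : ℕ) (hq : q ≠ 0) (f : PowerSeries R)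
    (n : ℕ) : PowerSeries.coeff n (expandRingHom q hq f) =
      if q ∣ n then PowerSeries.coeff (n / q) f else 0 := PowerSeries.coeff_expand q hq f

theorem expandRingHom_C {R : Type*} [CommRing R] (q : ℕ) (hq : q ≠ 0) (r : R) :
    expandRingHom q hq (PowerSeries.C r) = PowerSeries.C r := PowerSeries.expand_C q hq r

/-- The base change `x ↦ x ^ q`. -/
def ram (q : ℕ) (hq : q ≠ 0) : 𝓡 →ₐ[ℂ] 𝓡 where
  toRingHom := iterEquiv.symm.toRingEquiv.toRingHom.comp
    ((expandRingHom q hq).comp iterEquiv.toRingEquiv.toRingHom)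
  commutes' a := by
    apply iterEquiv.injective
    refine (iterEquiv.apply_symm_apply _).trans ?_
    change expandRingHom q hq (iterEquiv (algebraMap ℂ 𝓡 a)) = _
    rw [AlgEquiv.commutes, PowerSeries.algebraMap_apply]
    exact expandRingHom_C q hq _

theorem cf_ram (f : 𝓡) (i j : ℕ) : cf (ram q hq f) i j = if q ∣ i then cf f (i / q) j else 0 := by
  change cf (iterEquiv.symm (expandRingHom q hq (iterEquiv f))) i j = _
  rw [cf_iterEquiv_symm, coeff_expandRingHom]
  split_ifs
  · rw [coeff_iterEquiv]
  · simp

theorem ram_seriesInX (a : PowerSeries ℂ) :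
    ram q hq (seriesInX a) = seriesInX (PowerSeries.expand q hq a) := by
  refine cf_ext fun i j => ?_
  simp only [cf_ram, cf_seriesInX, PowerSeries.coeff_expand]
  split_ifs <;> rfl

@[simp] theorem ram_X_zero : ram q hq (X 0) = X 0 ^ q := by
  rw [← seriesInX_X, ram_seriesInX, PowerSeries.expand_X, map_pow]

@[simp] theorem ram_X_one : ram q hq (X 1) = X 1 := by
  refine cf_ext fun i j => ?_
  rw [cf_ram]
  rcases j with _ | j
  · rw [← mul_one (X 1), cf_X_one_mul_zero, cf_X_one_mul_zero, ite_self]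
  · rw [← mul_one (X 1), cf_X_one_mul_succ, cf_X_one_mul_succ, ← map_one C, cf_C, cf_C]
    by_cases hi : i = 0
    · simp [hi]
    · by_cases hd : q ∣ i
      · have : i / q ≠ 0 := fun h => hi (Nat.eq_zero_of_dvd_of_div_eq_zero hd h)
        simp [hi, this]
      · simp [hi, hd]

theorem ram_polyInY (P : Polynomial (PowerSeries ℂ)) :
    ram q hq (polyInY P) = polyInY (P.map
      (PowerSeries.expand q hq : PowerSeries ℂ →ₐ[ℂ] PowerSeries ℂ).toRingHom) := by
  refine cf_ext fun i j => ?_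
  rw [cf_ram, cf_polyInY, cf_polyInY, Polynomial.coeff_map]
  exact (PowerSeries.coeff_expand q hq _).symm

/-- `ℂ⟦x, y⟧` is free over `ℂ⟦x ^ q, y⟧` with basis `1, x, …, x ^ (q - 1)`. -/
def ramSum : (Fin q → 𝓡) →ₗ[ℂ] 𝓡 where
  toFun g := ∑ i : Fin q, X 0 ^ (i : ℕ) * ram q hq (g i)
  map_add' g h := by simp only [Pi.add_apply, map_add, mul_add, Finset.sum_add_distrib]
  map_smul' a g := by
    simp only [Pi.smul_apply, map_smul, mul_smul_comm, RingHom.id_apply, Finset.smul_sum]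

theorem cf_ramSum (g : Fin q → 𝓡) (i j : ℕ) (k : Fin q) :
    cf (ramSum q hq g) (q * i + k) j = cf (g k) i j := by
  have hsum : ∀ (s : Finset (Fin q)) (F : Fin q → 𝓡) (a b : ℕ),
      cf (∑ l ∈ s, F l) a b = ∑ l ∈ s, cf (F l) a b := by
    intro s F a b
    simp only [cf, map_sum]
  change cf (∑ l : Fin q, X 0 ^ (l : ℕ) * ram q hq (g l)) _ _ = _
  rw [hsum, Finset.sum_eq_single k]
  · rw [cf_X_zero_pow_mul, cf_ram, if_pos (dvd_mul_right _ _),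
      Nat.mul_div_cancel_left _ (Nat.pos_of_ne_zero hq)]
  · intro l _ hl
    rcases lt_or_ge (q * i + k) (l : ℕ) with h | h
    · exact cf_X_zero_pow_mul_of_lt h _ _
    · obtain ⟨m, hm⟩ := Nat.exists_eq_add_of_le h
      rw [hm, add_comm (l : ℕ), cf_X_zero_pow_mul, cf_ram, if_neg]
      rintro ⟨c, rfl⟩
      apply hl
      apply Fin.ext
      have h1 : (q * i + k) % q = k := by simp [Nat.mod_eq_of_lt k.2]
      have h2 : (l + q * c) % q = l := by simp [Nat.mod_eq_of_lt l.2]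
      rw [← h1, hm, h2]
  · simp

theorem ramSum_injective : Function.Injective (ramSum q hq) := by
  intro g h e
  funext k
  refine cf_ext fun i j => ?_
  rw [← cf_ramSum q hq, e, cf_ramSum]

theorem ramSum_surjective : Function.Surjective (ramSum q hq) := by
  intro f
  refine ⟨fun k => ofCoeff fun i j => cf f (q * i + k) j, cf_ext fun i j => ?_⟩
  have h : i = q * (i / q) + ((⟨i % q, Nat.mod_lt _ (Nat.pos_of_ne_zero hq)⟩ : Fin q) : ℕ) :=
    (Nat.div_add_mod i q).symm
  conv_lhs => rw [h]
  rw [cf_ramSum, cf_ofCoeff, ← h]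

/-- By freeness of rank q over the image of `ram`, membership in the extended ideal is tested
component by component, so the quotient is a sum of q copies of the original one. -/
theorem colen_ram (p r : 𝓡) :
    colen (Ideal.span {ram q hq p, ram q hq r}) = q * colen (Ideal.span {p, r}) := by
  set I : Ideal 𝓡 := Ideal.span {p, r}
  set J : Ideal 𝓡 := Ideal.span {ram q hq p, ram q hq r}
  have hmem : ∀ g, ramSum q hq g ∈ J ↔ ∀ k, g k ∈ I := by
    intro g
    constructor
    · intro h k
      obtain ⟨a, b, hab⟩ := mem_span_pair'.1 h
      obtain ⟨a, rfl⟩ := ramSum_surjective q hq a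
      obtain ⟨b, rfl⟩ := ramSum_surjective q hq b
      have : g = fun k => p * a k + r * b k := by
        apply ramSum_injective q hq
        rw [hab]
        change ram q hq p * (∑ l : Fin q, X 0 ^ (l : ℕ) * ram q hq (a l)) +
          ram q hq r * (∑ l : Fin q, X 0 ^ (l : ℕ) * ram q hq (b l)) =
          ∑ l : Fin q, X 0 ^ (l : ℕ) * ram q hq (p * a l + r * b l)
        rw [Finset.mul_sum, Finset.mul_sum, ← Finset.sum_add_distrib]
        refine Finset.sum_congr rfl fun l _ => ?_
        rw [map_add, map_mul, map_mul]; ring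
      rw [this]
      exact mem_span_pair'.2 ⟨a k, b k, rfl⟩
    · intro h
      change (∑ k : Fin q, X 0 ^ (k : ℕ) * ram q hq (g k)) ∈ J
      refine Ideal.sum_mem J fun k _ => J.mul_mem_left _ ?_
      obtain ⟨a, b, hab⟩ := mem_span_pair'.1 (h k)
      rw [hab, map_add, map_mul, map_mul]
      exact mem_span_pair'.2 ⟨_, _, rfl⟩
  let φ : (Fin q → 𝓡) →ₗ[ℂ] 𝓡 ⧸ J := (Ideal.Quotient.mkₐ ℂ J).toLinearMap ∘ₗ ramSum q hq
  let ψ : (Fin q → 𝓡) →ₗ[ℂ] (Fin q → 𝓡 ⧸ I) :=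
    LinearMap.pi fun k => (Ideal.Quotient.mkₐ ℂ I).toLinearMap ∘ₗ LinearMap.proj k
  have hφ : Function.Surjective φ :=
    (Ideal.Quotient.mk_surjective (I := J)).comp (ramSum_surjective q hq)
  have hψ : Function.Surjective ψ := by
    intro z
    choose g hg using fun k => Ideal.Quotient.mk_surjective (I := I) (z k)
    exact ⟨g, funext hg⟩
  have hker : LinearMap.ker φ = LinearMap.ker ψ := by
    ext g
    rw [LinearMap.mem_ker, LinearMap.mem_ker]
    refine (Ideal.Quotient.eq_zero_iff_mem).trans ((hmem g).trans ?_)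
    rw [funext_iff]
    exact forall_congr' fun k => Ideal.Quotient.eq_zero_iff_mem.symm
  have e : (𝓡 ⧸ J) ≃ₗ[ℂ] (Fin q → 𝓡 ⧸ I) :=
    (φ.quotKerEquivOfSurjective hφ).symm.trans
      ((Submodule.quotEquivOfEq _ _ hker).trans (ψ.quotKerEquivOfSurjective hψ))
  rw [colen, e.length_eq, Module.length_pi, ENat.card_eq_coe_fintype_card, Fintype.card_fin]
  rfl

end Ramification

/-! ### Intersection numbers as sums over branches; Teissier's lemma. -/

section Branches

theorem colen_span_pair_unit_mul {A : Type*} [CommRing A] [Algebra ℂ A] {u a b : A}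
    (hu : IsUnit u) : colen (Ideal.span {u * a, b}) = colen (Ideal.span {a, b}) := by
  congr 1
  rw [Ideal.span_insert, Ideal.span_insert, Ideal.span_singleton_mul_left_unit hu]

theorem colen_span_pair_of_isUnit {A : Type*} [CommRing A] [Algebra ℂ A] {u b : A}
    (hu : IsUnit u) : colen (Ideal.span {u, b}) = 0 := by
  rw [colen, Ideal.eq_top_of_isUnit_mem _ (Ideal.subset_span (by simp)) hu]
  exact Module.length_eq_zero

theorem isUnit_X_one_sub {a : PowerSeries ℂ} (ha : PowerSeries.constantCoeff a ≠ 0) :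
    IsUnit (X 1 - seriesInX a) := by
  rw [isUnit_iff_cf, cf_sub, cf_seriesInX, if_pos rfl, ← mul_one (X 1), cf_X_one_mul_zero,
    PowerSeries.coeff_zero_eq_constantCoeff_apply]
  simpa using ha

/-- Ramification multiplies colengths by q, and afterwards additivity applies to the linear factors.
Roots with nonzero constant term are allowed: their factors are units and contribute 0. They occur
after blowing up, as branches through other points of the divisor. -/
theorem colen_eq_sum_branches {q : ℕ} {hq : q ≠ 0} {s : Multiset (PowerSeries ℂ)} {u g h : 𝓡}
    (hu : IsUnit u) (hg : ram q hq (u * g) = (s.map fun a => X 1 - seriesInX a).prod)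
    (hfin : ∀ a ∈ s, colen (Ideal.span {X 1 - seriesInX a, ram q hq h}) ≠ ⊤) :
    q * colen (Ideal.span {g, h}) =
      (s.map fun a => colen (Ideal.span {X 1 - seriesInX a, ram q hq h})).sum := by
  rw [← colen_span_pair_unit_mul hu, ← colen_ram q hq, hg]
  refine colen_multiset_prod s _ _ (fun a _ e => ?_) fun a ha r hr => ?_
  · have := congrArg (fun f => cf f 0 1) e
    simp only [cf_sub, cf_seriesInX, cf_zero] at this
    rw [← mul_one (X 1), cf_X_one_mul_succ, ← map_one C, cf_C] at this
    simp at this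
  · by_cases h0 : PowerSeries.constantCoeff a = 0
    · refine ((prime_X_one_sub h0).dvd_or_dvd hr).resolve_left fun hd => hfin a ha ?_
      rw [colen_smooth h0, (curve_eq_zero_iff h0).2 hd, PowerSeries.order_zero]
    · exact (isUnit_X_one_sub h0).dvd

theorem polyInY_X_sub_C (a : PowerSeries ℂ) :
    polyInY (Polynomial.X - Polynomial.C a) = X 1 - seriesInX a := by
  simp [polyInY]

theorem constantCoeff_expand (q : ℕ) (hq : q ≠ 0) (a : PowerSeries ℂ) :
    PowerSeries.constantCoeff (PowerSeries.expand q hq a) = PowerSeries.constantCoeff a := by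
  rw [← PowerSeries.coeff_zero_eq_constantCoeff_apply, PowerSeries.coeff_expand]
  simp

/-- Weierstrass preparation followed by Puiseux splitting; modulo x the polynomial is y^n, so all
its roots have zero constant term. -/
theorem exists_branches {g : 𝓡} {n : ℕ} (h0 : ∀ j < n, cf g 0 j = 0) (hn : cf g 0 n ≠ 0) :
    ∃ (q : ℕ) (hq : q ≠ 0) (s : Multiset (PowerSeries ℂ)) (u : 𝓡), IsUnit u ∧
      (∀ a ∈ s, PowerSeries.constantCoeff a = 0) ∧
      ram q hq (u * g) = (s.map fun a => X 1 - seriesInX a).prod := by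
  obtain ⟨u, hu, -, hW⟩ := exists_weierstrass h0 hn
  obtain ⟨P, hP, hdeg, hPW⟩ := exists_polyInY hW
  obtain ⟨q, hq, s, hs⟩ := exists_puiseux_splitting hP
  refine ⟨q, hq, s, u, isUnit_iff_cf.2 hu, fun a ha => ?_, ?_⟩
  · have h1 : P.map PowerSeries.constantCoeff = Polynomial.X ^ n := by
      ext j
      rw [Polynomial.coeff_map, Polynomial.coeff_X_pow,
        ← PowerSeries.coeff_zero_eq_constantCoeff_apply, ← cf_polyInY, hPW]
      rcases lt_or_ge j n with h | h
      · rw [if_neg h.ne, ← coeff_restr, map_mul]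
        have : PowerSeries.X ^ n ∣ restr u * restr g := by
          refine Dvd.dvd.mul_left (PowerSeries.X_pow_dvd_iff.2 fun m hm => ?_) _
          rw [coeff_restr, h0 m hm]
        exact PowerSeries.X_pow_dvd_iff.1 this j h
      · obtain ⟨m, rfl⟩ := Nat.exists_eq_add_of_le' h
        rw [hW]
        simp
    have h2 := congrArg (Polynomial.map PowerSeries.constantCoeff) hs
    rw [Polynomial.map_map, show PowerSeries.constantCoeff.comp
      (PowerSeries.expand q hq : PowerSeries ℂ →ₐ[ℂ] PowerSeries ℂ).toRingHom =
      PowerSeries.constantCoeff from RingHom.ext (constantCoeff_expand q hq), h1] at h2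
    have h3 : (Polynomial.X - Polynomial.C (PowerSeries.constantCoeff a)) ∣
        (Polynomial.X : Polynomial ℂ) ^ n := by
      rw [h2, show Polynomial.X - Polynomial.C (PowerSeries.constantCoeff a) =
        (Polynomial.X - Polynomial.C a).map PowerSeries.constantCoeff by simp]
      exact Polynomial.map_dvd _ (Multiset.dvd_prod (Multiset.mem_map_of_mem _ ha))
    have h4 := Polynomial.dvd_iff_isRoot.1 h3
    rw [Polynomial.IsRoot, Polynomial.eval_pow, Polynomial.eval_X] at h4
    exact eq_zero_of_pow_eq_zero h4
  · rw [← hPW, ram_polyInY, hs, map_multiset_prod, Multiset.map_map]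
    simp only [Function.comp_def, polyInY_X_sub_C]

theorem derivative_algHom (φ : 𝓡 →ₐ[ℂ] PowerSeries ℂ)
    (h0 : ∀ i, constantCoeff (φ (X i)) = 0) (f : 𝓡) :
    PowerSeries.derivative ℂ (φ f) =
      φ (MvPowerSeries.pderiv ℂ 0 f) * PowerSeries.derivative ℂ (φ (X 0)) +
      φ (MvPowerSeries.pderiv ℂ 1 f) * PowerSeries.derivative ℂ (φ (X 1)) := by
  rw [← sub_eq_zero]
  refine derivation_eq_zero φ h0 (fun f => PowerSeries.derivative ℂ (φ f) -
      (φ (MvPowerSeries.pderiv ℂ 0 f) * PowerSeries.derivative ℂ (φ (X 0)) +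
      φ (MvPowerSeries.pderiv ℂ 1 f) * PowerSeries.derivative ℂ (φ (X 1)))) ?_ ?_ ?_ f
  · intro f g
    simp only [map_add]; ring
  · intro a
    have h1 : PowerSeries.derivative ℂ (φ (C a)) = 0 := by
      rw [algHom_C]; exact PowerSeries.derivative_C
    simp [h1]
  · intro i g
    have h1 : φ (MvPowerSeries.pderiv ℂ 0 (X i)) * PowerSeries.derivative ℂ (φ (X 0)) +
        φ (MvPowerSeries.pderiv ℂ 1 (X i)) * PowerSeries.derivative ℂ (φ (X 1)) =
        PowerSeries.derivative ℂ (φ (X i)) := by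
      fin_cases i
      · simp [pderiv_X_self, pderiv_X_of_ne]
      · simp [pderiv_X_self, pderiv_X_of_ne]
    simp only [map_mul, Derivation.leibniz, smul_eq_mul, map_add]
    linear_combination -φ g * h1

theorem order_eq_of_coeff_eq_zero_iff {a b : PowerSeries ℂ}
    (h : ∀ n, PowerSeries.coeff n a = 0 ↔ PowerSeries.coeff n b = 0) : a.order = b.order := by
  apply le_antisymm
  · exact PowerSeries.le_order _ _ fun i hi => (h i).1 (PowerSeries.coeff_of_lt_order i hi)
  · exact PowerSeries.le_order _ _ fun i hi => (h i).2 (PowerSeries.coeff_of_lt_order i hi)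

/-- Teissier's lemma: the intersection multiplicity of the polar `f_y` with `x f_x + s f` does not
depend on `s`. -/
theorem exists_colen_polar_eq {f : 𝓡} {n N : ℕ} (h0 : ∀ j ≤ n, cf f 0 j = 0)
    (hn : cf f 0 (n + 1) ≠ 0)
    (hN : X 0 ^ N ∈ Ideal.span {f, X 0 * MvPowerSeries.pderiv ℂ 0 f, MvPowerSeries.pderiv ℂ 1 f}) :
    ∃ c : ℕ, ∀ s : ℕ, colen (Ideal.span {MvPowerSeries.pderiv ℂ 1 f,
      X 0 * MvPowerSeries.pderiv ℂ 0 f + C (s : ℂ) * f}) = c := by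
  obtain ⟨q, hq, S, u, hu, hS, hprod⟩ := exists_branches (g := MvPowerSeries.pderiv ℂ 1 f) (n := n)
    (fun j hj => by rw [cf_pderiv_one, h0 _ hj, zero_mul])
    (by rw [cf_pderiv_one]; exact mul_ne_zero hn (Nat.cast_add_one_ne_zero n))
  have key : ∀ a ∈ S, ∃ c : ℕ, ∀ s : ℕ, colen (Ideal.span {X 1 - seriesInX a, ram q hq
      (X 0 * MvPowerSeries.pderiv ℂ 0 f + C (s : ℂ) * f)}) = c := by
    intro a ha
    have ha0 := hS a ha
    let φ : 𝓡 →ₐ[ℂ] PowerSeries ℂ := (curve a ha0).comp (ram q hq)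
    have hφ0 : φ (X 0) = PowerSeries.X ^ q := by
      change curve a ha0 (ram q hq (X 0)) = _
      rw [ram_X_zero, map_pow, curve_X_zero]
    have hφ1 : φ (X 1) = a := by
      change curve a ha0 (ram q hq (X 1)) = _
      rw [ram_X_one, curve_X_one]
    have hy : φ (MvPowerSeries.pderiv ℂ 1 f) = 0 := by
      have h1 : φ (u * MvPowerSeries.pderiv ℂ 1 f) = 0 := by
        change curve a ha0 (ram q hq _) = _
        rw [hprod, curve_eq_zero_iff]
        exact Multiset.dvd_prod (Multiset.mem_map_of_mem _ ha)
      rw [map_mul] at h1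
      exact (mul_eq_zero.1 h1).resolve_left (hu.map φ).ne_zero
    have hc0 : ∀ i, constantCoeff (φ (X i)) = 0 := by
      intro i
      fin_cases i
      · change constantCoeff (φ (X 0)) = 0
        rw [hφ0]
        refine (map_pow _ _ _).trans ?_
        rw [show constantCoeff (PowerSeries.X : PowerSeries ℂ) = 0 from
          PowerSeries.constantCoeff_X, zero_pow hq]
      · change constantCoeff (φ (X 1)) = 0
        rw [hφ1]; exact ha0
    have hder := derivative_algHom φ hc0 f
    rw [hy, zero_mul, add_zero, hφ0] at hder
    -- Along the branch (t^q, a(t)) of f_y = 0 the chain rule loses its f_y term, so t d/dt of f is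
    -- q times x f_x.
    have hXd : PowerSeries.X * PowerSeries.derivative ℂ (φ f) =
        (q : PowerSeries ℂ) * φ (X 0 * MvPowerSeries.pderiv ℂ 0 f) := by
      rw [hder, map_mul, hφ0, PowerSeries.derivative_pow, PowerSeries.derivative_X]
      obtain ⟨r, rfl⟩ := Nat.exists_eq_succ_of_ne_zero hq
      rw [Nat.succ_sub_one, pow_succ]; ring
    have hcoef : ∀ m, PowerSeries.coeff m (PowerSeries.X * PowerSeries.derivative ℂ (φ f)) =
        m * PowerSeries.coeff m (φ f) := by
      intro m
      rcases m with _ | m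
      · simp
      · rw [PowerSeries.coeff_succ_X_mul, PowerSeries.coeff_derivative]
        push_cast; ring
    -- If f vanished on the branch, so would x f_x, and then every element of the ideal in `hN`; but
    -- x^N restricts to t^(qN) ≠ 0.
    have hne : φ f ≠ 0 := by
      intro h
      have h2 : φ (X 0 * MvPowerSeries.pderiv ℂ 0 f) = 0 := by
        rw [h, map_zero, mul_zero] at hXd
        refine (mul_eq_zero.1 hXd.symm).resolve_left ?_
        rw [← map_natCast PowerSeries.C q]
        exact fun e => hq (Nat.cast_injective (PowerSeries.C_injective (e.trans (by simp))))
      obtain ⟨r₁, r₂, r₃, hr⟩ := mem_span_triple'.1 hN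
      have h3 := congrArg φ hr
      rw [map_add, map_add, map_mul _ f, map_mul _ (_ * _) r₂, map_mul _ _ r₃, h, h2, hy, map_pow, hφ0] at h3
      simp at h3
    have hf0 : PowerSeries.coeff 0 (φ f) = 0 := by
      have h1 : cf (ram q hq f) 0 0 = 0 := by
        rw [cf_ram]; simp [h0 0 (Nat.zero_le _)]
      obtain ⟨f₁, f₂, hf⟩ := exists_decomp (ram q hq f)
      rw [h1, map_zero, zero_add] at hf
      change PowerSeries.coeff 0 (curve a ha0 (ram q hq f)) = 0
      rw [hf]
      simp [ha0]
    obtain ⟨c, hc⟩ := ENat.ne_top_iff_exists.1 (mt PowerSeries.order_eq_top.1 hne)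
    refine ⟨c, fun s => ?_⟩
    rw [colen_smooth ha0, hc]
    refine order_eq_of_coeff_eq_zero_iff fun m => ?_
    change PowerSeries.coeff m (φ _) = 0 ↔ _
    -- Adding s f multiplies the m-th coefficient of f along the branch by m + q s, which is nonzero
    -- for m > 0, while the coefficient for m = 0 vanishes. So the order is that of f whatever s ≥ 0
    -- is.
    have h4 : (q : ℂ) * PowerSeries.coeff m (φ (X 0 * MvPowerSeries.pderiv ℂ 0 f + C (s : ℂ) * f)) =
        (m + q * s : ℕ) * PowerSeries.coeff m (φ f) := by
      have h5 := hcoef m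
      rw [hXd, ← map_natCast PowerSeries.C q, PowerSeries.coeff_C_mul] at h5
      rw [map_add, map_add, mul_add, h5, map_mul, algHom_C,
        show (C (s : ℂ) : MvPowerSeries Unit ℂ) = PowerSeries.C (s : ℂ) from rfl,
        PowerSeries.coeff_C_mul]
      push_cast; ring
    have hq' : (q : ℂ) ≠ 0 := Nat.cast_ne_zero.2 hq
    rw [← mul_eq_zero_iff_left hq', h4]
    rcases Nat.eq_zero_or_pos m with rfl | hm
    · simp [hf0]
    · rw [mul_eq_zero, or_iff_right]
      exact Nat.cast_ne_zero.2 (by omega)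
  choose! c hc using key
  have hsum : ∀ s : ℕ, q * colen (Ideal.span {MvPowerSeries.pderiv ℂ 1 f,
      X 0 * MvPowerSeries.pderiv ℂ 0 f + C (s : ℂ) * f}) = ((S.map c).sum : ℕ) := by
    intro s
    rw [colen_eq_sum_branches hu hprod fun a ha => by rw [hc a ha]; exact ENat.natCast_ne_top _]
    rw [Multiset.map_congr rfl fun a ha => hc a ha s]
    exact ((map_multiset_sum (Nat.castRingHom ℕ∞) (S.map c)).trans
      (by rw [Multiset.map_map]; rfl)).symm
  have hq' : (q : ℕ∞) ≠ 0 := by exact_mod_cast hq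
  have hfin : colen (Ideal.span {MvPowerSeries.pderiv ℂ 1 f,
      X 0 * MvPowerSeries.pderiv ℂ 0 f + C ((0 : ℕ) : ℂ) * f}) ≠ ⊤ := by
    intro e
    have := hsum 0
    rw [e, ENat.mul_top hq'] at this
    exact ENat.natCast_ne_top _ this.symm
  obtain ⟨d, hd⟩ := ENat.ne_top_iff_exists.1 hfin
  refine ⟨d, fun s => ?_⟩
  rw [hd]
  exact (ENat.mul_right_strictMono hq' (ENat.natCast_ne_top q)).injective
    ((hsum s).trans (hsum 0).symm)

end Branches

/-! ### Noether's formula for blowing-up. -/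

section Noether

theorem prod_X_sub_C_scaleRoots (s : Multiset (PowerSeries ℂ)) (r : PowerSeries ℂ) :
    (s.map fun a => Polynomial.X - Polynomial.C a).prod.scaleRoots r =
      (s.map fun a => Polynomial.X - Polynomial.C (r * a)).prod := by
  induction s using Multiset.induction_on with
  | empty => simp
  | cons a s ih =>
    rw [Multiset.map_cons, Multiset.prod_cons, Polynomial.mul_scaleRoots_of_noZeroDivisors, ih,
      Polynomial.X_sub_C_scaleRoots, Multiset.map_cons, Multiset.prod_cons, mul_comm a]

theorem exists_scaleRoots_eq {P : Polynomial (PowerSeries ℂ)} (hP : P.Monic)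
    (h : ∀ j < P.natDegree, PowerSeries.X ^ (P.natDegree - j) ∣ P.coeff j) :
    ∃ Q : Polynomial (PowerSeries ℂ), Q.Monic ∧ Q.natDegree = P.natDegree ∧
      Q.scaleRoots PowerSeries.X = P := by
  set n := P.natDegree with hn
  have h' : ∀ j : Fin n, ∃ c, P.coeff j = PowerSeries.X ^ (n - j) * c := fun j => h j j.2
  choose c hc using h'
  have hd : (∑ j : Fin n, Polynomial.C (c j) * Polynomial.X ^ (j : ℕ)).degree < (n : WithBot ℕ) :=
    Polynomial.degree_sum_fin_lt c
  set Q := Polynomial.X ^ n + ∑ j : Fin n, Polynomial.C (c j) * Polynomial.X ^ (j : ℕ) with hQ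
  have hQm : Q.Monic := Polynomial.monic_X_pow_add hd
  have hQn : Q.natDegree = n := by
    rw [hQ, Polynomial.natDegree_eq_of_degree_eq
      (Polynomial.degree_add_eq_left_of_degree_lt (by rwa [Polynomial.degree_X_pow])),
      Polynomial.natDegree_X_pow]
  refine ⟨Q, hQm, hQn, ?_⟩
  ext1 j
  rw [Polynomial.coeff_scaleRoots, hQn]
  rcases lt_trichotomy j n with hj | rfl | hj
  · have h1 : Q.coeff j = c ⟨j, hj⟩ := by
      rw [hQ, Polynomial.coeff_add, Polynomial.coeff_X_pow, if_neg hj.ne, zero_add,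
        Polynomial.finsetSum_coeff, Finset.sum_eq_single ⟨j, hj⟩]
      · simp
      · intro b _ hb
        rw [Polynomial.coeff_C_mul_X_pow, if_neg fun e => hb (Fin.ext e.symm)]
      · simp
    rw [h1, hc ⟨j, hj⟩, mul_comm]
  · rw [Nat.sub_self, pow_zero, mul_one, ← hQn, hQm.coeff_natDegree, hQn, hP.coeff_natDegree]
  · rw [Polynomial.coeff_eq_zero_of_natDegree_lt (hQn.trans_lt hj), zero_mul,
      Polynomial.coeff_eq_zero_of_natDegree_lt hj]

/-- When the order in y does not exceed the total order n, the coefficient of y^j in the Weierstrass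
polynomial is divisible by x^(n-j). All roots are then multiples of x, and splitting is applied to
the rescaled polynomial, whose constant terms are the tangent directions. -/
theorem exists_branches_of_le_order {g : 𝓡} {n : ℕ} (h0 : (n : ℕ∞) ≤ order g)
    (hn : cf g 0 n ≠ 0) :
    ∃ (q : ℕ) (hq : q ≠ 0) (s : Multiset (PowerSeries ℂ)) (u : 𝓡), IsUnit u ∧ s.card = n ∧
      ram q hq (u * g) = (s.map fun a => X 1 - X 0 ^ q * seriesInX a).prod := by
  obtain ⟨u, hu, -, hW⟩ := exists_weierstrass (fun j hj => le_order_iff.1 h0 0 j (by omega)) hn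
  obtain ⟨P, hP, hdeg, hPW⟩ := exists_polyInY hW
  have hord : (n : ℕ∞) ≤ order (u * g) := h0.trans (le_add_self.trans le_order_mul)
  obtain ⟨Q, hQ, hQn, hQP⟩ := exists_scaleRoots_eq hP fun j hj => by
    refine PowerSeries.X_pow_dvd_iff.2 fun m hm => ?_
    rw [← cf_polyInY, hPW]
    exact le_order_iff.1 hord m j (by omega)
  obtain ⟨q, hq, s, hs⟩ := exists_puiseux_splitting hQ
  refine ⟨q, hq, s, u, isUnit_iff_cf.2 hu, ?_, ?_⟩
  · rw [← hdeg, ← hQn, ← hQ.natDegree_map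
      (PowerSeries.expand q hq : PowerSeries ℂ →ₐ[ℂ] PowerSeries ℂ).toRingHom, hs,
      Polynomial.natDegree_multiset_prod_X_sub_C_eq_card]
  · rw [← hPW, ram_polyInY, ← hQP, Polynomial.map_scaleRoots _ _ _ (by simp [hQ.leadingCoeff]), hs,
      prod_X_sub_C_scaleRoots, map_multiset_prod, Multiset.map_map]
    simp only [Function.comp_def, polyInY_X_sub_C]
    have : (PowerSeries.expand q hq : PowerSeries ℂ →ₐ[ℂ] PowerSeries ℂ).toRingHom PowerSeries.X =
        PowerSeries.X ^ q := PowerSeries.expand_X q hq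
    simp only [this, map_mul, map_pow, seriesInX_X]

/-- An endomorphism of `ℂ⟦x, y⟧` which fixes `x` fixes `ℂ⟦x⟧`. -/
theorem algHom_seriesInX {φ : 𝓡 →ₐ[ℂ] 𝓡} (hφ : φ (X 0) = X 0) (a : PowerSeries ℂ) :
    φ (seriesInX a) = seriesInX a := by
  have h : φ.comp (seriesInXAlgHom.comp (curve 0 (map_zero _))) =
      seriesInXAlgHom.comp (curve 0 (map_zero _)) := by
    refine algHom_ext (fun i => ?_) fun i => ?_
    · fin_cases i
      · change φ (seriesInX (curve 0 (map_zero _) (X 0))) = seriesInX (curve 0 (map_zero _) (X 0))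
        rw [curve_X_zero, seriesInX_X, hφ]
      · change φ (seriesInX (curve 0 (map_zero _) (X 1))) = seriesInX (curve 0 (map_zero _) (X 1))
        rw [curve_X_one, map_zero, map_zero]
    · fin_cases i
      · change constantCoeff (φ (seriesInX (curve 0 (map_zero _) (X 0)))) = 0
        rw [curve_X_zero, seriesInX_X, hφ]
        simp
      · change constantCoeff (φ (seriesInX (curve 0 (map_zero _) (X 1)))) = 0
        rw [curve_X_one, map_zero, map_zero, map_zero]
  have h2 := DFunLike.congr_fun h (seriesInX a)
  change φ (seriesInX (curve 0 (map_zero _) _)) = seriesInX (curve 0 (map_zero _) _) at h2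
  rwa [curve_seriesInX] at h2

/-- The map B is the blowing-up seen after x ↦ x^q; it sends each factor y - x^q a to x^q (y - (a +
ε)), and the n powers of x^q cancel against the pull-back of x^n. -/
theorem ram_prod_of_blowUp {ε : ℂ} {g k u : 𝓡} {n q : ℕ} {hq : q ≠ 0}
    {s : Multiset (PowerSeries ℂ)} (hcard : s.card = n)
    (hg : ram q hq (u * g) = (s.map fun a => X 1 - X 0 ^ q * seriesInX a).prod)
    (hk : blowUp ε g = X 0 ^ n * k) :
    ram q hq (blowUp ε u * k) =
      ((s.map fun a => a + PowerSeries.C ε).map fun a => X 1 - seriesInX a).prod := by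
  let B : 𝓡 →ₐ[ℂ] 𝓡 := substAlgHom (R := ℂ) (hasSubst_pair (a := (X 0 : 𝓡))
    (b := X 0 ^ q * (X 1 - C ε)) (by simp) (by simp [hq]))
  have hB0 : B (X 0) = X 0 := by
    change substAlgHom _ _ = _
    rw [substAlgHom_X]; rfl
  have hB1 : B (X 1) = X 0 ^ q * (X 1 - C ε) := by
    change substAlgHom _ _ = _
    rw [substAlgHom_X]; rfl
  have hcomm : B.comp (ram q hq) = (ram q hq).comp (blowUp ε) := by
    refine algHom_ext (fun i => ?_) fun i => ?_
    · fin_cases i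
      · change B (ram q hq (X 0)) = ram q hq (blowUp ε (X 0))
        rw [ram_X_zero, blowUp_X_zero, ram_X_zero, map_pow, hB0]
      · change B (ram q hq (X 1)) = ram q hq (blowUp ε (X 1))
        rw [ram_X_one, blowUp_X_one, hB1, map_mul, map_sub, ram_X_zero, ram_X_one, algHom_C]
    · fin_cases i
      · change constantCoeff (B (ram q hq (X 0))) = 0
        rw [ram_X_zero, map_pow, hB0]
        simp [hq]
      · change constantCoeff (B (ram q hq (X 1))) = 0
        rw [ram_X_one, hB1]
        simp [hq]
  have h1 := congrArg B hg
  rw [show B (ram q hq (u * g)) = ram q hq (blowUp ε (u * g)) from DFunLike.congr_fun hcomm _,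
    map_multiset_prod, Multiset.map_map, map_mul, hk] at h1
  have h2 : ∀ a, B (X 1 - X 0 ^ q * seriesInX a) =
      X 0 ^ q * (X 1 - seriesInX (a + PowerSeries.C ε)) := by
    intro a
    rw [map_sub, map_mul, map_pow, hB0, hB1, algHom_seriesInX hB0, map_add, seriesInX_C]
    ring
  simp only [Function.comp_def, h2] at h1
  rw [Multiset.prod_map_mul, Multiset.map_const', Multiset.prod_replicate, hcard, ← pow_mul] at h1
  rw [Multiset.map_map]
  refine mul_left_cancel₀ (pow_ne_zero (q * n) prime_X_zero.ne_zero) (Eq.trans ?_ h1)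
  rw [map_mul, map_mul, map_mul, map_pow, ram_X_zero, ← pow_mul]
  ring

/-- The order of `f` along the branch `x = t ^ q`, `y = t ^ q a(t)`. -/
theorem curve_ram_eq {f k : 𝓡} {n q : ℕ} (hq : q ≠ 0) {a : PowerSeries ℂ} {c : ℂ}
    (hk : blowUp (-c) f = X 0 ^ n * k)
    (h1 : PowerSeries.constantCoeff (PowerSeries.X ^ q * a) = 0)
    (h2 : PowerSeries.constantCoeff (a - PowerSeries.C c) = 0) :
    curve (PowerSeries.X ^ q * a) h1 (ram q hq f) =
      PowerSeries.X ^ (q * n) * curve (a - PowerSeries.C c) h2 (ram q hq k) := by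
  have hcomm : (curve (PowerSeries.X ^ q * a) h1).comp (ram q hq) =
      (curve (a - PowerSeries.C c) h2).comp ((ram q hq).comp (blowUp (-c))) := by
    refine algHom_ext (fun i => ?_) fun i => ?_
    · fin_cases i
      · change curve _ h1 (ram q hq (X 0)) = curve _ h2 (ram q hq (blowUp (-c) (X 0)))
        rw [blowUp_X_zero, ram_X_zero, map_pow, map_pow, curve_X_zero, curve_X_zero]
      · change curve _ h1 (ram q hq (X 1)) = curve _ h2 (ram q hq (blowUp (-c) (X 1)))
        rw [blowUp_X_one, map_mul, map_sub, algHom_C, ram_X_zero, ram_X_one, map_mul, map_sub,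
          map_pow, curve_X_zero, curve_X_one, curve_X_one, curve_C, map_neg]
        ring
    · fin_cases i
      · change constantCoeff (curve _ h1 (ram q hq (X 0))) = 0
        rw [ram_X_zero, map_pow, curve_X_zero, map_pow]
        rw [show constantCoeff (PowerSeries.X : PowerSeries ℂ) = 0 from
          PowerSeries.constantCoeff_X, zero_pow hq]
      · change constantCoeff (curve _ h1 (ram q hq (X 1))) = 0
        rw [ram_X_one, curve_X_one]
        exact h1
  have := DFunLike.congr_fun hcomm f
  refine this.trans ?_
  change curve _ h2 (ram q hq (blowUp (-c) f)) = _
  rw [hk, map_mul, map_mul, map_pow, ram_X_zero, map_pow, map_pow, curve_X_zero, ← pow_mul]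

theorem constantCoeff_curve_ram {s : PowerSeries ℂ} (hs : PowerSeries.constantCoeff s = 0) {q : ℕ}
    (hq : q ≠ 0) (f : 𝓡) :
    PowerSeries.constantCoeff (curve s hs (ram q hq f)) = cf f 0 0 := by
  obtain ⟨f₁, f₂, hf⟩ := exists_decomp f
  conv_lhs => rw [hf]
  simp [hs, hq, algHom_C (ram q hq)]

theorem constantCoeff_shiftCoe (ε : ℂ) (p : Polynomial ℂ) :
    PowerSeries.constantCoeff (shiftCoe ε p) = p.eval (-ε) := by
  rw [shiftCoe_apply, ← PowerSeries.coeff_zero_eq_constantCoeff_apply, Polynomial.coeff_coe,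
    Polynomial.coeff_zero_eq_eval_zero, Polynomial.eval_comp]
  simp

/-- Noether's formula: the behaviour of the intersection multiplicity under blowing-up, when the
tangent cones have at most one line in common. -/
theorem colen_eq_mul_add_colen_blowUp {ε : ℂ} {h₁ h₂ k₁ k₂ : 𝓡} {n₁ n₂ N : ℕ}
    (ho₁ : (n₁ : ℕ∞) ≤ order h₁) (ho₂ : (n₂ : ℕ∞) ≤ order h₂)
    (hk₁ : blowUp ε h₁ = X 0 ^ n₁ * k₁) (hk₂ : blowUp ε h₂ = X 0 ^ n₂ * k₂)
    (hn : cf h₁ 0 n₁ ≠ 0) (hN : X 0 ^ N ∈ Ideal.span {h₁, h₂})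
    (hc : ∀ c, c ≠ -ε → (dehom n₁ h₁).eval c = 0 → (dehom n₂ h₂).eval c ≠ 0) :
    colen (Ideal.span {h₁, h₂}) = n₁ * n₂ + colen (Ideal.span {k₁, k₂}) := by
  obtain ⟨q, hq, s, u, hu, hcard, hprod⟩ := exists_branches_of_le_order ho₁ hn
  have hprod' := ram_prod_of_blowUp hcard hprod hk₁
  have hq' : (q : ℕ∞) ≠ 0 := by exact_mod_cast hq
  have hXa : ∀ a : PowerSeries ℂ, PowerSeries.constantCoeff (PowerSeries.X ^ q * a) = 0 := by
    intro a; simp [hq]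
  have hprod2 : ram q hq (u * h₁) =
      ((s.map fun a => PowerSeries.X ^ q * a).map fun a => X 1 - seriesInX a).prod := by
    rw [hprod, Multiset.map_map]
    simp only [Function.comp_def, map_mul, map_pow, seriesInX_X]
  have hfin : ∀ a ∈ s, curve _ (hXa a) (ram q hq h₂) ≠ 0 := by
    intro a ha h
    have h1 : curve _ (hXa a) (ram q hq (u * h₁)) = 0 := by
      rw [hprod2, curve_eq_zero_iff]
      exact Multiset.dvd_prod (Multiset.mem_map_of_mem _ (Multiset.mem_map_of_mem _ ha))
    rw [map_mul, map_mul] at h1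
    have h2 := (mul_eq_zero.1 h1).resolve_left ((hu.map (ram q hq)).map (curve _ (hXa a))).ne_zero
    obtain ⟨r, t, hr⟩ := mem_span_pair'.1 hN
    have h3 := congrArg (fun f => curve _ (hXa a) (ram q hq f)) hr
    simp only [map_add, map_mul, h, h2, map_pow, ram_X_zero, curve_X_zero] at h3
    simp at h3
  -- A branch of h₁ with tangent direction c meets h₂ with multiplicity q n₂ plus a contribution
  -- after blow-up. If c = -ε, the latter is the one at the chosen point. If c ≠ -ε, it is zero
  -- since the cone of h₂ does not contain that direction by `hc`, and the factor at the chosen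
  -- point is a unit, so both sides still agree.
  have key : ∀ a ∈ s, colen (Ideal.span {X 1 - seriesInX (PowerSeries.X ^ q * a), ram q hq h₂}) =
      q * n₂ + colen (Ideal.span {X 1 - seriesInX (a + PowerSeries.C ε), ram q hq k₂}) := by
    intro a ha
    set c := PowerSeries.constantCoeff a with hca
    have hac : PowerSeries.constantCoeff (a - PowerSeries.C c) = 0 := by simp [hca]
    obtain ⟨k₂', hk₂'⟩ := X_zero_pow_dvd_blowUp (-c) ho₂
    rw [colen_smooth (hXa a), curve_ram_eq hq hk₂' (hXa a) hac, PowerSeries.order_mul,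
      PowerSeries.order_X_pow]
    push_cast
    congr 1
    by_cases hcε : c = -ε
    · have hkk : k₂' = k₂ := by
        refine mul_left_cancel₀ (pow_ne_zero n₂ prime_X_zero.ne_zero) ?_
        rw [← hk₂', ← hk₂, hcε, neg_neg]
      have hs : PowerSeries.constantCoeff (a + PowerSeries.C ε) = 0 := by
        rw [map_add, ← hca, hcε]; simp
      rw [colen_smooth hs, hkk]
      congr 3
      rw [hcε, map_neg, sub_neg_eq_add]
    · rw [colen_span_pair_of_isUnit (isUnit_X_one_sub fun h => hcε ?_)]
      swap
      · rw [map_add, PowerSeries.constantCoeff_C, ← hca] at h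
        exact eq_neg_of_add_eq_zero_left h
      obtain ⟨k₁', hk₁'⟩ := X_zero_pow_dvd_blowUp (-c) ho₁
      have h1 : curve _ (hXa a) (ram q hq (u * h₁)) = 0 := by
        rw [hprod2, curve_eq_zero_iff]
        exact Multiset.dvd_prod (Multiset.mem_map_of_mem _ (Multiset.mem_map_of_mem _ ha))
      rw [map_mul, map_mul] at h1
      have h2 := (mul_eq_zero.1 h1).resolve_left
        ((hu.map (ram q hq)).map (curve _ (hXa a))).ne_zero
      rw [curve_ram_eq hq hk₁' (hXa a) hac] at h2
      have h3 := (mul_eq_zero.1 h2).resolve_left (pow_ne_zero _ PowerSeries.X_ne_zero)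
      have hev : ∀ {h k : 𝓡} {n : ℕ}, blowUp (-c) h = X 0 ^ n * k →
          cf k 0 0 = (dehom n h).eval c := by
        intro h k n hk
        rw [← coeff_restr, restr_of_blowUp_eq hk, PowerSeries.coeff_zero_eq_constantCoeff_apply,
          constantCoeff_shiftCoe, neg_neg]
      have h4 := hc c hcε (by
        rw [← hev hk₁', ← constantCoeff_curve_ram hac hq, h3, map_zero])
      refine (PowerSeries.order_eq_nat (n := 0)).2 ⟨?_, fun i hi => absurd hi (Nat.not_lt_zero i)⟩
      rw [PowerSeries.coeff_zero_eq_constantCoeff_apply, constantCoeff_curve_ram, hev hk₂']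
      exact h4
  have e1 := colen_eq_sum_branches hu hprod2 (h := h₂) (by
    intro b hb
    obtain ⟨a, ha, rfl⟩ := Multiset.mem_map.1 hb
    rw [colen_smooth (hXa a)]
    exact mt PowerSeries.order_eq_top.1 (hfin a ha))
  have e2 := colen_eq_sum_branches (hu.map (blowUp ε)) hprod' (h := k₂) (by
    intro b hb
    obtain ⟨a, ha, rfl⟩ := Multiset.mem_map.1 hb
    intro e
    have := key a ha
    rw [e, add_top, colen_smooth (hXa a)] at this
    exact hfin a ha (PowerSeries.order_eq_top.1 this))
  rw [Multiset.map_map] at e1 e2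
  simp only [Function.comp_def] at e1 e2
  refine (ENat.mul_right_strictMono hq' (ENat.natCast_ne_top q)).injective ?_
  rw [e1, mul_add, e2, Multiset.map_congr rfl key, Multiset.sum_map_add, Multiset.map_const',
    Multiset.sum_replicate, hcard, nsmul_eq_mul]
  ring

end Noether

/-! ### Comparison of ℂ{x, y} with its completion. -/

section Completion

/-- The germ of `y`. -/
def germY : 𝒪 := ⟨X 1, by
  refine isConvergent_iff.2 ⟨1, 1, one_pos, fun i j => ?_⟩
  rw [← mul_one (X 1)]
  rcases j with _ | j
  · rw [cf_X_one_mul_zero]; simp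
  · rw [cf_X_one_mul_succ, ← map_one C, cf_C]
    split_ifs <;> simp⟩

theorem isConvergent_of_finite (n : ℕ) (b : 𝓡) (h : ∀ i j, n ≤ i ∨ n ≤ j → cf b i j = 0) :
    IsConvergent b := by
  refine isConvergent_iff.2
    ⟨∑ p ∈ Finset.range n ×ˢ Finset.range n, ‖cf b p.1 p.2‖, 1, one_pos, fun i j => ?_⟩
  rw [one_pow, mul_one]
  by_cases hij : n ≤ i ∨ n ≤ j
  · rw [h i j hij, norm_zero]
    exact Finset.sum_nonneg fun _ _ => norm_nonneg _
  · push Not at hij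
    exact Finset.single_le_sum (f := fun p : ℕ × ℕ => ‖cf b p.1 p.2‖)
      (fun _ _ => norm_nonneg _) (a := (i, j)) (by simpa using hij)

theorem exists_shift_decomp (n : ℕ) (b : 𝓡) (h : ∀ i j, i < n → j < n → cf b i j = 0) :
    b = X 0 ^ n * ofCoeff (fun i j => cf b (i + n) j) +
      X 1 ^ n * ofCoeff (fun i j => if i < n then cf b i (j + n) else 0) := by
  refine cf_ext fun i j => ?_
  rw [cf_add]
  have h0 : cf (X 0 ^ n * ofCoeff (fun i j => cf b (i + n) j)) i j =
      if n ≤ i then cf b i j else 0 := by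
    split_ifs with hi
    · obtain ⟨m, rfl⟩ := Nat.exists_eq_add_of_le' hi
      rw [cf_X_zero_pow_mul, cf_ofCoeff]
    · exact cf_X_zero_pow_mul_of_lt (not_le.1 hi) _ _
  have h1 : cf (X 1 ^ n * ofCoeff (fun i j => if i < n then cf b i (j + n) else 0)) i j =
      if n ≤ j ∧ i < n then cf b i j else 0 := by
    by_cases hj : n ≤ j
    · obtain ⟨m, rfl⟩ := Nat.exists_eq_add_of_le' hj
      rw [cf_X_one_pow_mul, cf_ofCoeff]
      simp
    · rw [if_neg fun h => hj h.1]
      exact cf_X_one_pow_mul_of_lt (not_le.1 hj) _ _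
  rw [h0, h1]
  by_cases hi : n ≤ i
  · rw [if_pos hi, if_neg fun h => absurd h.2 hi.not_gt, add_zero]
  · by_cases hj : n ≤ j
    · rw [if_neg hi, if_pos ⟨hj, not_le.1 hi⟩, zero_add]
    · rw [if_neg hi, if_neg fun h => hj h.1, add_zero, h i j (not_le.1 hi) (not_le.1 hj)]

theorem cf_eq_zero_of_mem_span_pow {n : ℕ} {b : 𝓡}
    (h : b ∈ Ideal.span {(X 0 : 𝓡) ^ n, (X 1 : 𝓡) ^ n}) (i j : ℕ) (hi : i < n) (hj : j < n) :
    cf b i j = 0 := by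
  obtain ⟨r, s, rfl⟩ := mem_span_pair'.1 h
  rw [cf_add, cf_X_zero_pow_mul_of_lt hi, cf_X_one_pow_mul_of_lt hj, add_zero]

theorem exists_germ_sub_mem (n : ℕ) (b : 𝓡) :
    ∃ a : 𝒪, b - a ∈ Ideal.span {(X 0 : 𝓡) ^ n, (X 1 : 𝓡) ^ n} := by
  refine ⟨⟨ofCoeff fun i j => if i < n ∧ j < n then cf b i j else 0,
    isConvergent_of_finite n _ fun i j hij => ?_⟩, ?_⟩
  · rw [cf_ofCoeff, if_neg]
    omega
  · refine mem_span_pair'.2 ⟨_, _, exists_shift_decomp n _ fun i j hi hj => ?_⟩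
    rw [cf_sub, cf_ofCoeff, if_pos ⟨hi, hj⟩, sub_self]

theorem exists_germ_decomp {n : ℕ} {a : 𝒪}
    (h : (a : 𝓡) ∈ Ideal.span {(X 0 : 𝓡) ^ n, (X 1 : 𝓡) ^ n}) :
    ∃ c d : 𝒪, a = germX ^ n * c + germY ^ n * d := by
  obtain ⟨c, K, hK, hc⟩ := isConvergent_iff.1 a.2
  have hc0 : 0 ≤ c := by simpa using (norm_nonneg _).trans (hc 0 0)
  refine ⟨⟨ofCoeff (fun i j => cf a (i + n) j), isConvergent_iff.2 ⟨c * K ^ n, K, hK, fun i j => ?_⟩⟩,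
    ⟨ofCoeff (fun i j => if i < n then cf a i (j + n) else 0),
      isConvergent_iff.2 ⟨c * K ^ n, K, hK, fun i j => ?_⟩⟩, Subtype.ext ?_⟩
  · rw [cf_ofCoeff]
    refine (hc _ _).trans_eq ?_
    ring
  · rw [cf_ofCoeff]
    split_ifs
    · refine (hc _ _).trans_eq ?_
      ring
    · rw [norm_zero]; positivity
  · exact exists_shift_decomp n _ (cf_eq_zero_of_mem_span_pow h)

/-- The extension of an ideal to the completion. -/
abbrev extend (I : Ideal 𝒪) : Ideal 𝓡 := I.map convergentSeries.val

theorem exists_mem_sub_mem {I : Ideal 𝒪} {b : 𝓡} (hb : b ∈ extend I) (n : ℕ) :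
    ∃ a ∈ I, b - (a : 𝒪) ∈ Ideal.span {(X 0 : 𝓡) ^ n, (X 1 : 𝓡) ^ n} := by
  induction hb using Submodule.span_induction with
  | mem x hx =>
    obtain ⟨a, ha, rfl⟩ := hx
    exact ⟨a, ha, by
      change (a : 𝓡) - (a : 𝓡) ∈ _
      rw [sub_self]; exact zero_mem _⟩
  | zero => exact ⟨0, zero_mem _, by simp⟩
  | add x y _ _ hx hy =>
    obtain ⟨a, ha, ha'⟩ := hx
    obtain ⟨b, hb, hb'⟩ := hy
    refine ⟨a + b, add_mem ha hb, ?_⟩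
    have := add_mem ha' hb'
    rwa [sub_add_sub_comm] at this
  | smul r x _ hx =>
    obtain ⟨a, ha, ha'⟩ := hx
    obtain ⟨r', hr'⟩ := exists_germ_sub_mem n r
    refine ⟨r' * a, I.mul_mem_left _ ha, ?_⟩
    have h1 := Ideal.mul_mem_left _ r ha'
    have h2 := Ideal.mul_mem_right (a : 𝓡) _ hr'
    have := add_mem h1 h2
    rw [smul_eq_mul]
    convert this using 1
    change r * x - (r' : 𝓡) * (a : 𝓡) = _
    ring

/-- Nakayama by hand. A germ in the extension lies in I + (x^m, y^m) for every m. Taking m = n + 1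
for x^n and y^n gives two linear relations modulo I between them, whose determinant is a unit; hence
x^n, y^n ∈ I, and the case m = n settles the general germ. -/
theorem mem_iff_mem_extend {I : Ideal 𝒪} {n : ℕ} (h0 : (X 0 : 𝓡) ^ n ∈ extend I)
    (h1 : (X 1 : 𝓡) ^ n ∈ extend I) (a : 𝒪) : a ∈ I ↔ (a : 𝓡) ∈ extend I := by
  refine ⟨fun h => Ideal.mem_map_of_mem convergentSeries.val h, fun h => ?_⟩
  have key : ∀ b : 𝒪, (b : 𝓡) ∈ extend I → ∀ m, ∃ c d : 𝒪,
      b - (germX ^ m * c + germY ^ m * d) ∈ I := by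
    intro b hb m
    obtain ⟨a', ha', h⟩ := exists_mem_sub_mem hb m
    obtain ⟨c, d, hcd⟩ := exists_germ_decomp (a := b - a') h
    exact ⟨c, d, by rwa [← hcd, sub_sub_cancel]⟩
  obtain ⟨α, β, hα⟩ := key (germX ^ n) h0 (n + 1)
  obtain ⟨δ, γ, hγ⟩ := key (germY ^ n) h1 (n + 1)
  have hu : IsUnit ((1 - germX * α) * (1 - germY * γ) - germX * germY * δ * β) := by
    rw [isUnit_germ_iff]
    change cf ((1 - X 0 * (α : 𝓡)) * (1 - X 1 * (γ : 𝓡)) - X 0 * X 1 * (δ : 𝓡) * (β : 𝓡)) 0 0 ≠ 0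
    rw [← constantCoeff_eq_cf]
    simp
  have hX : germX ^ n ∈ I := by
    rw [← Ideal.mul_unit_mem_iff_mem I hu]
    convert add_mem (I.mul_mem_left (1 - germY * γ) hα) (I.mul_mem_left (germY * β) hγ) using 1
    ring
  have hY : germY ^ n ∈ I := by
    rw [← Ideal.mul_unit_mem_iff_mem I hu]
    convert add_mem (I.mul_mem_left (1 - germX * α) hγ) (I.mul_mem_left (germX * δ) hα) using 1
    ring
  obtain ⟨c, d, hcd⟩ := key a h n
  rw [← sub_add_cancel a (germX ^ n * c + germY ^ n * d)]
  exact add_mem hcd (add_mem (I.mul_mem_right _ hX) (I.mul_mem_right _ hY))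

theorem colen_extend {I : Ideal 𝒪} {n : ℕ} (h0 : (X 0 : 𝓡) ^ n ∈ extend I)
    (h1 : (X 1 : 𝓡) ^ n ∈ extend I) : colen I = colen (extend I) := by
  refine colen_eq_of_algHom convergentSeries.val (mem_iff_mem_extend h0 h1) fun b => ?_
  obtain ⟨a, ha⟩ := exists_germ_sub_mem n b
  refine ⟨a, ?_⟩
  rw [← neg_mem_iff, neg_sub]
  refine (Ideal.span_le.2 ?_ : Ideal.span {(X 0 : 𝓡) ^ n, (X 1 : 𝓡) ^ n} ≤ extend I) ha
  rintro x (rfl | rfl)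
  · exact h0
  · exact h1

/-- If the extension of `I` has finite colength, then so has `I`, and the colengths agree. -/
theorem colen_extend_of_ne_top {I : Ideal 𝒪} (h : colen (extend I) ≠ ⊤) :
    colen I = colen (extend I) := by
  obtain ⟨m, hm⟩ := exists_pow_mem_of_colen_ne_top h (x := X 0)
    (by rw [← constantCoeff_eq_cf]; simp)
  obtain ⟨n, hn⟩ := exists_pow_mem_of_colen_ne_top h (x := X 1)
    (by rw [← constantCoeff_eq_cf]; simp)
  refine colen_extend (n := m + n) ?_ ?_
  · rw [pow_add]; exact Ideal.mul_mem_right _ _ hm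
  · rw [pow_add]; exact Ideal.mul_mem_left _ _ hn

theorem extend_span (s : Set 𝒪) : extend (Ideal.span s) = Ideal.span ((fun a : 𝒪 => (a : 𝓡)) '' s) :=
  Ideal.map_span _ _

theorem extend_jacobianIdeal (f : 𝒪) : extend (jacobianIdeal f) =
    Ideal.span {MvPowerSeries.pderiv ℂ 0 (f : 𝓡), MvPowerSeries.pderiv ℂ 1 (f : 𝓡)} := by
  rw [jacobianIdeal, extend_span, Set.image_pair]
  rfl

theorem extend_tjurinaIdeal (f : 𝒪) : extend (tjurinaIdeal f) =
    Ideal.span {(f : 𝓡), MvPowerSeries.pderiv ℂ 0 (f : 𝓡), MvPowerSeries.pderiv ℂ 1 (f : 𝓡)} := by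
  rw [tjurinaIdeal, extend, Ideal.map_sup, ← extend, ← extend, extend_jacobianIdeal, extend_span,
    Set.image_singleton, ← Ideal.span_union]
  rfl

/-- The Milnor and Tjurina numbers can be computed in the completion. -/
theorem milnor_tjurina_eq {f : 𝒪} (h : colen (Ideal.span
      {MvPowerSeries.pderiv ℂ 0 (f : 𝓡), MvPowerSeries.pderiv ℂ 1 (f : 𝓡)}) ≠ ⊤) :
    Module.Finite ℂ (𝒪 ⧸ jacobianIdeal f) ∧
      (milnorNumber f : ℕ∞) = colen (Ideal.span
        {MvPowerSeries.pderiv ℂ 0 (f : 𝓡), MvPowerSeries.pderiv ℂ 1 (f : 𝓡)}) ∧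
      (tjurinaNumber f : ℕ∞) = colen (Ideal.span {(f : 𝓡), MvPowerSeries.pderiv ℂ 0 (f : 𝓡),
        MvPowerSeries.pderiv ℂ 1 (f : 𝓡)}) := by
  rw [← extend_jacobianIdeal] at h ⊢
  rw [← extend_tjurinaIdeal]
  have h2 : colen (extend (tjurinaIdeal f)) ≠ ⊤ :=
    ne_top_of_le_ne_top h (colen_mono (Ideal.map_mono le_sup_right))
  have e1 := colen_extend_of_ne_top h
  have e2 := colen_extend_of_ne_top h2
  have f1 : Module.Finite ℂ (𝒪 ⧸ jacobianIdeal f) := colen_ne_top_iff.1 (e1 ▸ h)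
  have f2 : Module.Finite ℂ (𝒪 ⧸ tjurinaIdeal f) := colen_ne_top_iff.1 (e2 ▸ h2)
  exact ⟨f1, by rw [← e1, colen_eq_finrank (e1 ▸ h)]; rfl, by rw [← e2, colen_eq_finrank (e2 ▸ h2)]; rfl⟩

end Completion

/-! ### Homogeneous parts of products, derivatives and the tangent cone. -/

section TangentCone

theorem dvd_of_order_le {a b : PowerSeries ℂ} (ha : a ≠ 0) (h : a.order ≤ b.order) :
    a ∣ b := by
  obtain ⟨n, hn⟩ := ENat.ne_top_iff_exists.1 (mt PowerSeries.order_eq_top.1 ha)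
  obtain ⟨c, hc⟩ := PowerSeries.X_pow_dvd_iff.2 fun m hm =>
    PowerSeries.coeff_of_lt_order m (show (m : ℕ∞) < a.order by rw [← hn]; exact_mod_cast hm)
  obtain ⟨d, hd⟩ := PowerSeries.X_pow_dvd_iff.2 fun m hm =>
    PowerSeries.coeff_of_lt_order m
      (show (m : ℕ∞) < b.order from lt_of_lt_of_le (by rw [← hn]; exact_mod_cast hm) h)
  have hu : IsUnit c := by
    rw [PowerSeries.isUnit_iff_constantCoeff, isUnit_iff_ne_zero]
    intro e
    have h1 := (PowerSeries.order_eq_nat.1 hn.symm).1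
    rw [hc, PowerSeries.coeff_X_pow_mul', if_pos le_rfl, Nat.sub_self,
      PowerSeries.coeff_zero_eq_constantCoeff_apply] at h1
    exact h1 e
  rw [hc, hd]
  exact mul_dvd_mul_left _ hu.dvd

theorem dehom_sub (d : ℕ) (f g : 𝓡) : dehom d (f - g) = dehom d f - dehom d g := by
  ext j
  rw [Polynomial.coeff_sub, coeff_dehom, coeff_dehom, coeff_dehom]
  split_ifs <;> simp

/-- Multiplicativity of initial parts is inherited from that of the blowing-up and of the
restriction to the exceptional divisor. -/
theorem dehom_mul {m n : ℕ} {f g : 𝓡} (hf : (m : ℕ∞) ≤ order f) (hg : (n : ℕ∞) ≤ order g) :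
    dehom (m + n) (f * g) = dehom m f * dehom n g := by
  obtain ⟨k, hk⟩ := X_zero_pow_dvd_blowUp 0 hf
  obtain ⟨l, hl⟩ := X_zero_pow_dvd_blowUp 0 hg
  apply shiftCoe_injective 0
  rw [map_mul, ← restr_of_blowUp_eq hk, ← restr_of_blowUp_eq hl, ← map_mul]
  refine (restr_of_blowUp_eq ?_).symm
  rw [map_mul, hk, hl]; ring

theorem dehom_pow {f : 𝓡} (hf : 1 ≤ order f) (n : ℕ) : dehom n (f ^ n) = dehom 1 f ^ n := by
  induction n with
  | zero =>
    rw [pow_zero, pow_zero, ← map_one C]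
    ext j
    rw [coeff_dehom, cf_C, Polynomial.coeff_one]
    rcases j with _ | j <;> simp
  | succ n ih =>
    rw [pow_succ, pow_succ, ← ih]
    refine dehom_mul ?_ (by exact_mod_cast hf)
    calc (n : ℕ∞) = n • 1 := by simp
      _ ≤ n • order f := by gcongr
      _ ≤ _ := le_order_pow n

theorem dehom_pderiv_one (d : ℕ) (f : 𝓡) :
    dehom d (pderiv ℂ 1 f) = (dehom (d + 1) f).derivative := by
  ext j
  rw [Polynomial.coeff_derivative, coeff_dehom, coeff_dehom, cf_pderiv_one]
  by_cases h : j ≤ d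
  · rw [if_pos h, if_pos (by omega), show d + 1 - (j + 1) = d - j by omega]
  · rw [if_neg h, if_neg (by omega), zero_mul]

theorem dehom_tangent {f : 𝓡} {ν : ℕ} {c ε : ℂ}
    (h : homogeneousComponent ν f = C c * (X 1 + C ε * X 0) ^ ν) :
    dehom ν f = Polynomial.C c * (Polynomial.X + Polynomial.C ε) ^ ν := by
  have h1 : dehom ν (homogeneousComponent ν f) = dehom ν f := by
    ext j
    rw [coeff_dehom, coeff_dehom]
    split_ifs with hj
    · rw [cf, coeff_homogeneousComponent, if_pos]
      · rfl
      · rw [map_add, Finsupp.degree_single, Finsupp.degree_single]; omega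
    · rfl
  have h2 : dehom 1 (X 1 + C ε * X 0) = Polynomial.X + Polynomial.C ε := by
    ext j
    rw [coeff_dehom, cf_add, cf_C_mul, ← mul_one (X 1), ← mul_one (X 0), ← map_one C]
    rcases j with _ | _ | j
    · rw [if_pos (by omega), show 1 - 0 = 0 + 1 from rfl, cf_X_one_mul_zero, cf_X_zero_mul_succ,
        cf_C]
      simp
    · rw [if_pos (by omega), show 1 - (0 + 1) = 0 from rfl, cf_X_one_mul_succ, cf_X_zero_mul_zero,
        cf_C]
      simp
    · rw [if_neg (by omega)]
      simp [Polynomial.coeff_X]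
  have h3 : dehom 0 (C c) = Polynomial.C c := by
    ext j
    rw [coeff_dehom, cf_C, Polynomial.coeff_C]
    rcases j with _ | j <;> simp
  have h4 : 1 ≤ order (X 1 + C ε * X 0 : 𝓡) := one_le_order_of_constantCoeff (by simp)
  have h5 : (ν : ℕ∞) ≤ order ((X 1 + C ε * X 0 : 𝓡) ^ ν) := by
    calc (ν : ℕ∞) = ν • 1 := by simp
      _ ≤ ν • order (X 1 + C ε * X 0 : 𝓡) := by gcongr
      _ ≤ _ := le_order_pow ν
  have h6 := dehom_mul (m := 0) (n := ν) (f := C c) (by simp) h5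
  rw [zero_add] at h6
  rw [← h1, h, h6, h3, dehom_pow h4, h2]

end TangentCone

/-! ### Derivatives of the pull-back. -/

section ChainRule

theorem pderiv_one_blowUp (ε : ℂ) (f : 𝓡) :
    pderiv ℂ 1 (blowUp ε f) = X 0 * blowUp ε (pderiv ℂ 1 f) := by
  rw [← sub_eq_zero]
  refine derivation_eq_zero (blowUp ε) (fun i => by fin_cases i <;> simp)
    (fun f => pderiv ℂ 1 (blowUp ε f) - X 0 * blowUp ε (pderiv ℂ 1 f)) ?_ ?_ ?_ f
  · intro f g
    simp only [map_add]; ring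
  · intro a
    simp
  · intro i g
    have h1 : pderiv ℂ 1 (blowUp ε (X i)) = X 0 * blowUp ε (pderiv ℂ 1 (X i)) := by
      fin_cases i
      · simp [pderiv_X_of_ne]
      · simp [pderiv_X_self, pderiv_X_of_ne, Derivation.leibniz]
    simp only [map_mul, Derivation.leibniz, smul_eq_mul, map_add]
    linear_combination blowUp ε g * h1

theorem pderiv_zero_blowUp (ε : ℂ) (f : 𝓡) :
    pderiv ℂ 0 (blowUp ε f) =
      blowUp ε (pderiv ℂ 0 f) + (X 1 - C ε) * blowUp ε (pderiv ℂ 1 f) := by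
  rw [← sub_eq_zero]
  refine derivation_eq_zero (blowUp ε) (fun i => by fin_cases i <;> simp)
    (fun f => pderiv ℂ 0 (blowUp ε f) -
      (blowUp ε (pderiv ℂ 0 f) + (X 1 - C ε) * blowUp ε (pderiv ℂ 1 f))) ?_ ?_ ?_ f
  · intro f g
    simp only [map_add]; ring
  · intro a
    simp
  · intro i g
    have h1 : pderiv ℂ 0 (blowUp ε (X i)) =
        blowUp ε (pderiv ℂ 0 (X i)) + (X 1 - C ε) * blowUp ε (pderiv ℂ 1 (X i)) := by
      fin_cases i
      · simp [pderiv_X_of_ne, pderiv_X_self]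
      · simp [pderiv_X_self, pderiv_X_of_ne, Derivation.leibniz]
    simp only [map_mul, Derivation.leibniz, smul_eq_mul, map_add]
    linear_combination blowUp ε g * h1

end ChainRule

/-! ### Derivatives and restriction of the strict transform. -/

section StrictTransform

variable {f f' : 𝓡} {ε c : ℂ} {ν : ℕ}

theorem blowUp_pderiv_one (hE : blowUp ε f = X 0 ^ (ν + 1) * f') :
    blowUp ε (pderiv ℂ 1 f) = X 0 ^ ν * pderiv ℂ 1 f' := by
  have h := pderiv_one_blowUp ε f
  rw [hE, Derivation.leibniz, smul_eq_mul, pderiv_pow, pderiv_X_of_ne (by decide)] at h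
  refine mul_left_cancel₀ prime_X_zero.ne_zero (h.symm.trans ?_)
  simp only [mul_zero, smul_zero, add_zero]
  ring

/-- The summand with coefficient ν + 1 comes from differentiating the exceptional factor; it is the
term that Teissier's lemma later removes. -/
theorem blowUp_pderiv_zero (hE : blowUp ε f = X 0 ^ (ν + 1) * f') :
    blowUp ε (pderiv ℂ 0 f) = X 0 ^ ν * (X 0 * pderiv ℂ 0 f' + C ((ν + 1 : ℕ) : ℂ) * f' -
      (X 1 - C ε) * pderiv ℂ 1 f') := by
  have h := pderiv_zero_blowUp ε f
  rw [hE, Derivation.leibniz, smul_eq_mul, pderiv_pow, pderiv_X_self, blowUp_pderiv_one hE,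
    smul_eq_mul, Nat.add_sub_cancel] at h
  rw [map_natCast]
  linear_combination -h

theorem restr_strictTransform (hE : blowUp ε f = X 0 ^ ν * f')
    (ht : dehom ν f = Polynomial.C c * (Polynomial.X + Polynomial.C ε) ^ ν) :
    restr f' = PowerSeries.C c * PowerSeries.X ^ ν := by
  rw [restr_of_blowUp_eq hE, ht]
  simp

end StrictTransform

/-! ### Forms tangent to a curve and to the exceptional line. -/

section FormalSide

theorem dvd_of_dvd_X_zero_pow_mul {f g : 𝓡} {N : ℕ} (hf : ¬ X 0 ∣ f) (h : f ∣ X 0 ^ N * g) :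
    f ∣ g := by
  obtain ⟨t, ht⟩ := h
  obtain ⟨s, rfl⟩ := prime_X_zero.pow_dvd_of_dvd_mul_left N hf (Dvd.intro _ ht)
  exact ⟨s, mul_left_cancel₀ (pow_ne_zero N prime_X_zero.ne_zero) (by rw [ht]; ring)⟩

/-- Regularity hypothesis of `colen_eq_of_basis`: f divides x^N g, and f is coprime to the prime x.
-/
theorem dvd_of_dvd_mul_of_mem {f g p q : 𝓡} {N : ℕ} (hf : ¬ X 0 ∣ f)
    (hN : X 0 ^ N ∈ Ideal.span {f, p, q}) (hp : f ∣ g * p) (hq : f ∣ g * q) : f ∣ g := by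
  obtain ⟨r, s, t, h⟩ := mem_span_triple'.1 hN
  refine dvd_of_dvd_X_zero_pow_mul hf (N := N) ?_
  rw [h, show (f * r + p * s + q * t) * g = f * (r * g) + g * p * s + g * q * t by ring]
  exact dvd_add (dvd_add (dvd_mul_right _ _) (Dvd.dvd.mul_right hp _)) (Dvd.dvd.mul_right hq _)

theorem not_X_zero_dvd {f : 𝓡} {n : ℕ} (h : cf f 0 n ≠ 0) : ¬ X 0 ∣ f := fun hd =>
  h (X_zero_dvd_iff.1 hd n)

/-- A vector field preserving a proper ideal of finite colength is singular. -/
theorem one_le_of_preserves {f a b h : 𝓡} (h0 : 2 ≤ order f)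
    (hfin : colen (Ideal.span {f, pderiv ℂ 0 f, pderiv ℂ 1 f}) ≠ ⊤)
    (he : a * pderiv ℂ 1 f - b * pderiv ℂ 0 f = h * f) : 1 ≤ order a ∧ 1 ≤ order b := by
  set J := Ideal.span {f, pderiv ℂ 0 f, pderiv ℂ 1 f} with hJ
  have hle := le_order_iff.1 (show ((2 : ℕ) : ℕ∞) ≤ order f from h0)
  have hJ1 : (1 : 𝓡) ∉ J := by
    intro h1
    obtain ⟨r, s, t, h1⟩ := mem_span_triple'.1 h1
    have := congrArg (fun g => cf g 0 0) h1
    simp only [cf_add, cf_zero_zero_mul, cf_pderiv_zero, cf_pderiv_one] at this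
    rw [hle 0 0 (by omega), hle _ _ (by omega), hle _ _ (by omega), ← map_one C, cf_C] at this
    simp at this
  have hf : f ∈ J := Ideal.subset_span (by simp)
  have hfx : pderiv ℂ 0 f ∈ J := Ideal.subset_span (by simp)
  have hfy : pderiv ℂ 1 f ∈ J := Ideal.subset_span (by simp)
  have hcomm : pderiv ℂ 0 (pderiv ℂ 1 f) = pderiv ℂ 1 (pderiv ℂ 0 f) := by
    refine cf_ext fun i j => ?_
    rw [cf_pderiv_zero, cf_pderiv_one, cf_pderiv_one, cf_pderiv_zero]; ring
  -- The field D = b ∂_x - a ∂_y multiplies f by -h; differentiating this relation in x and y shows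
  -- that D f_x and D f_y also lie in J.
  have hpres : ∀ g ∈ J, b * pderiv ℂ 0 g - a * pderiv ℂ 1 g ∈ J := by
    intro g hg
    obtain ⟨r, s, t, rfl⟩ := mem_span_triple'.1 hg
    have hx := congrArg (pderiv ℂ 0) he
    have hy := congrArg (pderiv ℂ 1) he
    simp only [map_sub, Derivation.leibniz, smul_eq_mul, hcomm] at hx hy
    have key : b * pderiv ℂ 0 (f * r + pderiv ℂ 0 f * s + pderiv ℂ 1 f * t) -
        a * pderiv ℂ 1 (f * r + pderiv ℂ 0 f * s + pderiv ℂ 1 f * t) =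
        (b * pderiv ℂ 0 r - a * pderiv ℂ 1 r - h * r - pderiv ℂ 0 h * s - pderiv ℂ 1 h * t) * f +
        (b * pderiv ℂ 0 s - a * pderiv ℂ 1 s - h * s - pderiv ℂ 0 b * s - pderiv ℂ 1 b * t) *
          pderiv ℂ 0 f +
        (b * pderiv ℂ 0 t - a * pderiv ℂ 1 t - h * t + pderiv ℂ 0 a * s + pderiv ℂ 1 a * t) *
          pderiv ℂ 1 f := by
      simp only [map_add, Derivation.leibniz, smul_eq_mul, hcomm]
      linear_combination -r * he - s * hx - t * hy
    rw [key]
    exact add_mem (add_mem (J.mul_mem_left _ hf) (J.mul_mem_left _ hfx)) (J.mul_mem_left _ hfy)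
  -- If D l were a unit, applying D to the least power of l in J would, up to a unit, put the
  -- preceding power in J, which is absurd.
  have main : ∀ l : 𝓡, cf l 0 0 = 0 → ¬ IsUnit (b * pderiv ℂ 0 l - a * pderiv ℂ 1 l) := by
    intro l hl hu
    have hex := exists_pow_mem_of_colen_ne_top hfin hl
    classical
    have hmin := fun {m} => Nat.find_min hex (m := m)
    have hspec := Nat.find_spec hex
    rcases hn : Nat.find hex with _ | n
    · rw [hn, pow_zero] at hspec
      exact hJ1 hspec
    · rw [hn] at hspec
      refine hmin (m := n) (by omega) ?_
      have h1 := hpres _ hspec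
      have h2 : b * pderiv ℂ 0 (l ^ (n + 1)) - a * pderiv ℂ 1 (l ^ (n + 1)) =
          l ^ n * (C ((n + 1 : ℕ) : ℂ) * (b * pderiv ℂ 0 l - a * pderiv ℂ 1 l)) := by
        rw [pderiv_pow, pderiv_pow, map_natCast, Nat.add_sub_cancel]; ring
      rw [h2] at h1
      refine (Ideal.mul_unit_mem_iff_mem J (IsUnit.mul ?_ hu)).1 h1
      rw [isUnit_iff_cf, cf_C, if_pos ⟨rfl, rfl⟩]
      exact_mod_cast Nat.succ_ne_zero n
  constructor
  · refine one_le_order_of_constantCoeff ?_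
    by_contra hne
    refine main (X 1) (by rw [← constantCoeff_eq_cf]; simp) ?_
    rw [pderiv_X_self, pderiv_X_of_ne (by decide), isUnit_iff_cf, ← constantCoeff_eq_cf]
    simpa using hne
  · refine one_le_order_of_constantCoeff ?_
    by_contra hne
    refine main (X 0) (by rw [← constantCoeff_eq_cf]; simp) ?_
    rw [pderiv_X_self, pderiv_X_of_ne (by decide), isUnit_iff_cf, ← constantCoeff_eq_cf]
    simpa using hne

theorem span_pair_add_mul {A : Type*} [CommRing A] (p q r : A) :
    Ideal.span {p, q + p * r} = Ideal.span {p, q} := by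
  rw [Set.pair_comm, mul_comm p, Ideal.span_pair_add_mul_right, Set.pair_comm]

/-- Comparison of `Ω¹` of the strict transform with the pull-back of `Ω¹`. -/
theorem colen_eq_add_of_order_le {f a₁ a₂ b₁ b₂ h₁ h₂ u : 𝓡} {ν N : ℕ} {c : ℂ} (hc : c ≠ 0)
    (hν : ν ≠ 0) (hr : restr f = PowerSeries.C c * PowerSeries.X ^ ν) (hu : IsUnit u)
    (hN : X 0 ^ N ∈ Ideal.span {f, pderiv ℂ 1 f, pderiv ℂ 0 f})
    (e₁ : a₁ * pderiv ℂ 1 f - b₁ * (X 0 * pderiv ℂ 0 f) = h₁ * f)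
    (e₂ : a₂ * pderiv ℂ 1 f - b₂ * (X 0 * pderiv ℂ 0 f) = h₂ * f)
    (hdet : a₁ * b₂ - a₂ * b₁ = u * f) (hle : (restr a₁).order ≤ (restr a₂).order) :
    ∃ e : ℕ, (restr a₁).order = e + 1 ∧
      colen (Ideal.span {h₁, h₂}) + colen (Ideal.span {f, pderiv ℂ 1 f, pderiv ℂ 0 f}) =
        colen (Ideal.span {pderiv ℂ 1 f, pderiv ℂ 0 f}) + e := by
  have hdom : IsDomain 𝓡 := NoZeroDivisors.to_isDomain 𝓡
  have hr0 : restr f ≠ 0 := by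
    rw [hr]
    refine mul_ne_zero ?_ (pow_ne_zero _ PowerSeries.X_ne_zero)
    rwa [Ne, map_eq_zero_iff _ PowerSeries.C_injective]
  have hXf : ¬ X 0 ∣ f := fun h => hr0 (restr_eq_zero_iff.2 h)
  have hf0 : f ≠ 0 := by rintro rfl; simp at hr0
  have ha0 : restr a₁ ≠ 0 := by
    intro h
    rw [h, PowerSeries.order_zero, top_le_iff, PowerSeries.order_eq_top] at hle
    have := congrArg restr hdet
    rw [map_sub, map_mul, map_mul, map_mul, h, hle, zero_mul, zero_mul, sub_zero] at this
    exact (mul_ne_zero (hu.map restr).ne_zero hr0) this.symm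
  -- On x = 0 the coefficient a₂ is a multiple of a₁, so a₂ - q a₁ = x α. The combination of the two
  -- forms can be divided by x, its cofactor too since x does not divide f, and the resulting pair
  -- has determinant u f: it is a basis without the tangency to x = 0.
  obtain ⟨q', hq'⟩ := dvd_of_order_le ha0 hle
  obtain ⟨q, rfl⟩ := restr_surjective q'
  have hα : X 0 ∣ a₂ - a₁ * q := by
    rw [← restr_eq_zero_iff, map_sub, map_mul, hq', sub_self]
  obtain ⟨α, hα⟩ := hα
  have hη : X 0 ∣ h₂ - h₁ * q := by
    refine (prime_X_zero.dvd_or_dvd (b := f) ⟨α * pderiv ℂ 1 f - (b₂ - b₁ * q) * pderiv ℂ 0 f, ?_⟩).resolve_right hXf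
    linear_combination -e₂ + q * e₁ + pderiv ℂ 1 f * hα
  obtain ⟨η, hη⟩ := hη
  have e₃ : α * pderiv ℂ 1 f - (b₂ - b₁ * q) * pderiv ℂ 0 f = η * f := by
    refine mul_left_cancel₀ prime_X_zero.ne_zero ?_
    linear_combination e₂ - q * e₁ - pderiv ℂ 1 f * hα + f * hη
  have e₁' : a₁ * pderiv ℂ 1 f - (X 0 * b₁) * pderiv ℂ 0 f = h₁ * f := by
    linear_combination e₁
  have hdet' : a₁ * (b₂ - b₁ * q) - α * (X 0 * b₁) = u * f := by
    linear_combination hdet + b₁ * hα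
  have hcol := colen_eq_of_basis hf0 hu e₁' e₃ hdet'
    fun g hp hq => dvd_of_dvd_mul_of_mem hXf hN hp hq
  have hry : restr (pderiv ℂ 1 f) = PowerSeries.C (ν * c) * PowerSeries.X ^ (ν - 1) := by
    ext j
    rw [coeff_restr, cf_pderiv_one, ← coeff_restr, hr, PowerSeries.coeff_C_mul,
      PowerSeries.coeff_C_mul, PowerSeries.coeff_X_pow, PowerSeries.coeff_X_pow]
    by_cases hj : j + 1 = ν
    · rw [if_pos hj, if_pos (by omega), ← hj]
      push_cast; ring
    · rw [if_neg hj, if_neg (by omega)]; simp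
  -- Restricting `e₁` to x = 0, where f is c y^ν and f_y is ν c y^(ν-1): this is the source of the
  -- -1 in the formula.
  have hrh : PowerSeries.C (ν : ℂ) * restr a₁ = PowerSeries.X * restr h₁ := by
    have h1 := congrArg restr e₁
    rw [map_sub, map_mul, map_mul, map_mul, map_mul, restr_X_zero, hry, hr, zero_mul, mul_zero,
      sub_zero] at h1
    obtain ⟨n, rfl⟩ := Nat.exists_eq_succ_of_ne_zero hν
    have hne : PowerSeries.C c * PowerSeries.X ^ n ≠ 0 := by
      refine mul_ne_zero ?_ (pow_ne_zero _ PowerSeries.X_ne_zero)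
      rwa [Ne, map_eq_zero_iff _ PowerSeries.C_injective]
    refine mul_right_cancel₀ hne ?_
    rw [map_mul, Nat.succ_sub_one, pow_succ] at h1
    linear_combination h1
  have hord : (restr a₁).order = (restr h₁).order + 1 := by
    have h1 := congrArg PowerSeries.order hrh
    rw [PowerSeries.order_mul, PowerSeries.order_mul, PowerSeries.order_X,
      PowerSeries.order_zero_of_unit, zero_add, add_comm] at h1
    · exact h1
    · rw [PowerSeries.isUnit_iff_constantCoeff, PowerSeries.constantCoeff_C, isUnit_iff_ne_zero]
      exact Nat.cast_ne_zero.2 hν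
  have hh0 : restr h₁ ≠ 0 := by
    intro h
    rw [h, PowerSeries.order_zero, top_add, PowerSeries.order_eq_top] at hord
    exact ha0 hord
  obtain ⟨e, he⟩ := ENat.ne_top_iff_exists.1 (mt PowerSeries.order_eq_top.1 hh0)
  refine ⟨e, by rw [hord, ← he], ?_⟩
  -- Modulo h₁ the second cofactor is x η, so additivity splits off the intersection of h₁ with x =
  -- 0.
  have h2 : colen (Ideal.span {h₁, h₂}) = colen (Ideal.span {h₁, η}) + e := by
    rw [show h₂ = X 0 * η + h₁ * q by rw [← hη]; ring, span_pair_add_mul, Set.pair_comm,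
      colen_mul prime_X_zero.ne_zero, colen_X_zero, ← he, Set.pair_comm η]
    intro s hs
    exact (prime_X_zero.dvd_or_dvd hs).resolve_left fun h => hh0 (restr_eq_zero_iff.2 h)
  rw [h2, hcol]
  ring

end FormalSide

/-! ### The formula over formal power series. -/

section Formula

/-- The Jacobian ideal contains (f_y, x f_x), of finite colength by Teissier's lemma at s = 0. -/
theorem colen_jacobian_ne_top {f : 𝓡} {n N : ℕ} (h0 : ∀ j ≤ n, cf f 0 j = 0)
    (hn : cf f 0 (n + 1) ≠ 0) (hN : X 0 ^ N ∈ Ideal.span {f, X 0 * pderiv ℂ 0 f, pderiv ℂ 1 f}) :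
    colen (Ideal.span {pderiv ℂ 0 f, pderiv ℂ 1 f}) ≠ ⊤ := by
  obtain ⟨m, hm⟩ := exists_colen_polar_eq h0 hn hN
  refine ne_top_of_le_ne_top (ENat.natCast_ne_top m) ?_
  rw [← hm 0]
  refine colen_mono (Ideal.span_le.2 ?_)
  rintro x (rfl | rfl)
  · exact Ideal.subset_span (by simp)
  · simp only [Nat.cast_zero, map_zero, zero_mul, add_zero]
    exact Ideal.mul_mem_left _ _ (Ideal.subset_span (by simp))

theorem mem_span_polar {f fx fy : 𝓡} {z : 𝓡} (h : z ∈ Ideal.span {f, fy}) :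
    z ∈ Ideal.span {f, X 0 * fx, fy} := by
  refine Ideal.span_mono ?_ h
  rintro x (rfl | rfl) <;> simp

theorem le_order_pderiv {f : 𝓡} {n : ℕ} (h : ((n + 1 : ℕ) : ℕ∞) ≤ order f) :
    (n : ℕ∞) ≤ order (pderiv ℂ 0 f) ∧ (n : ℕ∞) ≤ order (pderiv ℂ 1 f) := by
  rw [le_order_iff] at h
  constructor <;> rw [le_order_iff] <;> intro i j hij
  · rw [cf_pderiv_zero, h _ _ (by omega), zero_mul]
  · rw [cf_pderiv_one, h _ _ (by omega), zero_mul]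

theorem le_order_of_mul_eq {f g h : 𝓡} {m n : ℕ} (hf : order f = m)
    (hg : ((n + m : ℕ) : ℕ∞) ≤ order g) (h' : g = h * f) : (n : ℕ∞) ≤ order h := by
  have : order (h * f) = order h + order f := order_mul h f
  rw [h', this, hf] at hg
  push_cast at hg
  exact (ENat.add_le_add_iff_right (ENat.natCast_ne_top m)).1 hg

/-- Order count: the left side has order at least (n + 1) + m, and f takes away m + 1. -/
theorem le_order_cofactor {f a b h : 𝓡} {m n : ℕ} (hf : order f = (m + 1 : ℕ))
    (ha : ((n + 1 : ℕ) : ℕ∞) ≤ order a) (hb : ((n + 1 : ℕ) : ℕ∞) ≤ order b)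
    (he : a * pderiv ℂ 1 f - b * pderiv ℂ 0 f = h * f) : (n : ℕ∞) ≤ order h := by
  obtain ⟨hx, hy⟩ := le_order_pderiv hf.ge
  refine le_order_of_mul_eq hf ?_ he
  have h1 : ((n + (m + 1) : ℕ) : ℕ∞) = (n + 1 : ℕ) + m := by push_cast; ring
  rw [h1, sub_eq_add_neg, ← neg_mul]
  refine le_order_add ((add_le_add ha hy).trans le_order_mul)
    ((add_le_add ?_ hx).trans le_order_mul)
  rwa [order_neg]

variable {f f' u A₁ A₂ B₁ B₂ h₁ h₂ : 𝓡} {ε c : ℂ} {n₁ n₂ N : ℕ}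

/-- The common points of the tangent cones of the cofactors. -/
theorem cofactor_tangents (hc : c ≠ 0)
    (ht : dehom (n₁ + n₂ + 1 + 1) f =
      Polynomial.C c * (Polynomial.X + Polynomial.C ε) ^ (n₁ + n₂ + 1 + 1))
    (hf : ((n₁ + n₂ + 1 + 1 : ℕ) : ℕ∞) ≤ order f)
    (hB₁ : ((n₁ + 1 : ℕ) : ℕ∞) ≤ order B₁) (hB₂ : ((n₂ + 1 : ℕ) : ℕ∞) ≤ order B₂)
    (hh₁ : (n₁ : ℕ∞) ≤ order h₁) (hh₂ : (n₂ : ℕ∞) ≤ order h₂) (hu : IsUnit u)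
    (e : u * pderiv ℂ 1 f = B₂ * h₁ - B₁ * h₂) :
    (cf h₁ 0 n₁ ≠ 0 ∨ cf h₂ 0 n₂ ≠ 0) ∧
      ∀ z, z ≠ -ε → (dehom n₁ h₁).eval z = 0 → (dehom n₂ h₂).eval z ≠ 0 := by
  obtain ⟨-, hy⟩ := le_order_pderiv hf
  have hd0 : dehom 0 u = Polynomial.C (cf u 0 0) := by
    ext j
    rw [coeff_dehom, Polynomial.coeff_C]
    rcases j with _ | j <;> simp
  have h1 := congrArg (dehom (n₁ + n₂ + 1)) e
  have h2 := dehom_mul (m := 0) (f := u) (by simp) hy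
  have h3 := dehom_mul hB₂ hh₁
  have h4 := dehom_mul hB₁ hh₂
  rw [zero_add] at h2
  rw [show n₂ + 1 + n₁ = n₁ + n₂ + 1 by ring] at h3
  rw [show n₁ + 1 + n₂ = n₁ + n₂ + 1 by ring] at h4
  rw [h2, dehom_sub, h3, h4, hd0, dehom_pderiv_one, ht] at h1
  have hu0 := isUnit_iff_cf.1 hu
  have hnz : ((n₁ + n₂ + 1 + 1 : ℕ) : ℂ) ≠ 0 := Nat.cast_ne_zero.2 (Nat.succ_ne_zero _)
  constructor
  -- The coefficient of y^(n₁+n₂+1) on the left is a nonzero multiple of c, so some h_i is regular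
  -- in y of order n_i; that h_i will play the first role in Noether's formula.
  · by_contra! hcon
    have h5 := congrArg (fun p => p.coeff (n₁ + n₂ + 1)) h1
    have h6 := Polynomial.coeff_mul_add_eq_of_natDegree_le (natDegree_dehom_le (n₂ + 1) B₂)
      (natDegree_dehom_le n₁ h₁)
    have h7 := Polynomial.coeff_mul_add_eq_of_natDegree_le (natDegree_dehom_le (n₁ + 1) B₁)
      (natDegree_dehom_le n₂ h₂)
    rw [coeff_dehom n₁, if_pos le_rfl, Nat.sub_self, hcon.1, mul_zero,
      show n₂ + 1 + n₁ = n₁ + n₂ + 1 by ring] at h6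
    rw [coeff_dehom n₂, if_pos le_rfl, Nat.sub_self, hcon.2, mul_zero,
      show n₁ + 1 + n₂ = n₁ + n₂ + 1 by ring] at h7
    simp only [Polynomial.coeff_sub, h6, h7, Polynomial.coeff_C_mul, Polynomial.coeff_derivative,
      Polynomial.coeff_X_add_C_pow] at h5
    rw [Nat.sub_self, pow_zero, Nat.choose_self] at h5
    have h8 : cf u 0 0 * (c * ((n₁ + n₂ + 1 + 1 : ℕ) : ℂ)) = 0 := by
      push_cast at h5 ⊢
      linear_combination h5
    exact mul_ne_zero hu0 (mul_ne_zero hc hnz) h8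
  -- A common zero z of both cones is a zero of the derivative of c (y + ε)^ν, hence equals -ε.
  · intro z hz hz1 hz2
    have h5 := congrArg (fun p => p.eval z) h1
    simp only [Polynomial.eval_sub, Polynomial.eval_mul, hz1, hz2, mul_zero, sub_zero,
      Polynomial.derivative_C_mul, Polynomial.derivative_X_add_C_pow, Polynomial.eval_C,
      Polynomial.eval_pow, Polynomial.eval_add, Polynomial.eval_X, Nat.add_sub_cancel] at h5
    refine mul_ne_zero hu0 (mul_ne_zero hc (mul_ne_zero hnz (pow_ne_zero _ ?_))) h5
    exact fun h => hz (eq_neg_of_add_eq_zero_left h)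

/-- The coefficients of the pull-back of a form `A dx + B dy`. -/
theorem exists_pullback {A B a : 𝓡} {n : ℕ} (hB : (n : ℕ∞) ≤ order B)
    (ha : blowUp ε A + (X 1 - C ε) * blowUp ε B = X 0 ^ n * a) :
    ∃ b, blowUp ε B = X 0 ^ n * b ∧ blowUp ε A = X 0 ^ n * (a - (X 1 - C ε) * b) := by
  obtain ⟨b, hb⟩ := X_zero_pow_dvd_blowUp ε hB
  exact ⟨b, hb, by rw [mul_sub, ← ha, hb]; ring⟩

/-- The two terms with y - ε, one from the pull-back of A and one from that of f_x, cancel, and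
x^(n+1+m) is a common factor. -/
theorem blowUp_cofactor {A B h a b k : 𝓡} {m n : ℕ}
    (hE : blowUp ε f = X 0 ^ (m + 1) * f')
    (he : A * pderiv ℂ 1 f - B * pderiv ℂ 0 f = h * f)
    (hb : blowUp ε B = X 0 ^ (n + 1) * b)
    (ha : blowUp ε A = X 0 ^ (n + 1) * (a - (X 1 - C ε) * b))
    (hk : blowUp ε h = X 0 ^ n * k) :
    a * pderiv ℂ 1 f' - b * (X 0 * pderiv ℂ 0 f' + C ((m + 1 : ℕ) : ℂ) * f') = k * f' := by
  have h1 := congrArg (blowUp ε) he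
  rw [map_sub, map_mul, map_mul, map_mul, hb, ha, hk, hE, blowUp_pderiv_one hE,
    blowUp_pderiv_zero hE] at h1
  refine mul_left_cancel₀ (pow_ne_zero (n + 1 + m) prime_X_zero.ne_zero) ?_
  linear_combination h1

/-- The formula for the difference of the Milnor and Tjurina numbers of a branch and of its strict
transform, over formal power series. -/
theorem colen_formula {a₁ a₂ : 𝓡} (hc : c ≠ 0) (hf : order f = (n₁ + n₂ + 1 + 1 : ℕ))
    (ht : dehom (n₁ + n₂ + 1 + 1) f =
      Polynomial.C c * (Polynomial.X + Polynomial.C ε) ^ (n₁ + n₂ + 1 + 1))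
    (hE : blowUp ε f = X 0 ^ (n₁ + n₂ + 1 + 1) * f') (hu : IsUnit u)
    (hN : X 0 ^ N ∈ Ideal.span {f, pderiv ℂ 1 f})
    (hA₁ : ((n₁ + 1 : ℕ) : ℕ∞) ≤ order A₁) (hB₁ : ((n₁ + 1 : ℕ) : ℕ∞) ≤ order B₁)
    (hA₂ : ((n₂ + 1 : ℕ) : ℕ∞) ≤ order A₂) (hB₂ : ((n₂ + 1 : ℕ) : ℕ∞) ≤ order B₂)
    (e₁ : A₁ * pderiv ℂ 1 f - B₁ * pderiv ℂ 0 f = h₁ * f)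
    (e₂ : A₂ * pderiv ℂ 1 f - B₂ * pderiv ℂ 0 f = h₂ * f)
    (hdet : A₁ * B₂ - A₂ * B₁ = u * f)
    (ha₁ : blowUp ε A₁ + (X 1 - C ε) * blowUp ε B₁ = X 0 ^ (n₁ + 1) * a₁)
    (ha₂ : blowUp ε A₂ + (X 1 - C ε) * blowUp ε B₂ = X 0 ^ (n₂ + 1) * a₂) :
    ∃ e : ℕ, min (restr a₁).order (restr a₂).order = e + 1 ∧
      colen (Ideal.span {pderiv ℂ 0 f', pderiv ℂ 1 f'}) ≠ ⊤ ∧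
      colen (Ideal.span {pderiv ℂ 0 f, pderiv ℂ 1 f}) +
          colen (Ideal.span {f', pderiv ℂ 0 f', pderiv ℂ 1 f'}) =
        colen (Ideal.span {f, pderiv ℂ 0 f, pderiv ℂ 1 f}) +
          colen (Ideal.span {pderiv ℂ 0 f', pderiv ℂ 1 f'}) + n₁ * n₂ + e := by
  have hdom : IsDomain 𝓡 := NoZeroDivisors.to_isDomain 𝓡
  have hcf : cf f 0 (n₁ + n₂ + 1 + 1) ≠ 0 := by
    have := congrArg (fun p => p.coeff (n₁ + n₂ + 1 + 1)) ht
    simp only [coeff_dehom, Polynomial.coeff_C_mul, Polynomial.coeff_X_add_C_pow] at this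
    rw [if_pos le_rfl, Nat.sub_self] at this
    rw [this]
    simpa using hc
  have hcf0 : ∀ j ≤ n₁ + n₂ + 1, cf f 0 j = 0 := fun j hj =>
    le_order_iff.1 hf.ge 0 j (by omega)
  have hf0 : f ≠ 0 := by rintro rfl; simp at hcf
  have hXf := not_X_zero_dvd hcf
  have hfin := colen_jacobian_ne_top hcf0 hcf (mem_span_polar hN)
  -- the strict transform
  have hr := restr_strictTransform hE ht
  have hcf' : cf f' 0 (n₁ + n₂ + 1 + 1) ≠ 0 := by
    rw [← coeff_restr, hr]
    simpa [PowerSeries.coeff_C_mul, PowerSeries.coeff_X_pow] using hc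
  have hcf0' : ∀ j ≤ n₁ + n₂ + 1, cf f' 0 j = 0 := fun j hj => by
    rw [← coeff_restr, hr, PowerSeries.coeff_C_mul, PowerSeries.coeff_X_pow, if_neg (by omega),
      mul_zero]
  have hf0' : f' ≠ 0 := by rintro rfl; simp at hcf'
  have hXf' := not_X_zero_dvd hcf'
  have hN' : X 0 ^ N ∈ Ideal.span {f', pderiv ℂ 1 f'} := by
    obtain ⟨r, s, hrs⟩ := mem_span_pair'.1 hN
    have := congrArg (blowUp ε) hrs
    rw [map_add, map_mul, map_mul, hE, blowUp_pderiv_one hE, map_pow, blowUp_X_zero] at this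
    exact mem_span_pair'.2 ⟨X 0 ^ (n₁ + n₂ + 1 + 1) * blowUp ε r, X 0 ^ (n₁ + n₂ + 1) * blowUp ε s,
      by rw [this]; ring⟩
  have hfin' := colen_jacobian_ne_top hcf0' hcf' (mem_span_polar hN')
  have hN3 : ∀ q, X 0 ^ N ∈ Ideal.span {f', pderiv ℂ 1 f', q} := fun q =>
    Ideal.span_mono (by rintro x (rfl | rfl) <;> simp) hN'
  obtain ⟨m', hm'⟩ := exists_colen_polar_eq hcf0' hcf' (mem_span_polar hN')
  -- the cofactors
  have hh₁ := le_order_cofactor hf hA₁ hB₁ e₁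
  have hh₂ := le_order_cofactor hf hA₂ hB₂ e₂
  obtain ⟨k₁, hk₁⟩ := X_zero_pow_dvd_blowUp ε hh₁
  obtain ⟨k₂, hk₂⟩ := X_zero_pow_dvd_blowUp ε hh₂
  obtain ⟨b₁, hb₁, hA₁'⟩ := exists_pullback hB₁ ha₁
  obtain ⟨b₂, hb₂, hA₂'⟩ := exists_pullback hB₂ ha₂
  have r₁ := blowUp_cofactor hE e₁ hb₁ hA₁' hk₁
  have r₂ := blowUp_cofactor hE e₂ hb₂ hA₂' hk₂
  have hdet' : a₁ * b₂ - a₂ * b₁ = blowUp ε u * f' := by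
    have h := congrArg (blowUp ε) hdet
    rw [map_sub, map_mul, map_mul, map_mul, hE, hA₁', hA₂', hb₁, hb₂] at h
    refine mul_left_cancel₀ (pow_ne_zero (n₁ + n₂ + 1 + 1) prime_X_zero.ne_zero) ?_
    linear_combination h
  have huE : IsUnit (blowUp ε u) := hu.map _
  -- the colengths of the cofactors
  have c₁ := colen_eq_of_basis hf0 hu e₁ e₂ hdet fun g hp hq =>
    dvd_of_dvd_mul_of_mem hXf (Ideal.span_mono (by rintro x (rfl | rfl) <;> simp) hN :
      X 0 ^ N ∈ Ideal.span {f, pderiv ℂ 1 f, pderiv ℂ 0 f}) hp hq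
  have c₂ := colen_eq_of_basis hf0' huE r₁ r₂ hdet' fun g hp hq =>
    dvd_of_dvd_mul_of_mem hXf' (hN3 _) hp hq
  -- Moving the multiple of f' to the right side gives the cofactors relative to the pair (f'_y, x
  -- f'_x).
  have s₁ : a₁ * pderiv ℂ 1 f' - b₁ * (X 0 * pderiv ℂ 0 f') =
      (k₁ + C ((n₁ + n₂ + 1 + 1 : ℕ) : ℂ) * b₁) * f' := by linear_combination r₁
  have s₂ : a₂ * pderiv ℂ 1 f' - b₂ * (X 0 * pderiv ℂ 0 f') =
      (k₂ + C ((n₁ + n₂ + 1 + 1 : ℕ) : ℂ) * b₂) * f' := by linear_combination r₂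
  set l₁ := k₁ + C ((n₁ + n₂ + 1 + 1 : ℕ) : ℂ) * b₁
  set l₂ := k₂ + C ((n₁ + n₂ + 1 + 1 : ℕ) : ℂ) * b₂
  have c₃ := colen_eq_of_basis hf0' huE s₁ s₂ hdet' fun g hp hq =>
    dvd_of_dvd_mul_of_mem hXf' (hN3 _) hp hq
  -- `c₂` and `c₃` have the same left side by Teissier's lemma, and the same last term because
  -- adding a multiple of f' changes nothing once f' is a generator. The common term is finite and
  -- cancels.
  have hkl : colen (Ideal.span {k₁, k₂}) = colen (Ideal.span {l₁, l₂}) := by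
    have hT : Ideal.span {f', pderiv ℂ 1 f',
        X 0 * pderiv ℂ 0 f' + C ((n₁ + n₂ + 1 + 1 : ℕ) : ℂ) * f'} =
        Ideal.span {f', pderiv ℂ 1 f', X 0 * pderiv ℂ 0 f'} := by
      rw [Set.insert_comm, Set.insert_comm f', Ideal.span_insert, mul_comm (C _) f',
        span_pair_add_mul, ← Ideal.span_insert]
    rw [hm', hT] at c₂
    have h0 := hm' 0
    simp only [Nat.cast_zero, map_zero, zero_mul, add_zero] at h0
    rw [h0, c₂] at c₃
    exact (ENat.add_left_injective_of_ne_top fun h => ENat.natCast_ne_top m' (by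
      rw [c₂, h, add_top])) c₃
  have hu1 : u * pderiv ℂ 1 f = B₂ * h₁ - B₁ * h₂ := by
    refine mul_right_cancel₀ hf0 ?_
    linear_combination -pderiv ℂ 1 f * hdet + B₂ * e₁ - B₁ * e₂
  obtain ⟨hor, hcone⟩ := cofactor_tangents hc ht hf.ge hB₁ hB₂ hh₁ hh₂ hu hu1
  have hhfin : colen (Ideal.span {h₁, h₂}) ≠ ⊤ := by
    rw [Set.pair_comm, c₁] at hfin
    exact fun h => hfin (by rw [h, top_add])
  obtain ⟨M, hM⟩ := exists_pow_mem_of_colen_ne_top hhfin (x := X 0)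
    (by rw [← constantCoeff_eq_cf]; simp)
  have hnoether : colen (Ideal.span {h₁, h₂}) = n₁ * n₂ + colen (Ideal.span {k₁, k₂}) := by
    rcases hor with h | h
    · exact colen_eq_mul_add_colen_blowUp hh₁ hh₂ hk₁ hk₂ h hM hcone
    · rw [Set.pair_comm] at hM
      rw [Set.pair_comm, Set.pair_comm k₁, mul_comm]
      exact colen_eq_mul_add_colen_blowUp hh₂ hh₁ hk₂ hk₁ h hM fun z hz h2 h1 => hcone z hz h1 h2
  -- The roles of the two forms are interchanged if needed; this only changes the sign of the
  -- determinant.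
  have hstep : ∃ e : ℕ, min (restr a₁).order (restr a₂).order = e + 1 ∧
      colen (Ideal.span {l₁, l₂}) + colen (Ideal.span {f', pderiv ℂ 1 f', pderiv ℂ 0 f'}) =
        colen (Ideal.span {pderiv ℂ 1 f', pderiv ℂ 0 f'}) + e := by
    rcases le_total (restr a₁).order (restr a₂).order with h | h
    · rw [min_eq_left h]
      exact colen_eq_add_of_order_le hc (Nat.succ_ne_zero _) hr huE (hN3 _) s₁ s₂ hdet' h
    · rw [min_eq_right h, Set.pair_comm l₁]
      exact colen_eq_add_of_order_le hc (Nat.succ_ne_zero _) hr huE.neg (hN3 _) s₂ s₁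
        (by linear_combination -hdet') h
  obtain ⟨e, he, hstep⟩ := hstep
  refine ⟨e, he, hfin', ?_⟩
  rw [Set.pair_comm (pderiv ℂ 0 f), Set.pair_comm (pderiv ℂ 0 f'), c₁, hnoether, hkl]
  calc (n₁ * n₂ + colen (Ideal.span {l₁, l₂}) +
        colen (Ideal.span {f, pderiv ℂ 1 f, pderiv ℂ 0 f})) +
        colen (Ideal.span {f', pderiv ℂ 1 f', pderiv ℂ 0 f'}) =
      (colen (Ideal.span {l₁, l₂}) + colen (Ideal.span {f', pderiv ℂ 1 f', pderiv ℂ 0 f'})) +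
        (n₁ * n₂ + colen (Ideal.span {f, pderiv ℂ 1 f, pderiv ℂ 0 f})) := by ring
    _ = _ := by rw [hstep]; ring

end Formula

/-! ### The index as an order on the exceptional divisor. -/

section Index

theorem exists_pullback_coeff (ε : ℂ) {A B : 𝓡} {d : ℕ} (hA : (d : ℕ∞) ≤ order A)
    (hB : (d : ℕ∞) ≤ order B) :
    ∃ a, blowUp ε A + (X 1 - C ε) * blowUp ε B = X 0 ^ d * a ∧
      restr a = shiftCoe ε (dehom d A + Polynomial.X * dehom d B) := by
  obtain ⟨a, ha⟩ := X_zero_pow_dvd_blowUp ε hA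
  obtain ⟨b, hb⟩ := X_zero_pow_dvd_blowUp ε hB
  refine ⟨a + (X 1 - C ε) * b, by rw [ha, hb]; ring, ?_⟩
  rw [map_add, map_mul, map_sub, restr_X_one, restr_C, restr_of_blowUp_eq ha,
    restr_of_blowUp_eq hb, map_add, map_mul, shiftCoe_X]

/-- The index of a form is the order at the infinitely near point of the pull-back's coefficient. -/
theorem index_eq_order {ε : ℂ} {ω : OneForm} {a : 𝓡}
    (ha : blowUp ε (ω.1 : 𝓡) + (X 1 - C ε) * blowUp ε (ω.2 : 𝓡) = X 0 ^ (formMult ω).toNat * a) :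
    index ε ω = (restr a).order := by
  have h : ((formMult ω).toNat : ℕ∞) ≤ min (mult ω.1) (mult ω.2) := ENat.natCast_toNat_le_self _
  obtain ⟨a', ha', hr⟩ := exists_pullback_coeff ε (h.trans (min_le_left _ _))
    (h.trans (min_le_right _ _))
  obtain rfl : a = a' :=
    mul_left_cancel₀ (pow_ne_zero _ prime_X_zero.ne_zero) (ha.symm.trans ha')
  rw [hr, PowerSeries.order_eq_emultiplicity_X, index, emultiplicity_eq_emultiplicity_iff]
  intro n
  rw [X_pow_dvd_shiftCoe_iff]
  rfl

/-- By Cramer g₁ u f = A B₂ - B A₂ has order at least d + ν₂, and f has order exactly ν₁ + ν₂; so g₁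
has order at least d - ν₁, and similarly for g₂. After dividing by x^d, a is thus a combination of
a₁ and a₂ with power series coefficients. This is where goodness of the basis enters. -/
theorem min_le_order_restr {ε : ℂ} {A B A₁ A₂ B₁ B₂ g₁ g₂ u f a a₁ a₂ : 𝓡} {ν₁ ν₂ d : ℕ}
    (hu : IsUnit u) (hf : order f = (ν₁ + ν₂ : ℕ))
    (hA : (d : ℕ∞) ≤ order A) (hB : (d : ℕ∞) ≤ order B)
    (hA₁ : (ν₁ : ℕ∞) ≤ order A₁) (hB₁ : (ν₁ : ℕ∞) ≤ order B₁)
    (hA₂ : (ν₂ : ℕ∞) ≤ order A₂) (hB₂ : (ν₂ : ℕ∞) ≤ order B₂)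
    (eA : A = g₁ * A₁ + g₂ * A₂) (eB : B = g₁ * B₁ + g₂ * B₂) (hdet : A₁ * B₂ - A₂ * B₁ = u * f)
    (ha₁ : blowUp ε A₁ + (X 1 - C ε) * blowUp ε B₁ = X 0 ^ ν₁ * a₁)
    (ha₂ : blowUp ε A₂ + (X 1 - C ε) * blowUp ε B₂ = X 0 ^ ν₂ * a₂)
    (ha : blowUp ε A + (X 1 - C ε) * blowUp ε B = X 0 ^ d * a) :
    min (restr a₁).order (restr a₂).order ≤ (restr a).order := by
  obtain ⟨v, hv⟩ := hu.exists_left_inv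
  have key : ∀ {g : 𝓡} {m n : ℕ}, order f = (m + n : ℕ) →
      ((d + n : ℕ) : ℕ∞) ≤ order (g * (u * f)) → ∃ γ, blowUp ε g * X 0 ^ m = X 0 ^ d * γ := by
    intro g m n hmn h
    -- Multiplying by x^m expresses ord g ≥ d - m without subtraction.
    have h1 : (d : ℕ∞) ≤ order (g * X 0 ^ m) := by
      have h2 : order (v * (g * (u * f))) = order g + order f := by
        rw [show v * (g * (u * f)) = g * f by linear_combination g * f * hv]
        exact order_mul g f
      have h3 : ((d + n : ℕ) : ℕ∞) ≤ order g + order f := by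
        rw [← h2]
        exact h.trans (le_add_self.trans le_order_mul)
      rw [hmn] at h3
      have h4 : (d : ℕ∞) + n ≤ (order g + m) + n := by
        refine le_trans (by push_cast; rfl) (h3.trans_eq ?_)
        push_cast; ring
      have h5 := (ENat.add_le_add_iff_right (ENat.natCast_ne_top n)).1 h4
      refine h5.trans (le_trans ?_ le_order_mul)
      gcongr
      calc (m : ℕ∞) = m • 1 := by simp
        _ ≤ m • order (X 0 : 𝓡) := by
          gcongr
          exact one_le_order_of_constantCoeff (by simp)
        _ ≤ _ := le_order_pow m
    obtain ⟨γ, hγ⟩ := X_zero_pow_dvd_blowUp ε h1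
    exact ⟨γ, by rw [← hγ, map_mul, map_pow, blowUp_X_zero]⟩
  have hsub : ∀ {p q : 𝓡} {m : ℕ∞}, m ≤ order p → m ≤ order q → m ≤ order (p - q) := by
    intro p q m hp hq
    rw [sub_eq_add_neg]
    exact le_order_add hp (by rwa [order_neg])
  obtain ⟨γ₁, hγ₁⟩ := key (g := g₁) (m := ν₁) (n := ν₂) hf (by
    rw [show g₁ * (u * f) = A * B₂ - B * A₂ by rw [← hdet, eA, eB]; ring]
    push_cast
    exact hsub ((add_le_add hA hB₂).trans le_order_mul) ((add_le_add hB hA₂).trans le_order_mul))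
  obtain ⟨γ₂, hγ₂⟩ := key (g := g₂) (m := ν₂) (n := ν₁) (by rw [hf, add_comm]) (by
    rw [show g₂ * (u * f) = B * A₁ - A * B₁ by rw [← hdet, eA, eB]; ring]
    push_cast
    exact hsub ((add_le_add hB hA₁).trans le_order_mul) ((add_le_add hA hB₁).trans le_order_mul))
  have h : a = γ₁ * a₁ + γ₂ * a₂ := by
    refine mul_left_cancel₀ (pow_ne_zero d prime_X_zero.ne_zero) ?_
    rw [← ha, eA, eB, map_add, map_add, map_mul, map_mul, map_mul, map_mul]
    linear_combination blowUp ε g₁ * ha₁ + blowUp ε g₂ * ha₂ + a₁ * hγ₁ + a₂ * hγ₂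
  rw [h, map_add, map_mul, map_mul]
  refine le_trans (min_le_min ?_ ?_) (PowerSeries.min_order_le_order_add _ _)
  · rw [PowerSeries.order_mul]; exact le_add_self
  · rw [PowerSeries.order_mul]; exact le_add_self

end Index

/-! ### Saito's criterion for a basis. -/

section Saito

theorem exists_coords {f : 𝒪} (ω : Module.Basis (Fin 2) 𝒪 (saitoModule f)) {η : OneForm}
    (hη : η ∈ saitoModule f) : ∃ g₁ g₂ : 𝒪,
      η.1 = g₁ * (ω 0 : OneForm).1 + g₂ * (ω 1 : OneForm).1 ∧
      η.2 = g₁ * (ω 0 : OneForm).2 + g₂ * (ω 1 : OneForm).2 := by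
  have h := congrArg (Submodule.subtype _) (ω.sum_repr ⟨η, hη⟩)
  rw [Fin.sum_univ_two, map_add, map_smul, map_smul] at h
  exact ⟨ω.repr ⟨η, hη⟩ 0, ω.repr ⟨η, hη⟩ 1, congrArg Prod.fst h.symm, congrArg Prod.snd h.symm⟩

/-- Saito's criterion. -/
theorem exists_unit_det {f A₁ A₂ B₁ B₂ h₁ h₂ : 𝓡} {N M : ℕ} (hXf : ¬ X 0 ∣ f)
    (hN : X 0 ^ N ∈ Ideal.span {f, pderiv ℂ 0 f, pderiv ℂ 1 f})
    (hM : X 1 ^ M ∈ Ideal.span {f, pderiv ℂ 0 f, pderiv ℂ 1 f})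
    (e₁ : A₁ * pderiv ℂ 1 f - B₁ * pderiv ℂ 0 f = h₁ * f)
    (e₂ : A₂ * pderiv ℂ 1 f - B₂ * pderiv ℂ 0 f = h₂ * f)
    (d₀ : A₁ * B₂ - A₂ * B₁ ∣ f * f) (d₁ : A₁ * B₂ - A₂ * B₁ ∣ f * pderiv ℂ 0 f)
    (d₂ : A₁ * B₂ - A₂ * B₁ ∣ f * pderiv ℂ 1 f) :
    ∃ u, IsUnit u ∧ A₁ * B₂ - A₂ * B₁ = u * f := by
  have hf0 : f ≠ 0 := by rintro rfl; exact hXf (dvd_zero _)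
  -- The determinant times f_x and times f_y is a combination of the two cofactor relations.
  obtain ⟨u, hu⟩ : f ∣ A₁ * B₂ - A₂ * B₁ := by
    refine dvd_of_dvd_mul_of_mem hXf hN ⟨A₂ * h₁ - A₁ * h₂, ?_⟩ ⟨B₂ * h₁ - B₁ * h₂, ?_⟩
    · linear_combination A₂ * e₁ - A₁ * e₂
    · linear_combination B₂ * e₁ - B₁ * e₂
  refine ⟨u, ?_, by rw [hu, mul_comm]⟩
  -- Cancelling f shows that u divides the whole Tjurina ideal, in particular x^N and y^M; having no
  -- common prime factor, these leave only a unit.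
  have key : ∀ z ∈ Ideal.span {f, pderiv ℂ 0 f, pderiv ℂ 1 f}, u ∣ z := by
    intro z hz
    obtain ⟨r, s, t, rfl⟩ := mem_span_triple'.1 hz
    rw [hu] at d₀ d₁ d₂
    rw [mul_dvd_mul_iff_left hf0] at d₀ d₁ d₂
    exact dvd_add (dvd_add (d₀.mul_right _) (d₁.mul_right _)) (d₂.mul_right _)
  obtain ⟨i, -, hi⟩ := (dvd_prime_pow prime_X_zero N).1 (key _ hN)
  rcases i with _ | i
  · rw [pow_zero] at hi
    exact hi.symm.isUnit isUnit_one
  · exfalso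
    have h1 : X 0 ∣ (X 1 : 𝓡) ^ M :=
      (dvd_pow_self _ (Nat.succ_ne_zero i)).trans (hi.symm.dvd.trans (key _ hM))
    have h2 := restr_eq_zero_iff.2 (prime_X_zero.dvd_of_dvd_pow h1)
    rw [restr_X_one] at h2
    exact PowerSeries.X_ne_zero h2

/-- The determinant of a basis of `Ω¹(S)` divides `f` times the Tjurina ideal. -/
theorem det_dvd {f : 𝒪} (ω : Module.Basis (Fin 2) 𝒪 (saitoModule f)) :
    let w := (ω 0 : OneForm).1 * (ω 1 : OneForm).2 - (ω 1 : OneForm).1 * (ω 0 : OneForm).2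
    w ∣ f * f ∧ w ∣ f * partialDeriv 0 f ∧ w ∣ f * partialDeriv 1 f := by
  intro w
  have key : ∀ {η θ : OneForm}, η ∈ saitoModule f → θ ∈ saitoModule f →
      w ∣ η.1 * θ.2 - θ.1 * η.2 := by
    intro η θ hη hθ
    obtain ⟨g₁, g₂, h₁, h₂⟩ := exists_coords ω hη
    obtain ⟨k₁, k₂, l₁, l₂⟩ := exists_coords ω hθ
    refine ⟨g₁ * k₂ - g₂ * k₁, ?_⟩
    rw [h₁, h₂, l₁, l₂]; ring
  -- The minors of the three forms f dx, f dy and df give f times the generators of the Tjurina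
  -- ideal.
  have m₁ : ((f, 0) : OneForm) ∈ saitoModule f := (mem_saitoModule _ _).2 (by simp)
  have m₂ : ((0, f) : OneForm) ∈ saitoModule f :=
    (mem_saitoModule _ _).2 ⟨-partialDeriv 0 f, by ring⟩
  have m₃ : ((partialDeriv 0 f, partialDeriv 1 f) : OneForm) ∈ saitoModule f :=
    (mem_saitoModule _ _).2 ⟨0, by ring⟩
  refine ⟨?_, ?_, ?_⟩
  · simpa using key m₁ m₂
  · simpa [mul_comm] using key m₃ m₂
  · simpa using key m₁ m₃

end Saito

/-! ### Assembly for convergent germs. -/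

section Conclusion

/-- The basis forms themselves give one inequality, `min_le_order_restr` the other. -/
theorem minIndex_eq {f : 𝒪} {ε : ℂ} (ω : Module.Basis (Fin 2) 𝒪 (saitoModule f)) {ν₁ ν₂ : ℕ}
    (hν₁ : formMult (ω 0 : OneForm) = ν₁) (hν₂ : formMult (ω 1 : OneForm) = ν₂)
    (hf : order (f : 𝓡) = (ν₁ + ν₂ : ℕ)) {u a₁ a₂ : 𝓡} (hu : IsUnit u)
    (hdet : ((ω 0 : OneForm).1 : 𝓡) * (ω 1 : OneForm).2 - (ω 1 : OneForm).1 * (ω 0 : OneForm).2 =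
      u * f)
    (ha₁ : blowUp ε (ω 0 : OneForm).1 + (X 1 - C ε) * blowUp ε (ω 0 : OneForm).2 = X 0 ^ ν₁ * a₁)
    (ha₂ : blowUp ε (ω 1 : OneForm).1 + (X 1 - C ε) * blowUp ε (ω 1 : OneForm).2 =
      X 0 ^ ν₂ * a₂) :
    minIndex ε f = min (restr a₁).order (restr a₂).order := by
  have i₁ : index ε (ω 0 : OneForm) = (restr a₁).order :=
    index_eq_order (by rw [hν₁, ENat.toNat_natCast]; exact ha₁)
  have i₂ : index ε (ω 1 : OneForm) = (restr a₂).order :=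
    index_eq_order (by rw [hν₂, ENat.toNat_natCast]; exact ha₂)
  apply le_antisymm
  · rw [← i₁, ← i₂]
    exact le_min (iInf₂_le _ (ω 0).2) (iInf₂_le _ (ω 1).2)
  · refine le_iInf₂ fun η hη => ?_
    have h : ((formMult η).toNat : ℕ∞) ≤ min (mult η.1) (mult η.2) := ENat.natCast_toNat_le_self _
    have hA := h.trans (min_le_left _ _)
    have hB := h.trans (min_le_right _ _)
    obtain ⟨a, ha, -⟩ := exists_pullback_coeff ε hA hB
    rw [index_eq_order ha]
    obtain ⟨g₁, g₂, e₁, e₂⟩ := exists_coords ω hη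
    exact min_le_order_restr (g₁ := g₁) (g₂ := g₂) hu hf hA hB
      (hν₁.ge.trans (min_le_left _ _)) (hν₁.ge.trans (min_le_right _ _))
      (hν₂.ge.trans (min_le_left _ _)) (hν₂.ge.trans (min_le_right _ _))
      (congrArg Subtype.val e₁) (congrArg Subtype.val e₂) hdet ha₁ ha₂ ha

theorem exists_cofactor {f : 𝒪} {η : OneForm} (hη : η ∈ saitoModule f) :
    ∃ h : 𝓡, (η.1 : 𝓡) * pderiv ℂ 1 (f : 𝓡) - (η.2 : 𝓡) * pderiv ℂ 0 (f : 𝓡) = h * f := by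
  obtain ⟨h, hh⟩ := (mem_saitoModule _ _).1 hη
  refine ⟨h, ?_⟩
  rw [mul_comm (h : 𝓡)]
  exact congrArg Subtype.val hh

theorem milnor_sub_tjurina (f : 𝒪) (hirr : Irreducible f) (hsing : 2 ≤ mult f) (ε : ℂ)
    (htan : HasTangent ε f) (ω : Module.Basis (Fin 2) 𝒪 (saitoModule f)) (ν₁ ν₂ : ℕ)
    (hν₁ : formMult (ω 0 : OneForm) = ν₁) (hν₂ : formMult (ω 1 : OneForm) = ν₂)
    (hgood : mult f = ν₁ + ν₂) (f' : 𝒪) (hstrict : IsStrictTransform ε f f') :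
    Module.Finite ℂ (𝒪 ⧸ jacobianIdeal f) ∧ Module.Finite ℂ (𝒪 ⧸ jacobianIdeal f') ∧
    minIndex ε f ≠ ⊤ ∧
    (milnorNumber f : ℤ) - tjurinaNumber f = (milnorNumber f' : ℤ) - tjurinaNumber f' +
        ((ν₁ : ℤ) - 1) * ((ν₂ : ℤ) - 1) + (minIndex ε f).toNat - 1 := by
  have hord : order (f : 𝓡) = (ν₁ + ν₂ : ℕ) := hgood.trans (by push_cast; rfl)
  have hnat : (mult f).toNat = ν₁ + ν₂ := by
    rw [mult, hord, ENat.toNat_natCast]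
  obtain ⟨c, hc, hhom⟩ := htan
  rw [IsStrictTransform, blowUpPullback_eq, hnat] at hstrict
  rw [hnat] at hhom
  have ht := dehom_tangent hhom
  have h2 : 2 ≤ ν₁ + ν₂ := by
    rw [mult, hord] at hsing
    exact_mod_cast hsing
  have hcf : cf (f : 𝓡) 0 (ν₁ + ν₂) ≠ 0 := by
    have := congrArg (fun p => p.coeff (ν₁ + ν₂)) ht
    simp only [coeff_dehom, Polynomial.coeff_C_mul, Polynomial.coeff_X_add_C_pow] at this
    rw [if_pos le_rfl, Nat.sub_self] at this
    rw [this]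
    simpa using hc
  have hcf0 : ∀ j < ν₁ + ν₂, cf (f : 𝓡) 0 j = 0 := fun j hj =>
    le_order_iff.1 hord.ge 0 j (by omega)
  have hXf := not_X_zero_dvd hcf
  obtain ⟨N, r, s, hrs⟩ := exists_X_pow_mem hirr hcf0 hcf
  have hN : X 0 ^ N ∈ Ideal.span {(f : 𝓡), pderiv ℂ 1 (f : 𝓡)} :=
    mem_span_pair'.2 ⟨r, s, by
      rw [mul_comm (f : 𝓡), mul_comm (pderiv ℂ 1 (f : 𝓡))]
      exact congrArg Subtype.val hrs⟩
  have hfin : colen (Ideal.span {pderiv ℂ 0 (f : 𝓡), pderiv ℂ 1 (f : 𝓡)}) ≠ ⊤ := by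
    obtain ⟨n, hn⟩ : ∃ n, ν₁ + ν₂ = n + 1 := ⟨ν₁ + ν₂ - 1, by omega⟩
    exact colen_jacobian_ne_top (n := n) (fun j hj => hcf0 j (by omega)) (hn ▸ hcf)
      (mem_span_polar hN)
  have hfinT : colen (Ideal.span {(f : 𝓡), pderiv ℂ 0 (f : 𝓡), pderiv ℂ 1 (f : 𝓡)}) ≠ ⊤ :=
    ne_top_of_le_ne_top hfin (colen_mono (Ideal.span_mono (Set.subset_insert _ _)))
  obtain ⟨h₁, e₁⟩ := exists_cofactor (ω 0).2
  obtain ⟨h₂, e₂⟩ := exists_cofactor (ω 1).2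
  have hord2 : 2 ≤ order (f : 𝓡) := hsing
  -- A form not vanishing at the origin would give a nonsingular vector field preserving the Tjurina
  -- ideal. So ν_i - 1 is a natural number and can serve as the order bound for the cofactor.
  have hp₁ : 1 ≤ ν₁ := by
    have := le_min (one_le_of_preserves hord2 hfinT e₁).1 (one_le_of_preserves hord2 hfinT e₁).2
    exact_mod_cast (this.trans_eq hν₁ : (1 : ℕ∞) ≤ ν₁)
  have hp₂ : 1 ≤ ν₂ := by
    have := le_min (one_le_of_preserves hord2 hfinT e₂).1 (one_le_of_preserves hord2 hfinT e₂).2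
    exact_mod_cast (this.trans_eq hν₂ : (1 : ℕ∞) ≤ ν₂)
  obtain ⟨n₁, rfl⟩ := Nat.exists_eq_add_of_le' hp₁
  obtain ⟨n₂, rfl⟩ := Nat.exists_eq_add_of_le' hp₂
  obtain ⟨M, hM⟩ := exists_pow_mem_of_colen_ne_top hfinT (x := X 1)
    (by rw [← constantCoeff_eq_cf]; simp)
  have hN3 : X 0 ^ N ∈ Ideal.span {(f : 𝓡), pderiv ℂ 0 (f : 𝓡), pderiv ℂ 1 (f : 𝓡)} :=
    Ideal.span_mono (by rintro x (rfl | rfl) <;> simp) hN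
  obtain ⟨d₀, d₁, d₂⟩ := det_dvd ω
  obtain ⟨u, hu, hdet⟩ := exists_unit_det hXf hN3 hM e₁ e₂ (map_dvd convergentSeries.val d₀)
    (map_dvd convergentSeries.val d₁) (map_dvd convergentSeries.val d₂)
  have hA₁ := hν₁.ge.trans (min_le_left _ _)
  have hB₁ := hν₁.ge.trans (min_le_right _ _)
  have hA₂ := hν₂.ge.trans (min_le_left _ _)
  have hB₂ := hν₂.ge.trans (min_le_right _ _)
  obtain ⟨a₁, ha₁, -⟩ := exists_pullback_coeff ε hA₁ hB₁
  obtain ⟨a₂, ha₂, -⟩ := exists_pullback_coeff ε hA₂ hB₂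
  have hidx := minIndex_eq ω hν₁ hν₂ hord hu hdet ha₁ ha₂
  have hsum : n₁ + 1 + (n₂ + 1) = n₁ + n₂ + 1 + 1 := by ring
  rw [hsum] at hord ht hstrict
  obtain ⟨e, he, hfin', hformula⟩ := colen_formula hc hord ht hstrict hu hN hA₁ hB₁ hA₂ hB₂ e₁ e₂
    hdet ha₁ ha₂
  obtain ⟨F, hμ, hτ⟩ := milnor_tjurina_eq hfin
  obtain ⟨F', hμ', hτ'⟩ := milnor_tjurina_eq hfin'
  rw [he] at hidx
  refine ⟨F, F', ?_, ?_⟩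
  · rw [hidx]
    exact_mod_cast ENat.natCast_ne_top (e + 1)
  · rw [← hμ, ← hτ, ← hμ', ← hτ'] at hformula
    have h3 : milnorNumber f + tjurinaNumber f' = tjurinaNumber f + milnorNumber f' + n₁ * n₂ + e := by
      exact_mod_cast hformula
    have h4 : (minIndex ε f).toNat = e + 1 := by
      rw [hidx]
      exact_mod_cast ENat.toNat_natCast (e + 1)
    rw [h4]
    zify at h3
    push_cast
    linear_combination h3

end Conclusion

end PlaneBranch

end

theorem mainTheorem1
    -- a plane branch `S : {f = 0}`, singular at the origin
    (f : PlaneBranch.𝒪) (hirr : Irreducible f) (hsing : 2 ≤ PlaneBranch.mult f)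
    -- with tangent line `y + ε x = 0`
    (ε : ℂ) (htan : PlaneBranch.HasTangent ε f)
    -- a good Saito basis
    (ω : Module.Basis (Fin 2) PlaneBranch.𝒪 (PlaneBranch.saitoModule f))
    (ν₁ ν₂ : ℕ)
    (hν₁ : PlaneBranch.formMult (ω 0 : PlaneBranch.OneForm) = ν₁)
    (hν₂ : PlaneBranch.formMult (ω 1 : PlaneBranch.OneForm) = ν₂)
    (hgood : PlaneBranch.mult f = ν₁ + ν₂)
    -- the strict transform of `S`
    (f' : PlaneBranch.𝒪) (hstrict : PlaneBranch.IsStrictTransform ε f f') :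
    Module.Finite ℂ (PlaneBranch.𝒪 ⧸ PlaneBranch.jacobianIdeal f) ∧
    Module.Finite ℂ (PlaneBranch.𝒪 ⧸ PlaneBranch.jacobianIdeal f') ∧
    PlaneBranch.minIndex ε f ≠ ⊤ ∧
    (PlaneBranch.milnorNumber f : ℤ) - PlaneBranch.tjurinaNumber f =
      (PlaneBranch.milnorNumber f' : ℤ) - PlaneBranch.tjurinaNumber f' +
        ((ν₁ : ℤ) - 1) * ((ν₂ : ℤ) - 1) + (PlaneBranch.minIndex ε f).toNat - 1 := by
  exact PlaneBranch.milnor_sub_tjurina f hirr hsing ε htan ω ν₁ ν₂ hν₁ hν₂ hgood f' hstrict
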